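/- Let $d\ge 2$ and let $a<b$ be real numbers. Let $\Omega$ be the set of triples $\omega=(P,Q,W)$ of (a.e. classes of) functions in $L^\infty([a,b],\mathbb R^{d\times d})$ with symmetric values for which there are $\mu_1,\mu_2>0$ with $P(t)\ge\mu_1$ and $W(t)\ge\mu_2$ for a.e. $t\in[a,b]$; $\Omega$ carries the product topology induced by $L^\infty([a,b],\mathbb R^{d\times d})$. Let $\mathcal B^{\mathbb C}$ be the set of classes $[A\,|\,B]$ of pairs of complex $2d\times 2d$ matrices with $\operatorname{rank}(A\,|\,B)=2d$ and $AB^*=BA^*$, where $(A\,|\,B)$ and $(TA\,|\,TB)$ are identified for all $T\in GL(2d,\mathbb C)$; $\mathcal B^{\mathbb C}$ carries the quotient topology. For $0\le k\le 2d$ let $\Sigma_k^{\mathbb C}=\{[A\,|\,B]\in\mathcal B^{\mathbb C}: n^0(B)=k\}$, where $n^0(B)=\dim\ker B$ is the geometric multiplicity of the eigenvalue $0$ of $B$. For $\omega=(P,Q,W)\in\Omega$ and $\mathbf A=[A\,|\,B]\in\mathcal B^{\mathbb C}$ consider the Sturm–Liouville problem $$-(Py')'+Qy=\lambda Wy\ \text{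 on }[a,b],\qquad (A\,|\,B)\begin{pmatrix}-y(a)\\ y(b)\\ (Py')(a)\\ (Py')(b)\end{pmatrix}=0,$$ where solutions $y:[a,b]\to\mathbb C^d$ are such that $y$ and $Py'$ are absolutely continuous and the equation holds almost everywhere. A number $\lambda\in\mathbb C$ is an eigenvalue if the problem has a nonzero solution. Let $\phi_{1,\lambda},\dots,\phi_{2d,\lambda}$ be the solutions of the equation for which the $2d\times2d$ matrix with columns $\begin{pmatrix}\phi_{j,\lambda}(a)\\(P\phi_{j,\lambda}')(a)\end{pmatrix}$ is the identity, and let $\Phi_\lambda$ and $\Psi_\lambda$ be the $2d\times 2d$ matrices with columns $\begin{pmatrix}-\phi_{j,\lambda}(a)\\ \phi_{j,\lambda}(b)\end{pmatrix}$ and $\begin{pmatrix}(P\phi_{j,\lambda}')(a)\\ (P\phi_{j,\lambda}')(b)\end{pmatrix}$. The analytic multiplicity of an eigenvalue $\lambda$ is its order as a zero of $\Gamma_{(\omega,\mathbf A)}(\lambda)=\det(A\Phi_\lambda+B\Psi_\lambda)$; it does not depend on the representative $(A\,|\,B)$. Then for every $(\omega,\mathbf A)\in\Omega\times\mathcal B^{\mathbb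 C}$ all eigenvalues are real and, repeated according to their analytic multiplicities, they form an infinite sequence $\lambda_1(\omega,\mathbf A)\le\lambda_2(\omega,\mathbf A)\le\cdots$ with $\lambda_n(\omega,\mathbf A)\to\infty$; and for every $n\ge1$ and every $0\le k\le 2d$, the restriction of the function $(\omega,\mathbf A)\mapsto\lambda_n(\omega,\mathbf A)$ to $\Omega\times\Sigma_k^{\mathbb C}$ is continuous. -/

import Mathlib

open MeasureTheory Filter Topology

open scoped Matrix ENNReal

namespace SturmLiouville

/-! ### The space of Sturm-Liouville equations -/

/-- `L^∞([a,b], ℝ^{d×d})`; the norm is the essential supremum of the largest entry. -/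
abbrev Coeff (d : ℕ) (a b : ℝ) : Type :=
  Lp (Fin d → Fin d → ℝ) ∞ (volume.restrict (Set.Icc a b))

/-- The value at `t` of a coefficient, as a real matrix. -/
noncomputable def Coeff.mat {d : ℕ} {a b : ℝ} (P : Coeff d a b) (t : ℝ) : Matrix (Fin d) (Fin d) ℝ :=
  Matrix.of (P t)

/-- The value at `t` of a coefficient, as a complex matrix. -/
noncomputable def Coeff.cmat {d : ℕ} {a b : ℝ} (P : Coeff d a b) (t : ℝ) : Matrix (Fin d) (Fin d) ℂ :=
  (P.mat t).map Complex.ofReal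

/-- The values of the coefficient are symmetric matrices. -/
def Coeff.Symmetric {d : ℕ} {a b : ℝ} (P : Coeff d a b) : Prop :=
  ∀ᵐ t ∂(volume.restrict (Set.Icc a b)), (P.mat t).IsSymm

/-- `P(t) ≥ μ` for almost every `t`, for some constant `μ > 0`. -/
def Coeff.UniformlyPositive {d : ℕ} {a b : ℝ} (P : Coeff d a b) : Prop :=
  ∃ μ : ℝ, 0 < μ ∧ ∀ᵐ t ∂(volume.restrict (Set.Icc a b)),
    (P.mat t - μ • (1 : Matrix (Fin d) (Fin d) ℝ)).PosSemidef

/-- The space `Ω` of Sturm-Liouville equations `-(Py')' + Qy = λWy`, i.e. of triples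
`(P, Q, W)`, with the subspace topology of `L^∞ × L^∞ × L^∞`. -/
abbrev Equation (d : ℕ) (a b : ℝ) : Type :=
  {ω : Coeff d a b × Coeff d a b × Coeff d a b //
    (ω.1.Symmetric ∧ ω.2.1.Symmetric ∧ ω.2.2.Symmetric) ∧
      ω.1.UniformlyPositive ∧ ω.2.2.UniformlyPositive}

namespace Equation

variable {d : ℕ} {a b : ℝ}

/-- The leading coefficient. -/
def P (ω : Equation d a b) : Coeff d a b := ω.1.1

/-- The potential. -/
def Q (ω : Equation d a b) : Coeff d a b := ω.1.2.1

/-- The weight. -/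
def W (ω : Equation d a b) : Coeff d a b := ω.1.2.2

/-- `y` is a solution of `-(Py')' + Qy = λWy` on `[a,b]` with quasi-derivative `z`: both `y` and
`z` are absolutely continuous, `z = Py'` almost everywhere and `-z' + Qy = λWy` almost
everywhere. Thus `z` is the continuous representative of `Py'`. -/
structure IsSolution (ω : Equation d a b) (lam : ℂ) (y z : ℝ → Fin d → ℂ) : Prop where
  ac_fun : AbsolutelyContinuousOnInterval y a b
  ac_quasi : AbsolutelyContinuousOnInterval z a b
  quasi_eq : ∀ᵐ t ∂(volume.restrict (Set.Icc a b)), z t = ω.P.cmat t *ᵥ deriv y t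
  eqn : ∀ᵐ t ∂(volume.restrict (Set.Icc a b)),
    -deriv z t + ω.Q.cmat t *ᵥ y t = lam • (ω.W.cmat t *ᵥ y t)

/-- `φ j` (with quasi-derivatives `ψ j`), `j = 1, …, 2d`, are the solutions for which the matrix
with columns `(φ j (a), ψ j (a))` is the identity. -/
def IsFundamentalSystem (ω : Equation d a b) (lam : ℂ)
    (φ ψ : Fin d ⊕ Fin d → ℝ → Fin d → ℂ) : Prop :=
  (∀ j, ω.IsSolution lam (φ j) (ψ j)) ∧
    (Matrix.of fun i j => Sum.elim (φ j a) (ψ j a) i) =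
      (1 : Matrix (Fin d ⊕ Fin d) (Fin d ⊕ Fin d) ℂ)

/-- The fundamental solutions `φ_{1,λ}, …, φ_{2d,λ}` with their quasi-derivatives. They exist and
are unique on `[a,b]`; what the functions do outside `[a,b]` is irrelevant. -/
noncomputable def fundamentalSystem (ω : Equation d a b) (lam : ℂ) :
    (Fin d ⊕ Fin d → ℝ → Fin d → ℂ) × (Fin d ⊕ Fin d → ℝ → Fin d → ℂ) :=
  Classical.epsilon fun q => ω.IsFundamentalSystem lam q.1 q.2

/-- The `2d × 2d` matrix with columns `(-φ_{j,λ}(a), φ_{j,λ}(b))`. -/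
noncomputable def Phi (ω : Equation d a b) (lam : ℂ) :
    Matrix (Fin d ⊕ Fin d) (Fin d ⊕ Fin d) ℂ :=
  Matrix.of fun i j =>
    Sum.elim (-(ω.fundamentalSystem lam).1 j a) ((ω.fundamentalSystem lam).1 j b) i

/-- The `2d × 2d` matrix with columns `((Pφ_{j,λ}')(a), (Pφ_{j,λ}')(b))`. -/
noncomputable def Psi (ω : Equation d a b) (lam : ℂ) :
    Matrix (Fin d ⊕ Fin d) (Fin d ⊕ Fin d) ℂ :=
  Matrix.of fun i j =>
    Sum.elim ((ω.fundamentalSystem lam).2 j a) ((ω.fundamentalSystem lam).2 j b) i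

end Equation

/-! ### The space of self-adjoint boundary conditions -/

/-- The `2d × 4d` complex matrices `(A | B)` with `rank (A | B) = 2d` and `AB* = BA*`. -/
abbrev BoundaryMatrix (d : ℕ) : Type :=
  {M : Matrix (Fin d ⊕ Fin d) (Fin d ⊕ Fin d) ℂ × Matrix (Fin d ⊕ Fin d) (Fin d ⊕ Fin d) ℂ //
    (Matrix.fromCols M.1 M.2).rank = 2 * d ∧ M.1 * M.2ᴴ = M.2 * M.1ᴴ}

/-- `(A | B)` and `(C | D)` are equivalent if `(C | D) = (TA | TB)` with `det T ≠ 0`. -/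
instance boundarySetoid (d : ℕ) : Setoid (BoundaryMatrix d) where
  r M N := ∃ T : Matrix (Fin d ⊕ Fin d) (Fin d ⊕ Fin d) ℂ,
    IsUnit T.det ∧ N.1.1 = T * M.1.1 ∧ N.1.2 = T * M.1.2
  iseqv :=
    { refl := fun M => ⟨1, by simp, by simp, by simp⟩
      symm := by
        rintro M N ⟨T, hT, h1, h2⟩
        refine ⟨T⁻¹, ?_, ?_, ?_⟩
        · exact Matrix.isUnit_nonsing_inv_det T hT
        · rw [h1, Matrix.nonsing_inv_mul_cancel_left _ _ hT]
        · rw [h2, Matrix.nonsing_inv_mul_cancel_left _ _ hT]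
      trans := by
        rintro M N L ⟨T, hT, h1, h2⟩ ⟨S, hS, h3, h4⟩
        refine ⟨S * T, ?_, ?_, ?_⟩
        · rw [Matrix.det_mul]
          exact hS.mul hT
        · rw [h3, h1, Matrix.mul_assoc]
        · rw [h4, h2, Matrix.mul_assoc] }

/-- The space of boundary conditions `[A | B]`, with the quotient topology. -/
abbrev BoundaryCondition (d : ℕ) : Type := Quotient (boundarySetoid d)

/-- `(A | B)(u, v) = 0`. -/
def BoundaryCondition.Holds {d : ℕ} (bc : BoundaryCondition d) (u v : Fin d ⊕ Fin d → ℂ) : Prop :=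
  Quotient.lift (fun M : BoundaryMatrix d => M.1.1 *ᵥ u + M.1.2 *ᵥ v = 0)
    (by
      rintro M N ⟨T, hT, h1, h2⟩
      refine propext ?_
      rw [h1, h2, ← Matrix.mulVec_mulVec, ← Matrix.mulVec_mulVec, ← Matrix.mulVec_add]
      refine ⟨fun h => by rw [h, Matrix.mulVec_zero], fun h => ?_⟩
      have h' := congrArg (fun w => T⁻¹ *ᵥ w) h
      simpa [Matrix.mulVec_mulVec, Matrix.nonsing_inv_mul _ hT] using h') bc

/-- `n⁰(B)` for `[A | B]`: the geometric multiplicity of the eigenvalue `0` of `B`. -/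
noncomputable def BoundaryCondition.nullityB {d : ℕ} (bc : BoundaryCondition d) : ℕ :=
  Quotient.lift
    (fun M : BoundaryMatrix d =>
      Module.finrank ℂ (Module.End.eigenspace (Matrix.toLin' M.1.2) (0 : ℂ)))
    (by
      rintro M N ⟨T, hT, h1, h2⟩
      have h : Module.End.eigenspace (Matrix.toLin' M.1.2) (0 : ℂ)
          = Module.End.eigenspace (Matrix.toLin' N.1.2) (0 : ℂ) := by
        ext w
        simp only [Module.End.mem_eigenspace_iff, Matrix.toLin'_apply, zero_smul]
        rw [h2, ← Matrix.mulVec_mulVec]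
        refine ⟨fun h => by rw [h, Matrix.mulVec_zero], fun h => ?_⟩
        have h' := congrArg (fun w => T⁻¹ *ᵥ w) h
        simpa [Matrix.mulVec_mulVec, ← Matrix.mul_assoc, Matrix.nonsing_inv_mul _ hT] using h'
      exact congrArg (fun V : Submodule ℂ (Fin d ⊕ Fin d → ℂ) => Module.finrank ℂ V) h) bc

/-- The `k`-th layer: the boundary conditions `[A | B]` with `n⁰(B) = k`. -/
def layer (d k : ℕ) : Set (BoundaryCondition d) := {bc | bc.nullityB = k}

/-! ### Eigenvalues -/

/-- A nonzero constant factor does not change the order of vanishing. -/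
theorem analyticOrderAt_const_mul {c : ℂ} (hc : c ≠ 0) (f : ℂ → ℂ) (z : ℂ) :
    analyticOrderAt (fun w => c * f w) z = analyticOrderAt f z := by
  by_cases hf : AnalyticAt ℂ f z
  · have h0 : analyticOrderAt (fun _ : ℂ => c) z = 0 :=
      analyticOrderAt_eq_zero.2 (Or.inr hc)
    have h := analyticOrderAt_mul (analyticAt_const (𝕜 := ℂ) (v := c) (x := z)) hf
    rw [h0, zero_add] at h
    exact h
  · have hg : ¬ AnalyticAt ℂ (fun w => c * f w) z := by
      intro h
      apply hf
      have h' := (analyticAt_const (𝕜 := ℂ) (v := c⁻¹) (x := z)).mul h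
      refine h'.congr (Eventually.of_forall fun w => ?_)
      simp [hc]
    rw [analyticOrderAt_of_not_analyticAt hf, analyticOrderAt_of_not_analyticAt hg]

section

variable {d : ℕ} {a b : ℝ}

/-- `λ` is an eigenvalue of the problem `(ω, bc)`: there is a solution `y`, not identically zero on
`[a,b]`, with `(A | B)(-y(a), y(b), (Py')(a), (Py')(b)) = 0`. -/
def IsEigenvalue (ω : Equation d a b) (bc : BoundaryCondition d) (lam : ℂ) : Prop :=
  ∃ y z : ℝ → Fin d → ℂ, ω.IsSolution lam y z ∧ (∃ t ∈ Set.Icc a b, y t ≠ 0) ∧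
    bc.Holds (Sum.elim (-y a) (y b)) (Sum.elim (z a) (z b))

/-- The function `Γ(λ) = det (A Φ_λ + B Ψ_λ)`. -/
noncomputable def charFun (ω : Equation d a b) (M : BoundaryMatrix d) (lam : ℂ) : ℂ :=
  (M.1.1 * ω.Phi lam + M.1.2 * ω.Psi lam).det

/-- The analytic multiplicity of `λ`: its order as a zero of `Γ`. -/
noncomputable def analyticMultiplicity (ω : Equation d a b) (bc : BoundaryCondition d) (lam : ℂ) :
    ℕ∞ :=
  Quotient.lift (fun M : BoundaryMatrix d => analyticOrderAt (charFun ω M) lam)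
    (by
      rintro M N ⟨T, hT, h1, h2⟩
      have h : charFun ω N = fun w => T.det * charFun ω M w := by
        funext w
        simp only [charFun]
        rw [h1, h2, Matrix.mul_assoc, Matrix.mul_assoc, ← Matrix.mul_add, Matrix.det_mul]
      simp only [h]
      exact (analyticOrderAt_const_mul hT.ne_zero _ _).symm) bc

/-- `s 0 ≤ s 1 ≤ s 2 ≤ ⋯` is the sequence of all eigenvalues of `(ω, bc)`, each repeated according
to its analytic multiplicity, and it tends to `∞`. In particular all eigenvalues are real and all
multiplicities finite. -/
structure IsEigenvalueSequence (ω : Equation d a b) (bc : BoundaryCondition d) (s : ℕ → ℝ) :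
    Prop where
  mono : Monotone s
  tendsto : Tendsto s atTop atTop
  isEigenvalue : ∀ n, IsEigenvalue ω bc (s n : ℂ)
  multiplicity : ∀ lam : ℂ, IsEigenvalue ω bc lam →
    {n : ℕ | (s n : ℂ) = lam}.encard = analyticMultiplicity ω bc lam

open Classical in
/-- The `n`-th eigenvalue `λ_n(ω, bc)`, `n ≥ 1`: the `n`-th term of the eigenvalue sequence (which
is unique if it exists). -/
noncomputable def nthEigenvalue (ω : Equation d a b) (bc : BoundaryCondition d) (n : ℕ) : ℝ :=
  if h : ∃ s, IsEigenvalueSequence ω bc s then h.choose (n - 1) else 0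

end

end SturmLiouville

/-! The eigenvalues are counted by the negative index of a quadratic form. Since $AB^*=BA^*$ and
$(A\,|\,B)$ has full rank, the pairs $(u,v)$ with $Au+Bv=0$ are exactly the pairs
$(B^*\xi,-A^*\xi)$. Integration by parts therefore turns the problem into a weak equation on the
space of $(y,\xi)$ with $(-y(a),y(b))=B^*\xi$, with the Hermitian form $q_\lambda(y,\xi)=\int
(y'^*Py'+y^*Qy)+\xi^*BA^*\xi-\lambda\int y^*Wy$. Let $i(\lambda)$ be the largest dimension of a
subspace on which $q_\lambda$ is negative definite. Only dimensions are compared, so functions with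
bounded derivative suffice and no completion of the form domain is needed.

A Gårding inequality (`exists_coercive`) shows that $i(\lambda)$ is finite and that it vanishes for
very negative $\lambda$; test functions that vanish at both ends show that it is unbounded. It is
nondecreasing and left-continuous, and at each real $\lambda$ it jumps by exactly the number of
independent solutions of the boundary value problem. At least that much, because eigenfunctions are
null vectors of $q_\lambda$ on which the weight is positive (`IndexGE.sub_smul`). At most that much,
because the inhomogeneous problem is boundedly solvable on a space of that codimension
(`exists_green`), which makes $q_\lambda$ dominate a multiple of the weight there, up to the
directions already counted (`exists_index_sub_smul_le`).

The number of solutions is also the order of the zero of $\Gamma$: symmetry excludes Jordan chains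
of the characteristic matrix (`charMatrix_ker_deriv`), and then the order of a determinant is the
nullity (`analyticOrderAt_det`). Hence the numbers $\inf\{\lambda : i(\lambda)\ge n+1\}$, the values
of `jump`, form the eigenvalue sequence (`encard_jump_eq`), and a monotone sequence is determined by
its multiplicities.

For continuity, two neighbouring problems are compared by a linear map between their form domains
that adds a small affine function (`exists_transfer`); it changes both forms by a small multiple of
the $H^1$ norm, so it transports negative subspaces after a small shift of $\lambda$
(`exists_index_le_of_close`). The map needs a parameter $\xi$ controlled by $B^*\xi$, uniformly in
the problem, that is, uniformly bounded generalized inverses of $B^*$. Near a given matrix these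
exist among matrices of the same rank (`exists_uniform_lift`), which is why the result is restricted
to the layers. The statement descends to classes $[A\,|\,B]$ because the quotient map is open. -/

namespace SturmLiouville

/-! ### Hermitian forms and their negative index -/

section Form

open ComplexConjugate

/-- Sesquilinear forms on a complex vector space. -/
abbrev SesqForm (D : Type*) [AddCommGroup D] [Module ℂ D] : Type _ := D →ₗ⋆[ℂ] D →ₗ[ℂ] ℂ

variable {D : Type*} [AddCommGroup D] [Module ℂ D]

/-- Every Hermitian form `q` satisfies `conj (q x y) = q y x`. -/
def IsHermForm (q : SesqForm D) : Prop := ∀ x y, conj (q x y) = q y x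

/-- The form `q` is negative definite on the subspace `U`. -/
def NegOn (q : SesqForm D) (U : Submodule ℂ D) : Prop :=
  ∀ x ∈ U, x ≠ 0 → (q x x).re < 0

/-- The negative index of `q` is at least `n`. -/
def IndexGE (q : SesqForm D) (n : ℕ) : Prop :=
  ∃ U : Submodule ℂ D, FiniteDimensional ℂ U ∧ Module.finrank ℂ U = n ∧ NegOn q U

theorem NegOn.mono_form {q q' : SesqForm D} {U : Submodule ℂ D} (h : NegOn q U)
    (hq : ∀ x, (q' x x).re ≤ (q x x).re) : NegOn q' U :=
  fun x hx h0 => (hq x).trans_lt (h x hx h0)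

theorem IndexGE.mono_form {q q' : SesqForm D} {n : ℕ} (h : IndexGE q n)
    (hq : ∀ x, (q' x x).re ≤ (q x x).re) : IndexGE q' n := by
  obtain ⟨U, h1, h2, h3⟩ := h
  exact ⟨U, h1, h2, h3.mono_form hq⟩

theorem indexGE_zero (q : SesqForm D) : IndexGE q 0 :=
  ⟨⊥, inferInstance, by simp, fun x hx h0 => absurd ((Submodule.mem_bot ℂ).1 hx) h0⟩

theorem IndexGE.of_le {q : SesqForm D} {m n : ℕ} (h : IndexGE q n) (hmn : m ≤ n) :
    IndexGE q m := by
  obtain ⟨U, h1, h2, h3⟩ := h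
  let b := Module.finBasisOfFinrankEq ℂ U h2
  have hli : LinearIndependent ℂ fun i : Fin m => ((b (Fin.castLE hmn i) : U) : D) :=
    (b.linearIndependent.map' U.subtype U.ker_subtype).comp _ (Fin.castLE_injective hmn)
  refine ⟨Submodule.span ℂ (Set.range fun i : Fin m => ((b (Fin.castLE hmn i) : U) : D)),
    FiniteDimensional.span_of_finite ℂ (Set.finite_range _), ?_, fun x hx h0 => h3 x ?_ h0⟩
  · simpa using finrank_span_eq_card hli
  · refine Submodule.span_le.2 ?_ hx
    rintro _ ⟨i, rfl⟩
    exact (b _).2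

/-- A form is dominated, on a finite-dimensional space, by any positive definite one. -/
theorem exists_form_le_mul (p q : SesqForm D) (U : Submodule ℂ D)
    [FiniteDimensional ℂ U] (hp : ∀ x ∈ U, x ≠ 0 → 0 < (p x x).re) :
    ∃ K : ℝ, 0 < K ∧ ∀ x ∈ U, (q x x).re ≤ K * (p x x).re := by
  let b := Module.finBasis ℂ U
  set n := Module.finrank ℂ U
  let φ : (Fin n → ℂ) → D := fun c => ∑ i, c i • (b i : D)
  have hφU : ∀ c, φ c ∈ U := fun c => Submodule.sum_mem _ fun i _ => U.smul_mem _ (b i).2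
  have hφ0 : ∀ c, φ c = 0 → c = 0 := by
    intro c hc
    have hli := (b.linearIndependent.map' U.subtype U.ker_subtype)
    rw [Fintype.linearIndependent_iff] at hli
    exact funext (hli c hc)
  have hφs : ∀ x ∈ U, ∃ c, φ c = x := by
    intro x hx
    refine ⟨fun i => b.repr ⟨x, hx⟩ i, ?_⟩
    have := congrArg (U.subtype) (b.sum_repr ⟨x, hx⟩)
    simpa only [map_sum, map_smul, Submodule.subtype_apply] using this
  have hφm : ∀ (t : ℂ) c, φ (t • c) = t • φ c := by
    intro t c
    simp [φ, Finset.smul_sum, mul_smul]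
  have hcont : ∀ r : SesqForm D, Continuous fun c => (r (φ c) (φ c)).re := by
    intro r
    simp only [φ, map_sum, LinearMap.sum_apply, map_smulₛₗ, LinearMap.smul_apply,
      smul_eq_mul, RingHom.id_apply]
    fun_prop
  have hhom : ∀ (r : SesqForm D) (t : ℝ) (x : D),
      (r ((t : ℂ) • x) ((t : ℂ) • x)).re = t ^ 2 * (r x x).re := by
    intro r t x
    simp only [map_smulₛₗ, LinearMap.smul_apply, smul_eq_mul, RingHom.id_apply, Complex.conj_ofReal,
      Complex.re_ofReal_mul]
    ring
  -- Both forms are homogeneous of degree two, so it suffices to bound their quotient on the unit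
  -- sphere of the coordinate space, which is compact.
  have hS : IsCompact (Metric.sphere (0 : Fin n → ℂ) 1) := isCompact_sphere _ _
  have hpS : ∀ c ∈ Metric.sphere (0 : Fin n → ℂ) 1, 0 < (p (φ c) (φ c)).re := by
    intro c hc
    refine hp _ (hφU c) fun h => ?_
    rw [hφ0 c h] at hc
    simp at hc
  obtain ⟨K, hK⟩ := hS.exists_bound_of_continuousOn
    (f := fun c => (q (φ c) (φ c)).re / (p (φ c) (φ c)).re)
    (((hcont q).continuousOn).div (hcont p).continuousOn fun c hc => (hpS c hc).ne')
  refine ⟨max K 1, lt_max_of_lt_right one_pos, fun x hx => ?_⟩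
  obtain ⟨c, rfl⟩ := hφs x hx
  rcases eq_or_ne c 0 with rfl | hc
  · have : φ 0 = 0 := by simp [φ]
    simp [this]
  have hn : 0 < ‖c‖ := norm_pos_iff.2 hc
  set c' : Fin n → ℂ := ((‖c‖⁻¹ : ℝ) : ℂ) • c
  have hc' : c' ∈ Metric.sphere (0 : Fin n → ℂ) 1 := by
    simp [c', norm_smul, hn.ne']
  have hcc : φ c = ((‖c‖ : ℝ) : ℂ) • φ c' := by
    rw [hφm, smul_smul, ← Complex.ofReal_mul, mul_inv_cancel₀ hn.ne']
    simp
  rw [hcc, hhom, hhom]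
  have h1 := (le_abs_self _).trans (hK c' hc')
  have h2 := hpS c' hc'
  rw [div_le_iff₀ h2] at h1
  have h3 : (q (φ c') (φ c')).re ≤ max K 1 * (p (φ c') (φ c')).re :=
    h1.trans (mul_le_mul_of_nonneg_right (le_max_left _ _) h2.le)
  nlinarith [sq_nonneg ‖c‖, mul_le_mul_of_nonneg_left h3 (sq_nonneg ‖c‖)]

/-- The Cauchy-Schwarz inequality for a Hermitian form that is nonnegative on a subspace. -/
theorem IsHermForm.norm_sq_le {q : SesqForm D} (hq : IsHermForm q) {M : Submodule ℂ D}
    (hM : ∀ x ∈ M, 0 ≤ (q x x).re) {x y : D} (hx : x ∈ M) (hy : y ∈ M) :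
    ‖q x y‖ ^ 2 ≤ (q x x).re * (q y y).re := by
  let c : PreInnerProductSpace.Core ℂ M :=
    { inner := fun x y => q x y
      conj_inner_symm := fun x y => hq y x
      re_inner_nonneg := fun x => hM x x.2
      add_left := fun x y z => by simp
      smul_left := fun x y r => by simp }
  have h := @InnerProductSpace.Core.inner_mul_inner_self_le ℂ M _ _ _ c ⟨x, hx⟩ ⟨y, hy⟩
  have h' : ‖q x y‖ * ‖q y x‖ ≤ (q x x).re * (q y y).re := h
  rwa [← hq x y, RCLike.norm_conj, ← pow_two] at h'

theorem IsHermForm.norm_sq_le_of_nonneg {q : SesqForm D} (hq : IsHermForm q)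
    (h : ∀ x, 0 ≤ (q x x).re) (x y : D) : ‖q x y‖ ^ 2 ≤ (q x x).re * (q y y).re :=
  hq.norm_sq_le (M := ⊤) (fun x _ => h x) trivial trivial

theorem IsHermForm.re_add {q : SesqForm D} (hq : IsHermForm q) (x y : D) :
    (q (x + y) (x + y)).re = (q x x).re + (q y y).re + 2 * (q x y).re := by
  have h : (q y x).re = (q x y).re := by rw [← hq x y]; simp
  simp only [map_add, LinearMap.add_apply, Complex.add_re, h]
  ring

/-- The form orthogonal complement of `U`. -/
def formOrth (q : SesqForm D) (U : Submodule ℂ D) : Submodule ℂ D where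
  carrier := {y | ∀ u ∈ U, q u y = 0}
  add_mem' := fun hx hy u hu => by rw [map_add, hx u hu, hy u hu, add_zero]
  zero_mem' := fun u _ => map_zero _
  smul_mem' := fun c x hx u hu => by rw [map_smul, hx u hu, smul_zero]

/-- The values of `q` on a basis of `U`. -/
noncomputable def formCoords (q : SesqForm D) (U : Submodule ℂ D)
    [FiniteDimensional ℂ U] : D →ₗ[ℂ] Fin (Module.finrank ℂ U) → ℂ :=
  LinearMap.pi fun i => q (Module.finBasis ℂ U i : D)

theorem formCoords_eq_zero {q : SesqForm D} {U : Submodule ℂ D}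
    [FiniteDimensional ℂ U] {y : D} (h : formCoords q U y = 0) : y ∈ formOrth q U := by
  intro u hu
  have h1 : ∀ i, q (Module.finBasis ℂ U i : D) y = 0 := fun i => congrFun h i
  have h2 := congrArg U.subtype ((Module.finBasis ℂ U).sum_repr ⟨u, hu⟩)
  simp only [map_sum, map_smul, Submodule.subtype_apply] at h2
  rw [← h2]
  simp [LinearMap.sum_apply, h1]

/-- A vector of `U` orthogonal to all of `U` has `q u u = 0`, hence vanishes. So the functionals `q
u ·` separate the points of `U`, and by equality of dimensions they take on `U` every value they
take on `x`. -/
theorem NegOn.exists_proj {q : SesqForm D} {U : Submodule ℂ D}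
    [FiniteDimensional ℂ U] (h : NegOn q U) (x : D) : ∃ u ∈ U, x - u ∈ formOrth q U := by
  have hinj : Function.Injective ((formCoords q U) ∘ₗ U.subtype) := by
    rw [← LinearMap.ker_eq_bot, LinearMap.ker_eq_bot']
    intro u hu
    by_contra h0
    have h1 := formCoords_eq_zero hu u u.2
    have h2 := h u u.2 (fun h => h0 (Subtype.ext h))
    simp only [Submodule.subtype_apply] at h1
    rw [h1] at h2
    simp at h2
  have hsurj := (LinearMap.injective_iff_surjective_of_finrank_eq_finrank (by simp)).1 hinj
  obtain ⟨u, hu⟩ := hsurj (formCoords q U x)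
  refine ⟨u, u.2, formCoords_eq_zero ?_⟩
  rw [map_sub, ← hu]
  simp

theorem finrank_sup_of_disjoint {U V : Submodule ℂ D} [FiniteDimensional ℂ U]
    [FiniteDimensional ℂ V] (h : ∀ x ∈ U, x ∈ V → x = 0) :
    Module.finrank ℂ ↥(U ⊔ V) = Module.finrank ℂ U + Module.finrank ℂ V := by
  have h1 := Submodule.finrank_sup_add_finrank_inf_eq U V
  have h2 : U ⊓ V = ⊥ := by
    rw [eq_bot_iff]
    rintro x ⟨hx, hy⟩
    exact (Submodule.mem_bot ℂ).2 (h x hx hy)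
  rw [h2] at h1
  simpa using h1

/-- A maximal negative definite subspace has a nonnegative complement. -/
theorem NegOn.nonneg_formOrth {q : SesqForm D} (hq : IsHermForm q) {U : Submodule ℂ D}
    [FiniteDimensional ℂ U] (h : NegOn q U) (hmax : ¬ IndexGE q (Module.finrank ℂ U + 1)) :
    ∀ y ∈ formOrth q U, 0 ≤ (q y y).re := by
  intro y hy
  by_contra! hneg
  have hy0 : y ≠ 0 := by
    rintro rfl
    simp at hneg
  refine hmax ⟨U ⊔ Submodule.span ℂ {y}, inferInstance, ?_, ?_⟩
  · rw [finrank_sup_of_disjoint, finrank_span_singleton hy0]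
    intro x hx hxy
    obtain ⟨c, rfl⟩ := Submodule.mem_span_singleton.1 hxy
    by_contra h0
    have := h _ hx h0
    have h2 : q (c • y) (c • y) = 0 := by
      rw [map_smul, hy _ hx, smul_zero]
    rw [h2] at this
    simp at this
  · intro x hx h0
    obtain ⟨u, hu, v, hv, rfl⟩ := Submodule.mem_sup.1 hx
    obtain ⟨c, rfl⟩ := Submodule.mem_span_singleton.1 hv
    rw [hq.re_add, map_smul (q u), hy u hu]
    have h3 : (q (c • y) (c • y)).re = ‖c‖ ^ 2 * (q y y).re := by
      simp only [map_smulₛₗ, LinearMap.smul_apply, smul_eq_mul, RingHom.id_apply]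
      rw [← mul_assoc, Complex.mul_conj, Complex.normSq_eq_norm_sq, Complex.re_ofReal_mul]
    rw [h3]
    rcases eq_or_ne u 0 with rfl | hu0
    · rcases eq_or_ne c 0 with rfl | hc
      · simp at h0
      · have : 0 < ‖c‖ ^ 2 := by positivity
        simp only [map_zero, Complex.zero_re, smul_zero, mul_zero, add_zero, zero_add]
        nlinarith
    · have := h u hu hu0
      have : 0 ≤ ‖c‖ ^ 2 := by positivity
      simp only [smul_zero, Complex.zero_re, mul_zero, add_zero]
      nlinarith

/-- A negative definite subspace meets the kernel of `τ` only in zero, so `τ` embeds it. Every upper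
bound for an index comes from here: nonnegativity under finitely many linear constraints. -/
theorem IndexGE.le_finrank {T : Type*} [AddCommGroup T] [Module ℂ T] [FiniteDimensional ℂ T]
    {q : SesqForm D} {n : ℕ} (h : IndexGE q n) (τ : D →ₗ[ℂ] T)
    (hτ : ∀ x, τ x = 0 → 0 ≤ (q x x).re) : n ≤ Module.finrank ℂ T := by
  obtain ⟨V, hVfd, rfl, hV⟩ := h
  have hinj : Function.Injective (τ ∘ₗ V.subtype) := by
    rw [← LinearMap.ker_eq_bot, LinearMap.ker_eq_bot']
    intro v hv
    by_contra h0
    exact absurd (hV v v.2 (fun h => h0 (Subtype.ext h))) (not_lt.2 (hτ v hv))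
  exact LinearMap.finrank_le_finrank_of_injective hinj

theorem not_indexGE_one_of_nonneg {q : SesqForm D} (h : ∀ x, 0 ≤ (q x x).re) :
    ¬ IndexGE q 1 := fun h1 => by
  have := h1.le_finrank (0 : D →ₗ[ℂ] (Fin 0 → ℂ)) fun x _ => h x
  simp at this

/-- The index of `q - ε w`, for small `ε`, exceeds that of `q` at most by the codimension of the
space on which the equation `q x = w y` is boundedly solvable. -/
theorem exists_index_sub_smul_le {T : Type*} [AddCommGroup T] [Module ℂ T]
    [FiniteDimensional ℂ T] {q w : SesqForm D} (hq : IsHermForm q) (hw : IsHermForm w)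
    (hw0 : ∀ x, 0 ≤ (w x x).re) {N : ℕ} (hN : IndexGE q N) (hN' : ¬ IndexGE q (N + 1))
    (τ : D →ₗ[ℂ] T) {C : ℝ} (hC : 0 ≤ C)
    (hG : ∀ y, τ y = 0 → ∃ x, (∀ η, q η x = w η y) ∧ (w x x).re ≤ C ^ 2 * (w y y).re) :
    ∃ ε₀ : ℝ, 0 < ε₀ ∧ ∀ n, IndexGE (q - (ε₀ : ℂ) • w) n → n ≤ N + Module.finrank ℂ T := by
  obtain ⟨U, hfd, hdim, hneg⟩ := hN
  have hpos := hneg.nonneg_formOrth hq (by rwa [hdim])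
  obtain ⟨K, hK0, hK⟩ := exists_form_le_mul (-q) w U (fun x hx h0 => by
    simpa using hneg x hx h0)
  -- With `x` the solution of `q η x = w η y`, split `x = u + m` along `U` and its complement. The
  -- part in `U` costs at most `K`, the whole of `x` at most `C`, so `q m m ≤ (C + K) w y y`. Since
  -- `q y m = w y y`, Cauchy-Schwarz for `q` on the complement gives `(w y y)² ≤ q y y * q m m`, and
  -- one factor `w y y` cancels.
  have key : ∀ y ∈ formOrth q U, τ y = 0 → (w y y).re ≤ (C + K) * (q y y).re := by
    intro y hy hτ
    obtain ⟨x, hx, hxC⟩ := hG y hτ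
    obtain ⟨u, hu, hm⟩ := hneg.exists_proj x
    set m := x - u
    have hxum : x = u + m := by simp [m]
    have hω := hw0 y
    have h1 : q u x = q u u := by rw [hxum, map_add, hm u hu, add_zero]
    have h2 : (q u u).re = (w u y).re := by rw [← h1, hx]
    have hK' : (w u u).re ≤ K * (-(q u u).re) := by simpa using hK u hu
    have hβ : 0 ≤ -(q u u).re := by
      rcases eq_or_ne u 0 with h | h
      · simp [h]
      · linarith [hneg u hu h]
    have h3 : -(q u u).re ≤ K * (w y y).re := by
      have h4 : |(w u y).re| ^ 2 ≤ (w u u).re * (w y y).re :=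
        (pow_le_pow_left₀ (abs_nonneg _) (Complex.abs_re_le_norm _) 2).trans
          (hw.norm_sq_le_of_nonneg hw0 u y)
      rw [← h2, sq_abs] at h4
      by_contra! hlt
      have : 0 < -(q u u).re := lt_of_le_of_lt (by positivity) hlt
      nlinarith [mul_le_mul_of_nonneg_right hK' hω, mul_lt_mul_of_pos_left hlt this]
    have h5 : (q x x).re ≤ C * (w y y).re := by
      rw [hx x]
      refine (le_abs_self _).trans ((Complex.abs_re_le_norm _).trans ?_)
      refine le_of_sq_le_sq ?_ (by positivity)
      nlinarith [hw.norm_sq_le_of_nonneg hw0 x y]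
    have h6 : (q m m).re ≤ (C + K) * (w y y).re := by
      have := hq.re_add u m
      rw [← hxum, hm u hu] at this
      simp only [Complex.zero_re, mul_zero, add_zero] at this
      nlinarith
    have h7 : q y m = w y y := by
      rw [← hx y, hxum, map_add]
      have : q y u = 0 := by rw [← hq u y, hy u hu, map_zero]
      rw [this, zero_add]
    have h8 : (w y y).re ^ 2 ≤ (q y y).re * (q m m).re := by
      have := hq.norm_sq_le hpos hy hm
      rw [h7] at this
      refine le_trans ?_ this
      rw [← sq_abs]
      exact pow_le_pow_left₀ (abs_nonneg _) (Complex.abs_re_le_norm _) 2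
    have h9 := hpos y hy
    by_contra! hlt
    have : 0 < (w y y).re := lt_of_le_of_lt (by positivity) hlt
    nlinarith [mul_le_mul_of_nonneg_left h6 h9, mul_lt_mul_of_pos_right hlt this]
  -- For this value `q - ε w` is nonnegative wherever the coordinates against `U` and `τ` vanish, a
  -- total of `N + dim T` conditions.
  refine ⟨(C + K)⁻¹, by positivity, ?_⟩
  intro n hn
  have := hn.le_finrank ((formCoords q U).prod τ) fun v hv => by
    have h1 := key v (formCoords_eq_zero (congrArg Prod.fst hv)) (congrArg Prod.snd hv)
    simp only [LinearMap.sub_apply, LinearMap.smul_apply, smul_eq_mul, Complex.sub_re,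
      Complex.re_ofReal_mul]
    rw [← inv_mul_le_iff₀ (by positivity)] at h1
    linarith
  simpa [hdim] using this

theorem injective_of_form_pos {E : Type*} [AddCommGroup E] [Module ℂ E] {w : SesqForm D}
    {T : E →ₗ[ℂ] D} (hT : ∀ e, e ≠ 0 → 0 < (w (T e) (T e)).re) : Function.Injective T := by
  rw [← LinearMap.ker_eq_bot, LinearMap.ker_eq_bot']
  intro e he
  by_contra h0
  have := hT e h0
  rw [he] at this
  simp at this

/-- The index of `q - ε w` is at least the sum of the index of `q` and of the dimension of any
space of null vectors of `q` on which `w` is positive. -/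
theorem IndexGE.sub_smul {E : Type*} [AddCommGroup E] [Module ℂ E] [FiniteDimensional ℂ E]
    {q w : SesqForm D} (hq : IsHermForm q)
    (hw0 : ∀ x, 0 ≤ (w x x).re) {N : ℕ} (hN : IndexGE q N) (T : E →ₗ[ℂ] D)
    (hT : ∀ e η, q η (T e) = 0) (hTw : ∀ e, e ≠ 0 → 0 < (w (T e) (T e)).re) {ε : ℝ}
    (hε : 0 < ε) : IndexGE (q - (ε : ℂ) • w) (N + Module.finrank ℂ E) := by
  obtain ⟨U, hfd, rfl, hneg⟩ := hN
  rw [← LinearMap.finrank_range_of_inj (injective_of_form_pos hTw)]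
  refine ⟨U ⊔ LinearMap.range T, inferInstance, finrank_sup_of_disjoint ?_, ?_⟩
  · rintro x hx ⟨e, rfl⟩
    by_contra h0
    have := hneg _ hx h0
    rw [hT e _] at this
    simp at this
  · intro x hx h0
    obtain ⟨u, hu, _, ⟨e, rfl⟩, rfl⟩ := Submodule.mem_sup.1 hx
    simp only [LinearMap.sub_apply, LinearMap.smul_apply, smul_eq_mul, Complex.sub_re,
      Complex.re_ofReal_mul]
    rw [hq.re_add, hT, hT]
    have h1 := hw0 (u + T e)
    -- The cross terms vanish because `T e` is a null vector. Strict negativity comes from the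
    -- weight when `u = 0` and from `q` on `U` otherwise.
    rcases eq_or_ne u 0 with rfl | hu0
    · have h2 := hTw e (by rintro rfl; simp at h0)
      simp only [map_zero, Complex.zero_re, zero_add, mul_zero, add_zero] at *
      nlinarith
    · have := hneg u hu hu0
      simp only [Complex.zero_re, add_zero, mul_zero]
      nlinarith

/-- The index of `q + ε w` for small `ε` is at least that of `q`. -/
theorem IndexGE.exists_add_smul {q w : SesqForm D} {N : ℕ} (hN : IndexGE q N) :
    ∃ ε : ℝ, 0 < ε ∧ IndexGE (q + (ε : ℂ) • w) N := by
  obtain ⟨U, hfd, rfl, hneg⟩ := hN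
  obtain ⟨K, hK0, hK⟩ := exists_form_le_mul (-q) w U (fun x hx h0 => by
    simpa using hneg x hx h0)
  -- The perturbation may use up half of `-(q x x)` on `U`; applied to the weight, this is the
  -- left-continuity of the index in the spectral parameter.
  refine ⟨(2 * K)⁻¹, by positivity, U, hfd, rfl, fun x hx h0 => ?_⟩
  simp only [LinearMap.add_apply, LinearMap.smul_apply, smul_eq_mul, Complex.add_re,
      Complex.re_ofReal_mul]
  have h1 := hneg x hx h0
  have h2 : (w x x).re ≤ K * (-(q x x).re) := by simpa using hK x hx
  have h3 : (2 * K)⁻¹ * (w x x).re ≤ (2 * K)⁻¹ * (K * (-(q x x).re)) :=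
    mul_le_mul_of_nonneg_left h2 (by positivity)
  have h4 : (2 * K)⁻¹ * (K * (-(q x x).re)) = -(q x x).re / 2 := by field_simp
  linarith

/-- The index of `q - κ w` is at least the dimension of any space on which `w` is positive, for
large `κ`. -/
theorem exists_indexGE_sub_smul {E : Type*} [AddCommGroup E] [Module ℂ E] [FiniteDimensional ℂ E]
    {q w : SesqForm D} (T : E →ₗ[ℂ] D) (hT : ∀ e, e ≠ 0 → 0 < (w (T e) (T e)).re) :
    ∃ κ : ℝ, IndexGE (q - (κ : ℂ) • w) (Module.finrank ℂ E) := by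
  have hU : ∀ x ∈ LinearMap.range T, x ≠ 0 → 0 < (w x x).re := by
    rintro _ ⟨e, rfl⟩ h0
    exact hT e fun he => h0 (by rw [he, map_zero])
  obtain ⟨K, hK0, hK⟩ := exists_form_le_mul w q (LinearMap.range T) hU
  refine ⟨K + 1, LinearMap.range T, inferInstance,
    LinearMap.finrank_range_of_inj (injective_of_form_pos hT), fun x hx h0 => ?_⟩
  simp only [LinearMap.sub_apply, LinearMap.smul_apply, smul_eq_mul, Complex.sub_re,
      Complex.re_ofReal_mul]
  nlinarith [hK x hx, hU x hx h0]

end Form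

/-! ### Volterra operators and linear differential equations with bounded coefficients -/

section Resolvent

variable {X : Type*} [NormedAddCommGroup X] [NormedSpace ℂ X]

/-- Some power of `V` has norm below one, so `1 - V ^ n` is invertible. It is the product of `1 - V`
with a geometric sum commuting with it, so `1 - V` is invertible too. No smallness of `V` itself is
required. -/
theorem isUnit_one_sub_of_pow_bound [CompleteSpace X] {V : X →L[ℂ] X} {K : ℝ} (hK0 : 0 ≤ K)
    (hK : ∀ n Y, ‖(V ^ n) Y‖ ≤ K ^ n / n.factorial * ‖Y‖) : IsUnit (1 - V) := by
  obtain ⟨n, hn⟩ := ((FloorSemiring.tendsto_pow_div_factorial_atTop K).eventually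
    (gt_mem_nhds (one_pos : (0 : ℝ) < 1))).exists
  have h1 : ‖V ^ n‖ < 1 :=
    (ContinuousLinearMap.opNorm_le_bound _ (by positivity) (hK n)).trans_lt hn
  have h2 := isUnit_one_sub_of_norm_lt_one h1
  rw [← mul_neg_geom_sum] at h2
  refine ((Commute.isUnit_mul_iff ?_).1 h2).1
  exact Commute.sum_right _ _ _ fun i _ =>
    Commute.sub_left (Commute.one_left _) ((Commute.refl _).pow_right i)

/-- The inverse of `1 - (V + lam V₁)`. -/
noncomputable def solOp (V V₁ : X →L[ℂ] X) (lam : ℂ) : X →L[ℂ] X :=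
  Ring.inverse (1 - (V + lam • V₁))

variable {V V₁ : X →L[ℂ] X}

theorem solOp_eq {lam : ℂ} (h : IsUnit (1 - (V + lam • V₁))) (x : X) :
    solOp V V₁ lam x = x + (V (solOp V V₁ lam x) + lam • V₁ (solOp V V₁ lam x)) := by
  have h := congrArg (fun T : X →L[ℂ] X => T x) (Ring.mul_inverse_cancel _ h)
  exact sub_eq_iff_eq_add.1 h

theorem eq_solOp {lam : ℂ} (h : IsUnit (1 - (V + lam • V₁))) {x Y : X}
    (hY : Y = x + (V Y + lam • V₁ Y)) : Y = solOp V V₁ lam x := by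
  have h := congrArg (fun T : X →L[ℂ] X => T Y) (Ring.inverse_mul_cancel _ h)
  have h2 : (1 - (V + lam • V₁)) Y = x := sub_eq_iff_eq_add.2 hY
  exact h.symm.trans (congrArg (solOp V V₁ lam) h2)

theorem differentiable_solOp [CompleteSpace X] (h : ∀ lam : ℂ, IsUnit (1 - (V + lam • V₁))) :
    Differentiable ℂ (solOp V V₁) := by
  intro lam
  have h1 : DifferentiableAt ℂ (fun l : ℂ => 1 - (V + l • V₁)) lam :=
    ((differentiableAt_id.smul_const V₁).const_add V).const_sub 1
  exact (differentiableAt_inverse (h lam)).comp lam h1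

/-- The derivative of the solution operator with respect to the parameter. -/
theorem deriv_solOp_eq [CompleteSpace X] (h : ∀ lam : ℂ, IsUnit (1 - (V + lam • V₁))) (lam : ℂ) (x : X) :
    deriv (solOp V V₁) lam x = V₁ (solOp V V₁ lam x) +
      (V (deriv (solOp V V₁) lam x) + lam • V₁ (deriv (solOp V V₁) lam x)) := by
  have h0 : HasDerivAt (fun l => solOp V V₁ l x) (deriv (solOp V V₁) lam x) lam := by
    have := ((differentiable_solOp h lam).hasDerivAt).clm_apply (hasDerivAt_const lam x)
    simpa using this
  have h1 : HasDerivAt (fun l => x + (V (solOp V V₁ l x) + l • V₁ (solOp V V₁ l x)))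
      (V (deriv (solOp V V₁) lam x) + (lam • V₁ (deriv (solOp V V₁) lam x) +
        (1 : ℂ) • V₁ (solOp V V₁ lam x))) lam :=
    ((V.hasFDerivAt.comp_hasDerivAt lam h0).add
      ((hasDerivAt_id lam).smul (V₁.hasFDerivAt.comp_hasDerivAt lam h0))).const_add x
  have h2 := h0.unique (h1.congr_of_eventuallyEq (Eventually.of_forall fun l =>
    solOp_eq (h l) x))
  refine h2.trans ?_
  rw [one_smul]
  abel

end Resolvent

/-! ### Volterra integral operators with bounded matrix coefficients. -/

section Volterra

open Set BoundedContinuousFunction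

variable {ι κ : Type*}

/-- A bounded measurable matrix function that vanishes outside `(a,b]`. -/
structure IsCoeff (a b : ℝ) (M : ℝ → Matrix κ ι ℂ) : Prop where
  meas : ∀ i j, Measurable fun t => M t i j
  bdd : ∃ C : ℝ, ∀ t i j, ‖M t i j‖ ≤ C
  supp : ∀ t, t ∉ Ioc a b → M t = 0

variable {a b : ℝ} {M N : ℝ → Matrix κ ι ℂ}

theorem IsCoeff.exists_bound (h : IsCoeff a b M) : ∃ C : ℝ, 0 ≤ C ∧ ∀ t i j, ‖M t i j‖ ≤ C := by
  obtain ⟨C, hC⟩ := h.bdd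
  exact ⟨max C 0, le_max_right _ _, fun t i j => (hC t i j).trans (le_max_left _ _)⟩

theorem IsCoeff.add (hM : IsCoeff a b M) (hN : IsCoeff a b N) : IsCoeff a b (M + N) := by
  obtain ⟨C, hC⟩ := hM.bdd
  obtain ⟨C', hC'⟩ := hN.bdd
  exact ⟨fun i j => (hM.meas i j).add (hN.meas i j),
    ⟨C + C', fun t i j => (norm_add_le _ _).trans (add_le_add (hC t i j) (hC' t i j))⟩,
    fun t ht => by simp [hM.supp t ht, hN.supp t ht]⟩

theorem IsCoeff.const_smul (hM : IsCoeff a b M) (c : ℂ) : IsCoeff a b (c • M) := by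
  obtain ⟨C, hC⟩ := hM.bdd
  refine ⟨fun i j => (hM.meas i j).const_smul c, ⟨‖c‖ * C, fun t i j => ?_⟩,
    fun t ht => by simp [hM.supp t ht]⟩
  simp only [Pi.smul_apply, Matrix.smul_apply, norm_smul]
  exact mul_le_mul_of_nonneg_left (hC t i j) (norm_nonneg _)

variable [Fintype ι] [Fintype κ]

theorem norm_mulVec_le {C : ℝ} {M : Matrix κ ι ℂ} (hM : ∀ i j, ‖M i j‖ ≤ C) (hC : 0 ≤ C)
    (v : ι → ℂ) : ‖M *ᵥ v‖ ≤ Fintype.card ι * C * ‖v‖ := by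
  refine (pi_norm_le_iff_of_nonneg (by positivity)).2 fun i => ?_
  calc ‖(M *ᵥ v) i‖ ≤ ∑ j, ‖M i j * v j‖ := norm_sum_le _ _
    _ ≤ ∑ _j : ι, C * ‖v‖ := Finset.sum_le_sum fun j _ => by
        rw [norm_mul]
        exact mul_le_mul (hM i j) (norm_le_pi_norm v j) (norm_nonneg _) hC
    _ = Fintype.card ι * C * ‖v‖ := by simp [mul_assoc]

/-- A bounded measurable vector function. -/
def IsBddMeas (f : ℝ → ι → ℂ) : Prop := Measurable f ∧ ∃ C : ℝ, ∀ t, ‖f t‖ ≤ C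

theorem IsBddMeas.intervalIntegrable {f : ℝ → ι → ℂ} (hf : IsBddMeas f) (s t : ℝ) :
    IntervalIntegrable f volume s t := by
  obtain ⟨h1, C, hC⟩ := hf
  rw [intervalIntegrable_iff]
  exact Measure.integrableOn_of_bounded (by simp) h1.aestronglyMeasurable
    (Eventually.of_forall hC)

theorem IsBddMeas.add {f g : ℝ → ι → ℂ} (hf : IsBddMeas f) (hg : IsBddMeas g) :
    IsBddMeas (f + g) := by
  obtain ⟨h1, C, hC⟩ := hf
  obtain ⟨h2, C', hC'⟩ := hg
  exact ⟨h1.add h2, C + C', fun t => (norm_add_le _ _).trans (add_le_add (hC t) (hC' t))⟩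

theorem IsBddMeas.const_smul {f : ℝ → ι → ℂ} (hf : IsBddMeas f) (c : ℂ) :
    IsBddMeas (c • f) := by
  obtain ⟨h1, C, hC⟩ := hf
  refine ⟨h1.const_smul c, ‖c‖ * C, fun t => ?_⟩
  rw [Pi.smul_apply, norm_smul]
  exact mul_le_mul_of_nonneg_left (hC t) (norm_nonneg _)

theorem IsBddMeas.continuous_primitive {f : ℝ → ι → ℂ} (hf : IsBddMeas f) (a : ℝ) :
    Continuous fun t => ∫ s in a..t, f s :=
  intervalIntegral.continuous_primitive (fun s t => hf.intervalIntegrable s t) a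

theorem IsCoeff.isBddMeas_mulVec (hM : IsCoeff a b M) {f : ℝ → ι → ℂ} (hf : IsBddMeas f) :
    IsBddMeas fun t => M t *ᵥ f t := by
  obtain ⟨C, hC0, hC⟩ := hM.exists_bound
  obtain ⟨h1, C', hC'⟩ := hf
  refine ⟨?_, Fintype.card ι * C * C', fun t => (norm_mulVec_le (hC t) hC0 _).trans ?_⟩
  · refine measurable_pi_lambda _ fun i => ?_
    simp only [Matrix.mulVec, dotProduct]
    exact Finset.measurable_sum _ fun j _ => (hM.meas i j).mul ((measurable_pi_apply j).comp h1)
  · exact mul_le_mul_of_nonneg_left (hC' t) (by positivity)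

theorem BoundedContinuousFunction.isBddMeas (Y : ℝ →ᵇ (ι → ℂ)) : IsBddMeas Y :=
  ⟨Y.continuous.measurable, ‖Y‖, Y.norm_coe_le_norm⟩

/-- The integrand vanishes outside `(a,b]`, so its primitive is constant on either side. This lets
bounded continuous functions on the whole line stand for functions on `[a,b]`. -/
theorem integral_eq_clamp (hab : a ≤ b) {f : ℝ → κ → ℂ} (hf : IsBddMeas f)
    (hs : ∀ t, t ∉ Ioc a b → f t = 0) (t : ℝ) :
    ∫ s in a..t, f s = ∫ s in a..(max a (min b t)), f s := by
  have h0 : ∀ s t, (t ≤ a ∨ b ≤ s) → s ≤ t → ∫ r in s..t, f r = 0 := by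
    intro s t h hst
    refine intervalIntegral.integral_zero_ae (Eventually.of_forall fun r hr => hs r ?_)
    rw [uIoc_of_le hst] at hr
    rintro ⟨h1, h2⟩
    rcases h with h | h <;> linarith [hr.1, hr.2]
  rcases le_total t a with h | h
  · rw [min_eq_right (h.trans hab), max_eq_left h, intervalIntegral.integral_same,
      intervalIntegral.integral_symm, h0 t a (Or.inl le_rfl) h, neg_zero]
  rcases le_total t b with h' | h'
  · rw [min_eq_right h', max_eq_right h]
  · rw [min_eq_left h', max_eq_right hab, ← intervalIntegral.integral_add_adjacent_intervals
      (hf.intervalIntegrable a b) (hf.intervalIntegrable b t), h0 b t (Or.inr le_rfl) h', add_zero]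

theorem norm_integral_le_of_supp (hab : a ≤ b) {f : ℝ → κ → ℂ} (hf : IsBddMeas f)
    (hs : ∀ t, t ∉ Ioc a b → f t = 0) {C : ℝ} (hC : ∀ t, ‖f t‖ ≤ C) (t : ℝ) :
    ‖∫ s in a..t, f s‖ ≤ C * (b - a) := by
  have hC0 : 0 ≤ C := (norm_nonneg _).trans (hC a)
  rw [integral_eq_clamp hab hf hs]
  refine (intervalIntegral.norm_integral_le_of_norm_le_const fun s _ => hC s).trans ?_
  refine mul_le_mul_of_nonneg_left ?_ hC0
  rw [abs_of_nonneg (by simp)]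
  have : max a (min b t) ≤ b := max_le hab (min_le_left _ _)
  linarith

theorem exists_volterra (hab : a ≤ b) (hM : IsCoeff a b M) :
    ∃ T : (ℝ →ᵇ (ι → ℂ)) →L[ℂ] (ℝ →ᵇ (κ → ℂ)), ∀ Y t, T Y t = ∫ s in a..t, M s *ᵥ Y s := by
  obtain ⟨C, hC0, hC⟩ := hM.exists_bound
  have h1 : ∀ Y : ℝ →ᵇ (ι → ℂ), IsBddMeas fun t => M t *ᵥ Y t := fun Y =>
    hM.isBddMeas_mulVec (BoundedContinuousFunction.isBddMeas Y)
  have h2 : ∀ (Y : ℝ →ᵇ (ι → ℂ)) t, ‖∫ s in a..t, M s *ᵥ Y s‖ ≤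
      Fintype.card ι * C * ‖Y‖ * (b - a) := fun Y =>
    norm_integral_le_of_supp hab (h1 Y) (fun t ht => by simp [hM.supp t ht]) fun t =>
      (norm_mulVec_le (hC t) hC0 _).trans
        (mul_le_mul_of_nonneg_left (Y.norm_coe_le_norm t) (by positivity))
  let T : (ℝ →ᵇ (ι → ℂ)) →ₗ[ℂ] (ℝ →ᵇ (κ → ℂ)) :=
    { toFun := fun Y => BoundedContinuousFunction.ofNormedAddCommGroup
          (fun t => ∫ s in a..t, M s *ᵥ Y s) ((h1 Y).continuous_primitive a) _ (h2 Y)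
      map_add' := fun Y Z => by
        ext1 t
        simp only [BoundedContinuousFunction.coe_ofNormedAddCommGroup,
          BoundedContinuousFunction.coe_add, Pi.add_apply, Matrix.mulVec_add]
        exact intervalIntegral.integral_add ((h1 Y).intervalIntegrable _ _)
          ((h1 Z).intervalIntegrable _ _)
      map_smul' := fun c Y => by
        ext1 t
        simp only [BoundedContinuousFunction.coe_ofNormedAddCommGroup,
          BoundedContinuousFunction.coe_smul, Matrix.mulVec_smul, RingHom.id_apply]
        exact intervalIntegral.integral_smul _ _ }
  have hb : 0 ≤ b - a := sub_nonneg.2 hab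
  refine ⟨T.mkContinuous (Fintype.card ι * C * (b - a)) fun Y => ?_, fun Y t => rfl⟩
  refine (BoundedContinuousFunction.norm_le (by positivity)).2 fun t => ?_
  exact (h2 Y t).trans_eq (mul_right_comm _ _ _)

open Classical in
/-- The operator `Y ↦ ∫ₐᵗ M Y`. -/
noncomputable def volterra (a b : ℝ) (M : ℝ → Matrix κ ι ℂ) :
    (ℝ →ᵇ (ι → ℂ)) →L[ℂ] (ℝ →ᵇ (κ → ℂ)) :=
  if h : a ≤ b ∧ IsCoeff a b M then (exists_volterra h.1 h.2).choose else 0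

theorem volterra_apply (hab : a ≤ b) (hM : IsCoeff a b M) (Y : ℝ →ᵇ (ι → ℂ)) (t : ℝ) :
    volterra a b M Y t = ∫ s in a..t, M s *ᵥ Y s := by
  rw [volterra, dif_pos ⟨hab, hM⟩]
  exact (exists_volterra hab hM).choose_spec Y t

theorem volterra_apply_left (hab : a ≤ b) (hM : IsCoeff a b M) (Y : ℝ →ᵇ (ι → ℂ)) :
    volterra a b M Y a = 0 := by
  rw [volterra_apply hab hM, intervalIntegral.integral_same]

theorem volterra_add_smul (hab : a ≤ b) (hM : IsCoeff a b M) (hN : IsCoeff a b N) (c : ℂ) :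
    volterra a b (M + c • N) = volterra a b M + c • volterra a b N := by
  ext1 Y
  ext1 t
  simp only [_root_.add_apply, _root_.smul_apply,
    BoundedContinuousFunction.coe_add, BoundedContinuousFunction.coe_smul, Pi.add_apply]
  have h1 := hM.isBddMeas_mulVec (BoundedContinuousFunction.isBddMeas Y)
  have h2 := hN.isBddMeas_mulVec (BoundedContinuousFunction.isBddMeas Y)
  rw [volterra_apply hab (hM.add (hN.const_smul c)), volterra_apply hab hM, volterra_apply hab hN,
    ← intervalIntegral.integral_smul]
  refine Eq.trans ?_ (intervalIntegral.integral_add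
      (h1.intervalIntegrable _ _) ((h2.const_smul c).intervalIntegrable _ _))
  simp [Matrix.add_mulVec, Matrix.smul_mulVec]

variable {M N : ℝ → Matrix ι ι ℂ}

/-- The iterated integral over a simplex: each application of the operator integrates `(s - a) ^ n`
once more, which produces the factorial. -/
theorem exists_volterra_pow_bound (hab : a ≤ b) (hM : IsCoeff a b M) :
    ∃ K : ℝ, 0 ≤ K ∧ ∀ n Y, ‖(volterra a b M ^ n) Y‖ ≤ K ^ n / n.factorial * ‖Y‖ := by
  obtain ⟨C, hC0, hC⟩ := hM.exists_bound
  obtain ⟨L, hLdef⟩ : ∃ L : ℝ, L = Fintype.card ι * C := ⟨_, rfl⟩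
  have hL : 0 ≤ L := by rw [hLdef]; positivity
  have hb : 0 ≤ b - a := sub_nonneg.2 hab
  have key : ∀ (n : ℕ) (Y : ℝ →ᵇ (ι → ℂ)), ∀ t ∈ Icc a b, ‖(volterra a b M ^ n) Y t‖ ≤
      L ^ n * (t - a) ^ n / n.factorial * ‖Y‖ := by
    intro n Y
    induction n with
    | zero =>
      intro t _
      simpa using Y.norm_coe_le_norm t
    | succ n ih =>
      intro t ht
      rw [pow_succ', mul_apply_eq_comp, volterra_apply hab hM]
      have h1 : ‖∫ s in a..t, M s *ᵥ (volterra a b M ^ n) Y s‖ ≤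
          ∫ s in a..t, L * (L ^ n * (s - a) ^ n / n.factorial * ‖Y‖) := by
        refine intervalIntegral.norm_integral_le_of_norm_le ht.1
          (Eventually.of_forall fun s hs => ?_)
          (Continuous.intervalIntegrable (by fun_prop) _ _)
        exact (norm_mulVec_le (hC s) hC0 _).trans (hLdef ▸ mul_le_mul_of_nonneg_left
          (ih s ⟨hs.1.le, hs.2.trans ht.2⟩) hL)
      refine h1.trans (le_of_eq ?_)
      have h2 : ∀ s, L * (L ^ n * (s - a) ^ n / n.factorial * ‖Y‖) =
          (L ^ (n + 1) / n.factorial * ‖Y‖) * (s - a) ^ n := fun s => by ring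
      simp_rw [h2]
      rw [intervalIntegral.integral_const_mul,
        intervalIntegral.integral_comp_sub_right (fun x => x ^ n) a, integral_pow,
        Nat.factorial_succ]
      push_cast
      simp
      field_simp
  refine ⟨L * (b - a), by positivity, fun n Y => ?_⟩
  refine (BoundedContinuousFunction.norm_le (by positivity)).2 fun t => ?_
  -- The case `n = 0` is separate: the identity does not produce functions that are constant outside
  -- `[a,b]`, so the reduction to `[a,b]` below needs at least one integration.
  rcases n with _ | n
  · simpa using Y.norm_coe_le_norm t
  have hclamp : (volterra a b M ^ (n + 1)) Y t =
      (volterra a b M ^ (n + 1)) Y (max a (min b t)) := by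
    rw [pow_succ', mul_apply_eq_comp, volterra_apply hab hM, volterra_apply hab hM]
    exact integral_eq_clamp hab (hM.isBddMeas_mulVec (BoundedContinuousFunction.isBddMeas _))
      (fun t ht => by simp [hM.supp t ht]) t
  rw [hclamp]
  have hm : max a (min b t) ∈ Icc a b := ⟨le_max_left _ _, max_le hab (min_le_left _ _)⟩
  refine (key (n + 1) Y _ hm).trans ?_
  rw [mul_pow L]
  have h1 : (max a (min b t) - a) ^ (n + 1) ≤ (b - a) ^ (n + 1) :=
    pow_le_pow_left₀ (by linarith [hm.1]) (by linarith [hm.2]) _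
  gcongr

theorem isUnit_one_sub_volterra (hab : a ≤ b) (hM : IsCoeff a b M) :
    IsUnit (1 - volterra a b M) := by
  obtain ⟨K, hK0, hK⟩ := exists_volterra_pow_bound hab hM
  exact isUnit_one_sub_of_pow_bound hK0 hK

theorem isUnit_one_sub_volterra_add (hab : a ≤ b) (hM : IsCoeff a b M) (hN : IsCoeff a b N)
    (lam : ℂ) : IsUnit (1 - (volterra a b M + lam • volterra a b N)) := by
  rw [← volterra_add_smul hab hM hN]
  exact isUnit_one_sub_volterra hab (hM.add (hN.const_smul lam))

end Volterra

/-! ### The order of vanishing of a determinant -/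

section DetOrder

variable {ι : Type*} [Fintype ι] [DecidableEq ι]

theorem det_projection_add_smul {V : Type*} [AddCommGroup V] [Module ℂ V] [FiniteDimensional ℂ V]
    {R C : Submodule ℂ V} (h : IsCompl R C) (z : ℂ) :
    LinearMap.det (R.projection C h + z • (LinearMap.id - R.projection C h)) =
      z ^ Module.finrank ℂ C := by
  let e := R.prodEquivOfIsCompl C h
  have h1 : R.projection C h + z • (LinearMap.id - R.projection C h) =
      e.toLinearMap ∘ₗ (LinearMap.prodMap (LinearMap.id : R →ₗ[ℂ] R)
        (z • (LinearMap.id : C →ₗ[ℂ] C))) ∘ₗ e.symm.toLinearMap := by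
    refine LinearMap.ext fun x => ?_
    obtain ⟨⟨r, c⟩, rfl⟩ := e.surjective x
    simp only [LinearMap.comp_apply, LinearEquiv.coe_coe, LinearEquiv.symm_apply_apply]
    simp [e, Submodule.projection_apply_left, Submodule.projection_apply_right]
  rw [h1, LinearMap.det_conj, LinearMap.det_prodMap]
  simp

/-- If no null vector `u ≠ 0` of `F z₀` is mapped by `F' z₀` into the range of `F z₀`, then the order
of the zero `z₀` of `det F` is the dimension of the kernel of `F z₀`. -/
theorem analyticOrderAt_det {F : ℂ → Matrix ι ι ℂ} {z₀ : ℂ}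
    (hF : ∀ i j, AnalyticAt ℂ (fun z => F z i j) z₀)
    (hker : ∀ u, F z₀ *ᵥ u = 0 →
      (∃ v, (Matrix.of fun i j => deriv (fun z => F z i j) z₀) *ᵥ u = F z₀ *ᵥ v) → u = 0) :
    analyticOrderAt (fun z => (F z).det) z₀ =
      Module.finrank ℂ (LinearMap.ker (F z₀).mulVecLin) := by
  set R := LinearMap.range (F z₀).mulVecLin
  obtain ⟨C, hC⟩ := R.exists_isCompl
  set p := LinearMap.toMatrix' (R.projection C hC)
  have hp : ∀ v, p *ᵥ v = R.projection C hC v := fun v => by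
    rw [← Matrix.toLin'_apply, Matrix.toLin'_toMatrix']
  let G : ℂ → Matrix ι ι ℂ := fun z => Matrix.of fun i j => dslope (fun z => F z i j) z₀ z
  have hG : ∀ i j, AnalyticAt ℂ (fun z => G z i j) z₀ := by
    intro i j
    obtain ⟨s, hs⟩ := hF i j
    exact ⟨_, hs.has_fpower_series_dslope_fslope⟩
  have hFG : ∀ z, F z = F z₀ + (z - z₀) • G z := by
    intro z
    ext i j
    have := sub_smul_dslope (fun z => F z i j) z₀ z
    simp only [Matrix.add_apply, Matrix.smul_apply, G, Matrix.of_apply]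
    rw [this]
    ring
  have hpF : p * F z₀ = F z₀ := by
    refine Matrix.ext_of_mulVec_single fun j => ?_
    rw [← Matrix.mulVec_mulVec, hp]
    exact Submodule.projection_apply_of_mem_left hC ⟨Pi.single j 1, rfl⟩
  have hpp : p * p = p := by
    rw [← LinearMap.toMatrix'_mul]
    exact congrArg _ (Submodule.isIdempotentElem_projection hC)
  -- Here `p` projects onto the range of `F z₀` and `G` is the difference quotient of `F` at `z₀`.
  -- The component of `F z` in the complement `C` vanishes at `z₀`, so a factor `z - z₀` splits off
  -- in each of its `dim C` directions. The first factor carries the whole zero of the determinant,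
  -- and the hypothesis on `F' z₀` makes the second invertible at `z₀`.
  have hfac : ∀ z, F z = (p + (z - z₀) • (1 - p)) * (p * F z + (1 - p) * G z) := by
    intro z
    have e1 : (1 - p) * F z = (z - z₀) • ((1 - p) * G z) := by
      rw [hFG z, Matrix.mul_add, Matrix.sub_mul 1 p (F z₀), Matrix.one_mul, hpF, sub_self, zero_add,
        Matrix.mul_smul]
    have e2 : p * (1 - p) = 0 := by rw [Matrix.mul_sub, hpp, Matrix.mul_one, sub_self]
    have e3 : (1 - p) * p = 0 := by rw [Matrix.sub_mul, hpp, Matrix.one_mul, sub_self]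
    have e4 : (1 - p) * (1 - p) = 1 - p := by rw [Matrix.mul_sub, e3, Matrix.mul_one, sub_zero]
    rw [Matrix.add_mul, Matrix.mul_add, Matrix.mul_add, Matrix.smul_mul, Matrix.smul_mul,
      ← Matrix.mul_assoc, ← Matrix.mul_assoc, ← Matrix.mul_assoc, ← Matrix.mul_assoc, hpp, e2, e3,
      e4, Matrix.zero_mul, Matrix.zero_mul, smul_zero, add_zero, zero_add, ← e1, Matrix.sub_mul,
      Matrix.one_mul]
    abel
  have hdetp : ∀ z, (p + (z - z₀) • (1 - p)).det = (z - z₀) ^ Module.finrank ℂ C := by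
    intro z
    rw [← det_projection_add_smul hC, ← LinearMap.det_toMatrix']
    simp [p, LinearMap.toMatrix'_id]
  have hdim : Module.finrank ℂ C = Module.finrank ℂ (LinearMap.ker (F z₀).mulVecLin) := by
    have h1 := Submodule.finrank_add_eq_of_isCompl hC
    have h2 := (F z₀).mulVecLin.finrank_range_add_finrank_ker
    exact Nat.add_left_cancel (h1.trans h2.symm)
  have hH : ∀ i j, AnalyticAt ℂ (fun z => (p * F z + (1 - p) * G z) i j) z₀ := by
    intro i j
    simp only [Matrix.add_apply, Matrix.mul_apply]
    refine AnalyticAt.fun_add ?_ ?_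
    · exact Finset.analyticAt_fun_sum _ fun k _ => analyticAt_const.mul (hF k j)
    · exact Finset.analyticAt_fun_sum _ fun k _ => analyticAt_const.mul (hG k j)
  have hdet : ∀ {H : ℂ → Matrix ι ι ℂ}, (∀ i j, AnalyticAt ℂ (fun z => H z i j) z₀) →
      AnalyticAt ℂ (fun z => (H z).det) z₀ := by
    intro H hH
    simp only [Matrix.det_apply]
    exact Finset.analyticAt_fun_sum _ fun σ _ => AnalyticAt.const_smul
      (Finset.analyticAt_fun_prod _ fun i _ => hH _ _)
  rw [← hdim, (hdet hF).analyticOrderAt_eq_natCast]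
  refine ⟨fun z => (p * F z + (1 - p) * G z).det, hdet hH, ?_, Eventually.of_forall fun z => ?_⟩
  · intro h0
    obtain ⟨u, hu0, hu⟩ := Matrix.exists_mulVec_eq_zero_iff.2 h0
    rw [hpF, Matrix.add_mulVec, ← Matrix.mulVec_mulVec, Matrix.sub_mulVec, Matrix.one_mulVec, hp]
      at hu
    have hR : F z₀ *ᵥ u ∈ R := ⟨u, rfl⟩
    -- The two summands of `hu` lie in the complementary spaces `R` and `C`, so each vanishes: `u`
    -- is a null vector of `F z₀`, and `G z₀ *ᵥ u` lies in `R`.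
    have e1 : F z₀ *ᵥ u = 0 := by
      have := congrArg (R.projection C hC) hu
      rw [map_add, map_sub, map_zero, Submodule.projection_apply_of_mem_left hC hR,
        Submodule.projection_apply_of_mem_left hC (Submodule.projection_apply_mem hC _),
        sub_self, add_zero] at this
      exact this
    rw [e1, zero_add, sub_eq_zero] at hu
    have e2 : G z₀ *ᵥ u ∈ R := by
      rw [hu]
      exact Submodule.projection_apply_mem hC _
    obtain ⟨v, hv⟩ := e2
    refine hu0 (hker u e1 ⟨v, ?_⟩)
    have e3 : (Matrix.of fun i j => deriv (fun z => F z i j) z₀) = G z₀ := by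
      ext i j
      simp [G]
    rw [e3]
    exact hv.symm
  · rw [smul_eq_mul, ← hdetp, ← Matrix.det_mul, ← hfac z]

end DetOrder

/-! ### Integral forms on spaces of vector functions -/

section FormSpace

open Set ComplexConjugate

theorem intervalIntegrable_of_bounded {f : ℝ → ℝ} (hf : Measurable f) {C : ℝ}
    (hC : ∀ t, |f t| ≤ C) (s t : ℝ) : IntervalIntegrable f volume s t := by
  rw [intervalIntegrable_iff]
  exact Measure.integrableOn_of_bounded (by simp) hf.aestronglyMeasurable
    (Eventually.of_forall hC)

theorem intervalIntegrable_of_bounded_complex {f : ℝ → ℂ} (hf : Measurable f) {C : ℝ}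
    (hC : ∀ t, ‖f t‖ ≤ C) (s t : ℝ) : IntervalIntegrable f volume s t := by
  rw [intervalIntegrable_iff]
  exact Measure.integrableOn_of_bounded (by simp) hf.aestronglyMeasurable
    (Eventually.of_forall hC)

/-- The Cauchy-Schwarz inequality for the integral of a bounded function. -/
theorem sq_integral_le {f : ℝ → ℝ} (hf : Measurable f) {C : ℝ} (hC : ∀ t, |f t| ≤ C) {s t : ℝ}
    (hst : s ≤ t) : (∫ r in s..t, f r) ^ 2 ≤ (t - s) * ∫ r in s..t, f r ^ 2 := by
  rcases hst.eq_or_lt with rfl | hlt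
  · simp
  have h1 := intervalIntegrable_of_bounded hf hC s t
  have h2 : IntervalIntegrable (fun r => f r ^ 2) volume s t :=
    intervalIntegrable_of_bounded (hf.pow_const 2) (C := C ^ 2)
      (fun r => by rw [abs_pow]; exact pow_le_pow_left₀ (abs_nonneg _) (hC r) 2) s t
  set A := ∫ r in s..t, f r
  set m := A / (t - s)
  have hpos : 0 < t - s := sub_pos.2 hlt
  -- The variance of `f` about its mean `m` is nonnegative; expanding the square gives the claim.
  have h3 : 0 ≤ ∫ r in s..t, (f r - m) ^ 2 :=
    intervalIntegral.integral_nonneg hst fun r _ => sq_nonneg _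
  have h4 : ∫ r in s..t, (f r - m) ^ 2 = (∫ r in s..t, f r ^ 2) - 2 * m * A + (t - s) * m ^ 2 := by
    have e : ∀ r, (f r - m) ^ 2 = f r ^ 2 - 2 * m * f r + m ^ 2 := fun r => by ring
    simp_rw [e]
    rw [intervalIntegral.integral_add (h2.sub (h1.const_mul _)) intervalIntegrable_const,
      intervalIntegral.integral_sub h2 (h1.const_mul _), intervalIntegral.integral_const_mul,
      intervalIntegral.integral_const, smul_eq_mul]
  have h5 : m * (t - s) = A := by simp only [m]; field_simp
  rw [h4] at h3
  have h6 : (t - s) * (2 * m * A) = 2 * A ^ 2 := by rw [← h5]; ring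
  have h7 : (t - s) * ((t - s) * m ^ 2) = A ^ 2 := by rw [← h5]; ring
  nlinarith [mul_nonneg hpos.le h3]

/-- Pullback of a sesquilinear form. -/
def pullForm {D E : Type*} [AddCommGroup D] [Module ℂ D] [AddCommGroup E] [Module ℂ E]
    (q : SesqForm D) (f : E →ₗ[ℂ] D) : SesqForm E :=
  LinearMap.mk₂'ₛₗ _ _ (fun x y => q (f x) (f y)) (fun x y z => by simp)
    (fun c x y => by simp) (fun x y z => by simp) (fun c x y => by simp)

@[simp]
theorem pullForm_apply {D E : Type*} [AddCommGroup D] [Module ℂ D] [AddCommGroup E] [Module ℂ E]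
    (q : SesqForm D) (f : E →ₗ[ℂ] D) (x y : E) : pullForm q f x y = q (f x) (f y) := rfl

/-- The form `x, y ↦ x* N y`. -/
def matForm {κ : Type*} [Fintype κ] (N : Matrix κ κ ℂ) : SesqForm (κ → ℂ) :=
  LinearMap.mk₂'ₛₗ _ _ (fun x y => star x ⬝ᵥ (N *ᵥ y))
    (fun x y z => by rw [star_add, add_dotProduct])
    (fun c x y => by rw [star_smul, smul_dotProduct]; rfl)
    (fun x y z => by rw [Matrix.mulVec_add, dotProduct_add])
    (fun c x y => by rw [Matrix.mulVec_smul, dotProduct_smul]; rfl)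

@[simp]
theorem matForm_apply {κ : Type*} [Fintype κ] (N : Matrix κ κ ℂ) (x y : κ → ℂ) :
    matForm N x y = star x ⬝ᵥ (N *ᵥ y) := rfl

theorem isHermForm_matForm {κ : Type*} [Fintype κ] {N : Matrix κ κ ℂ} (hN : N.IsHermitian) :
    IsHermForm (matForm N) := by
  intro x y
  simp only [matForm_apply]
  change star (star x ⬝ᵥ (N *ᵥ y)) = _
  rw [← Matrix.star_dotProduct_star, star_star, Matrix.star_mulVec, hN.eq,
    ← Matrix.dotProduct_mulVec]

theorem norm_matForm_le {κ : Type*} [Fintype κ] {N : Matrix κ κ ℂ} {C : ℝ} (hC0 : 0 ≤ C)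
    (hC : ∀ i j, ‖N i j‖ ≤ C) (x y : κ → ℂ) :
    ‖matForm N x y‖ ≤ Fintype.card κ ^ 2 * C * (‖x‖ * ‖y‖) := by
  have h1 := norm_mulVec_le hC hC0 y
  calc ‖matForm N x y‖ ≤ ∑ i, ‖star x i * (N *ᵥ y) i‖ := norm_sum_le _ _
    _ ≤ ∑ _i : κ, ‖x‖ * (Fintype.card κ * C * ‖y‖) := Finset.sum_le_sum fun i _ => by
        rw [norm_mul, Pi.star_apply, norm_star]
        exact mul_le_mul (norm_le_pi_norm x i) ((norm_le_pi_norm _ i).trans h1) (norm_nonneg _)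
          (norm_nonneg _)
    _ = Fintype.card κ ^ 2 * C * (‖x‖ * ‖y‖) := by
        simp
        ring

/-- The change of `x* N x` under a change of `N` and of `x`. -/
theorem norm_matForm_sub_le {κ : Type*} [Fintype κ] {N N' : Matrix κ κ ℂ} {C δ : ℝ} (hC0 : 0 ≤ C)
    (hδ : 0 < δ) (hC : ∀ i j, ‖N' i j‖ ≤ C) (hN : ∀ i j, ‖(N' - N) i j‖ ≤ δ) (x h : κ → ℂ) :
    ‖matForm N' (x + h) (x + h) - matForm N x x‖ ≤
      Fintype.card κ ^ 2 * ((1 + C) * δ * ‖x‖ ^ 2 + C * (1 + 1 / δ) * ‖h‖ ^ 2) := by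
  have e : matForm N' (x + h) (x + h) - matForm N x x =
      matForm (N' - N) x x + matForm N' x h + matForm N' h x + matForm N' h h := by
    simp only [map_add, LinearMap.add_apply]
    simp only [matForm_apply, Matrix.sub_mulVec, dotProduct_sub]
    ring
  rw [e]
  have h1 := norm_matForm_le hδ.le hN x x
  have h2 := norm_matForm_le hC0 hC x h
  have h3 := norm_matForm_le hC0 hC h x
  have h4 := norm_matForm_le hC0 hC h h
  -- Young's inequality with weight `δ`. In the application `‖h‖ ^ 2` is of order `δ ^ 2`, so the
  -- factor `1 / δ` still leaves an error of order `δ`.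
  have h5 : 2 * (‖x‖ * ‖h‖) ≤ δ * ‖x‖ ^ 2 + 1 / δ * ‖h‖ ^ 2 := by
    have : 0 ≤ (1 / δ) * (δ * ‖x‖ - ‖h‖) ^ 2 := by positivity
    have e2 : (1 / δ) * (δ * ‖x‖ - ‖h‖) ^ 2 =
        δ * ‖x‖ ^ 2 - 2 * (‖x‖ * ‖h‖) + 1 / δ * ‖h‖ ^ 2 := by
      field_simp
      ring
    linarith
  have h6 : C * (2 * (‖x‖ * ‖h‖)) ≤ C * (δ * ‖x‖ ^ 2 + 1 / δ * ‖h‖ ^ 2) :=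
    mul_le_mul_of_nonneg_left h5 hC0
  refine (norm_add_le _ _).trans ((add_le_add (norm_add₃_le) le_rfl).trans ?_)
  have h7 : (0 : ℝ) ≤ (Fintype.card κ : ℝ) ^ 2 := by positivity
  have h8 := mul_le_mul_of_nonneg_left h6 h7
  nlinarith

/-- The space of bounded measurable vector functions. -/
def bddVec (d : ℕ) : Submodule ℂ (ℝ → Fin d → ℂ) where
  carrier := {f | IsBddMeas f}
  add_mem' := fun hf hg => hf.add hg
  zero_mem' := ⟨measurable_const, 0, fun t => by simp⟩
  smul_mem' := fun c f hf => hf.const_smul c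

variable {d : ℕ} {a b : ℝ}

theorem measurable_matForm {N : ℝ → Matrix (Fin d) (Fin d) ℂ}
    (hN : ∀ i j, Measurable fun t => N t i j) {f g : ℝ → Fin d → ℂ} (hf : Measurable f)
    (hg : Measurable g) : Measurable fun t => matForm (N t) (f t) (g t) := by
  simp only [matForm_apply, Matrix.mulVec, dotProduct]
  refine Finset.measurable_sum _ fun i _ => Measurable.mul ?_
    (Finset.measurable_sum _ fun j _ => (hN i j).mul ((measurable_pi_apply j).comp hg))
  exact continuous_star.measurable.comp ((measurable_pi_apply i).comp hf)

theorem IsCoeff.intervalIntegrable_matForm {N : ℝ → Matrix (Fin d) (Fin d) ℂ}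
    (hN : IsCoeff a b N) {f g : ℝ → Fin d → ℂ} (hf : IsBddMeas f) (hg : IsBddMeas g) (s t : ℝ) :
    IntervalIntegrable (fun t => matForm (N t) (f t) (g t)) volume s t := by
  obtain ⟨C, hC0, hC⟩ := hN.exists_bound
  obtain ⟨h1, C1, hC1⟩ := hf
  obtain ⟨h2, C2, hC2⟩ := hg
  refine intervalIntegrable_of_bounded_complex (measurable_matForm hN.meas h1 h2)
    (C := Fintype.card (Fin d) ^ 2 * C * (C1 * C2)) (fun t => ?_) s t
  refine (norm_matForm_le hC0 (hC t) _ _).trans (mul_le_mul_of_nonneg_left ?_ (by positivity))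
  exact mul_le_mul (hC1 t) (hC2 t) (norm_nonneg _) ((norm_nonneg _).trans (hC1 t))

open Classical in
/-- The form `f, g ↦ ∫ f* N g`. -/
noncomputable def intForm (a b : ℝ) (N : ℝ → Matrix (Fin d) (Fin d) ℂ) (hN : IsCoeff a b N) :
    SesqForm (bddVec d) :=
  LinearMap.mk₂'ₛₗ _ _
    (fun f g => ∫ t in a..b, matForm (N t) ((f : ℝ → Fin d → ℂ) t) ((g : ℝ → Fin d → ℂ) t))
    (fun f f' g => by
      rw [← intervalIntegral.integral_add (hN.intervalIntegrable_matForm f.2 g.2 _ _)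
        (hN.intervalIntegrable_matForm f'.2 g.2 _ _)]
      simp only [Submodule.coe_add, Pi.add_apply, map_add, LinearMap.add_apply])
    (fun c f g => by
      simp only [Submodule.coe_smul, Pi.smul_apply, map_smulₛₗ, LinearMap.smul_apply]
      exact intervalIntegral.integral_smul _ _)
    (fun f g g' => by
      rw [← intervalIntegral.integral_add (hN.intervalIntegrable_matForm f.2 g.2 _ _)
        (hN.intervalIntegrable_matForm f.2 g'.2 _ _)]
      simp only [Submodule.coe_add, Pi.add_apply, map_add])
    (fun c f g => by
      simp only [Submodule.coe_smul, Pi.smul_apply, map_smulₛₗ]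
      exact intervalIntegral.integral_smul _ _)

theorem intForm_apply {N : ℝ → Matrix (Fin d) (Fin d) ℂ} (hN : IsCoeff a b N) (f g : bddVec d) :
    intForm a b N hN f g =
      ∫ t in a..b, matForm (N t) ((f : ℝ → Fin d → ℂ) t) ((g : ℝ → Fin d → ℂ) t) := rfl

theorem isHermForm_intForm {N : ℝ → Matrix (Fin d) (Fin d) ℂ} (hN : IsCoeff a b N)
    (hH : ∀ t, (N t).IsHermitian) : IsHermForm (intForm a b N hN) := by
  intro f g
  rw [intForm_apply, intForm_apply, intervalIntegral, intervalIntegral, map_sub, ← integral_conj,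
    ← integral_conj]
  simp only [fun t => isHermForm_matForm (hH t) ((f : ℝ → Fin d → ℂ) t) ((g : ℝ → Fin d → ℂ) t)]

theorem intForm_re {N : ℝ → Matrix (Fin d) (Fin d) ℂ} (hN : IsCoeff a b N) (f : bddVec d) :
    (intForm a b N hN f f).re = ∫ t in a..b, (matForm (N t) ((f : ℝ → Fin d → ℂ) t)
      ((f : ℝ → Fin d → ℂ) t)).re := by
  have := intervalIntegral.intervalIntegral_re (𝕜 := ℂ) (hN.intervalIntegrable_matForm f.2 f.2 a b)
  exact this.symm

/-- The square of the `L²` norm. -/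
noncomputable def sqInt {κ : Type*} [Fintype κ] (a b : ℝ) (f : ℝ → κ → ℂ) : ℝ := ∫ t in a..b, ‖f t‖ ^ 2

theorem IsBddMeas.intervalIntegrable_sq {κ : Type*} [Fintype κ] {f : ℝ → κ → ℂ} (hf : IsBddMeas f) (s t : ℝ) :
    IntervalIntegrable (fun t => ‖f t‖ ^ 2) volume s t := by
  obtain ⟨h1, C, hC⟩ := hf
  refine intervalIntegrable_of_bounded (h1.norm.pow_const 2) (C := C ^ 2) (fun t => ?_) s t
  rw [abs_of_nonneg (by positivity)]
  exact pow_le_pow_left₀ (norm_nonneg _) (hC t) 2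

theorem sqInt_nonneg {κ : Type*} [Fintype κ] (hab : a ≤ b) (f : ℝ → κ → ℂ) : 0 ≤ sqInt a b f :=
  intervalIntegral.integral_nonneg hab fun _ _ => by positivity

theorem norm_integral_sq_le {κ : Type*} [Fintype κ] {f : ℝ → κ → ℂ} (hf : IsBddMeas f) {s t : ℝ} (hs : s ∈ Icc a b)
    (ht : t ∈ Icc a b) : ‖∫ r in s..t, f r‖ ^ 2 ≤ |t - s| * sqInt a b f := by
  wlog hst : s ≤ t generalizing s t
  · rw [intervalIntegral.integral_symm, norm_neg, abs_sub_comm]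
    exact this ht hs (le_of_not_ge hst)
  obtain ⟨h1, C, hC⟩ := hf
  have h2 := sq_integral_le (f := fun r => ‖f r‖) h1.norm (C := C) (fun r => by simpa using hC r) hst
  have h3 : ∫ r in s..t, ‖f r‖ ^ 2 ≤ sqInt a b f :=
    intervalIntegral.integral_mono_interval hs.1 hst ht.2
      (Eventually.of_forall fun r => by positivity)
      (IsBddMeas.intervalIntegrable_sq ⟨h1, C, hC⟩ _ _)
  rw [abs_of_nonneg (sub_nonneg.2 hst)]
  exact (pow_le_pow_left₀ (norm_nonneg _)
    (intervalIntegral.norm_integral_le_integral_norm hst) 2).trans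
    (h2.trans (mul_le_mul_of_nonneg_left h3 (sub_nonneg.2 hst)))

theorem intForm_re_ge (hab : a ≤ b) {N : ℝ → Matrix (Fin d) (Fin d) ℂ} (hN : IsCoeff a b N) {μ : ℝ}
    (hμ : ∀ᵐ t ∂(volume.restrict (Icc a b)), ∀ v, μ * ‖v‖ ^ 2 ≤ (matForm (N t) v v).re)
    (f : bddVec d) : μ * sqInt a b (f : ℝ → Fin d → ℂ) ≤ (intForm a b N hN f f).re := by
  rw [intForm_re, sqInt, ← intervalIntegral.integral_const_mul]
  have hi := hN.intervalIntegrable_matForm f.2 f.2 a b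
  refine intervalIntegral.integral_mono_ae_restrict hab ((f.2.intervalIntegrable_sq a b).const_mul _)
    ?_ (hμ.mono fun t ht => ht _)
  exact ⟨hi.1.re, hi.2.re⟩

theorem norm_intForm_le (hab : a ≤ b) {N : ℝ → Matrix (Fin d) (Fin d) ℂ} (hN : IsCoeff a b N)
    {C : ℝ} (hC0 : 0 ≤ C)
    (hC : ∀ᵐ t ∂(volume.restrict (Icc a b)), ∀ i j, ‖N t i j‖ ≤ C) (f : bddVec d) :
    ‖intForm a b N hN f f‖ ≤ d ^ 2 * C * sqInt a b (f : ℝ → Fin d → ℂ) := by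
  rw [intForm_apply, sqInt, ← intervalIntegral.integral_const_mul]
  refine intervalIntegral.norm_integral_le_of_norm_le hab ?_
    ((f.2.intervalIntegrable_sq a b).const_mul _)
  rw [← ae_restrict_iff' measurableSet_Ioc]
  filter_upwards [ae_restrict_of_ae_restrict_of_subset Ioc_subset_Icc_self hC] with t ht
  simpa [pow_two] using norm_matForm_le hC0 ht ((f : ℝ → Fin d → ℂ) t) ((f : ℝ → Fin d → ℂ) t)

theorem norm_intForm_sub_le (hab : a ≤ b) {N N' : ℝ → Matrix (Fin d) (Fin d) ℂ}
    (hN : IsCoeff a b N) (hN' : IsCoeff a b N') {C δ : ℝ} (hC0 : 0 ≤ C) (hδ : 0 < δ)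
    (hC : ∀ᵐ t ∂(volume.restrict (Icc a b)), ∀ i j, ‖N' t i j‖ ≤ C)
    (hd : ∀ᵐ t ∂(volume.restrict (Icc a b)), ∀ i j, ‖(N' t - N t) i j‖ ≤ δ) (f h : bddVec d) :
    ‖intForm a b N' hN' (f + h) (f + h) - intForm a b N hN f f‖ ≤
      d ^ 2 * ((1 + C) * δ * sqInt a b (f : ℝ → Fin d → ℂ) + C * (1 + 1 / δ) * sqInt a b (h : ℝ → Fin d → ℂ)) := by
  rw [intForm_apply, intForm_apply, ← intervalIntegral.integral_sub
    (hN'.intervalIntegrable_matForm (f + h).2 (f + h).2 _ _)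
    (hN.intervalIntegrable_matForm f.2 f.2 _ _), sqInt, sqInt,
    ← intervalIntegral.integral_const_mul, ← intervalIntegral.integral_const_mul,
    ← intervalIntegral.integral_add ((f.2.intervalIntegrable_sq a b).const_mul _)
      ((h.2.intervalIntegrable_sq a b).const_mul _), ← intervalIntegral.integral_const_mul]
  refine intervalIntegral.norm_integral_le_of_norm_le hab ?_
    ((((f.2.intervalIntegrable_sq a b).const_mul _).add
      ((h.2.intervalIntegrable_sq a b).const_mul _)).const_mul _)
  rw [← ae_restrict_iff' measurableSet_Ioc]
  filter_upwards [ae_restrict_of_ae_restrict_of_subset Ioc_subset_Icc_self hC,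
    ae_restrict_of_ae_restrict_of_subset Ioc_subset_Icc_self hd] with t ht ht'
  simpa using norm_matForm_sub_le hC0 hδ ht ht' ((f : ℝ → Fin d → ℂ) t) ((h : ℝ → Fin d → ℂ) t)

/-! ### Functions of class `W^{1,∞}` -/

/-- The space of bounded measurable vector functions that vanish outside `(a,b]`. -/
def derivSpace (d : ℕ) (a b : ℝ) : Submodule ℂ (ℝ → Fin d → ℂ) where
  carrier := {f | IsBddMeas f ∧ ∀ t, t ∉ Ioc a b → f t = 0}
  add_mem' := fun hf hg => ⟨hf.1.add hg.1, fun t ht => by simp [hf.2 t ht, hg.2 t ht]⟩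
  zero_mem' := ⟨⟨measurable_const, 0, fun t => by simp⟩, fun t _ => rfl⟩
  smul_mem' := fun c f hf => ⟨hf.1.const_smul c, fun t ht => by simp [hf.2 t ht]⟩

/-- Triples `(c, g, ξ)` of an initial value, a derivative and a boundary parameter. -/
abbrev Triple (d : ℕ) (a b : ℝ) : Type :=
  (Fin d → ℂ) × derivSpace d a b × (Fin d ⊕ Fin d → ℂ)

/-- The derivative `g` of a triple. -/
def Triple.der : Triple d a b →ₗ[ℂ] bddVec d where
  toFun x := ⟨x.2.1, x.2.1.2.1⟩
  map_add' _ _ := rfl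
  map_smul' _ _ := rfl

theorem Triple.isBddMeas (x : Triple d a b) : IsBddMeas (x.2.1 : ℝ → Fin d → ℂ) := x.2.1.2.1

/-- The function `c + ∫ₐᵗ g`. -/
noncomputable def Triple.fn (x : Triple d a b) (t : ℝ) : Fin d → ℂ :=
  x.1 + ∫ s in a..t, (x.2.1 : ℝ → Fin d → ℂ) s

theorem Triple.fn_add (x y : Triple d a b) (t : ℝ) : (x + y).fn t = x.fn t + y.fn t := by
  have : ∫ s in a..t, ((x.2.1 + y.2.1 : derivSpace d a b) : ℝ → Fin d → ℂ) s =
      (∫ s in a..t, (x.2.1 : ℝ → Fin d → ℂ) s) + ∫ s in a..t, (y.2.1 : ℝ → Fin d → ℂ) s :=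
    intervalIntegral.integral_add (x.isBddMeas.intervalIntegrable _ _)
      (y.isBddMeas.intervalIntegrable _ _)
  simp only [Triple.fn, Prod.fst_add, Prod.snd_add, this]
  abel

theorem Triple.fn_smul (c : ℂ) (x : Triple d a b) (t : ℝ) : (c • x).fn t = c • x.fn t := by
  have : ∫ s in a..t, ((c • x.2.1 : derivSpace d a b) : ℝ → Fin d → ℂ) s =
      c • ∫ s in a..t, (x.2.1 : ℝ → Fin d → ℂ) s :=
    intervalIntegral.integral_smul c (x.2.1 : ℝ → Fin d → ℂ)
  simp only [Triple.fn, Prod.smul_fst, Prod.smul_snd, this, smul_add]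

@[simp]
theorem Triple.fn_left (x : Triple d a b) : x.fn a = x.1 := by simp [Triple.fn]

theorem Triple.continuous_fn (x : Triple d a b) : Continuous x.fn :=
  continuous_const.add (x.isBddMeas.continuous_primitive a)

theorem Triple.isBddMeas_fn (x : Triple d a b) : IsBddMeas x.fn := by
  refine ⟨x.continuous_fn.measurable, ?_⟩
  rcases le_total a b with hab | hab
  · obtain ⟨h1, C, hC⟩ := x.isBddMeas
    exact ⟨‖x.1‖ + C * (b - a), fun t => (norm_add_le _ _).trans (add_le_add le_rfl
      (norm_integral_le_of_supp hab ⟨h1, C, hC⟩ x.2.1.2.2 hC t))⟩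
  · refine ⟨‖x.1‖, fun t => ?_⟩
    have : (x.2.1 : ℝ → Fin d → ℂ) = 0 := by
      funext s
      exact x.2.1.2.2 s (by simp [Ioc_eq_empty (not_lt.2 hab)])
    simp [Triple.fn, this]

/-- The function `c + ∫ₐᵗ g` of a triple, as a linear map. -/
noncomputable def Triple.val : Triple d a b →ₗ[ℂ] bddVec d where
  toFun x := ⟨x.fn, x.isBddMeas_fn⟩
  map_add' x y := Subtype.ext (funext fun t => x.fn_add y t)
  map_smul' c x := Subtype.ext (funext fun t => x.fn_smul c t)

/-- The boundary values `(-y(a), y(b))`. -/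
noncomputable def Triple.bdry : Triple d a b →ₗ[ℂ] (Fin d ⊕ Fin d → ℂ) where
  toFun x := Sum.elim (-x.fn a) (x.fn b)
  map_add' x y := by
    rw [x.fn_add, x.fn_add, neg_add]
    ext (i | i) <;> rfl
  map_smul' c x := by
    rw [x.fn_smul, x.fn_smul, ← smul_neg]
    ext (i | i) <;> rfl

/-- The square of the `L²` norm of the derivative. -/
noncomputable def Triple.energy (x : Triple d a b) : ℝ := sqInt a b (x.der : ℝ → Fin d → ℂ)

/-- The square of the `L²` norm of the function. -/
noncomputable def Triple.mass (x : Triple d a b) : ℝ := sqInt a b (x.val : ℝ → Fin d → ℂ)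

theorem Triple.norm_fn_sub_sq_le (x : Triple d a b) {s t : ℝ} (hs : s ∈ Icc a b)
    (ht : t ∈ Icc a b) : ‖x.fn t - x.fn s‖ ^ 2 ≤ |t - s| * x.energy := by
  have h : x.fn t - x.fn s = ∫ r in s..t, (x.2.1 : ℝ → Fin d → ℂ) r := by
    rw [Triple.fn, Triple.fn, add_sub_add_left_eq_sub, intervalIntegral.integral_interval_sub_left
      (x.isBddMeas.intervalIntegrable _ _) (x.isBddMeas.intervalIntegrable _ _)]
  rw [h]
  exact norm_integral_sq_le x.isBddMeas hs ht

/-- A Sobolev inequality. -/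
theorem Triple.norm_fn_sq_le (x : Triple d a b) {h : ℝ} (h0 : 0 < h) (hh : 2 * h ≤ b - a) {t : ℝ}
    (ht : t ∈ Icc a b) : ‖x.fn t‖ ^ 2 ≤ 2 / h * x.mass + 2 * h * x.energy := by
  -- An interval of length `h` inside `[a,b]` with `t` as an endpoint; `2 * h ≤ b - a` ensures that
  -- it fits on one side. Averaging `‖y r‖ ^ 2` over it produces the mass, and the oscillation of
  -- `y` on it produces the energy with a factor that is small with `h`.
  obtain ⟨s, hs, hsb, hst⟩ : ∃ s, a ≤ s ∧ s + h ≤ b ∧ ∀ r ∈ Icc s (s + h), |t - r| ≤ h := by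
    rcases le_total (t + h) b with h1 | h1
    · refine ⟨t, ht.1, h1, fun r hr => abs_le.2 ⟨?_, ?_⟩⟩ <;> linarith [hr.1, hr.2]
    · refine ⟨t - h, by linarith, by linarith [ht.2], fun r hr => abs_le.2 ⟨?_, ?_⟩⟩ <;>
        linarith [hr.1, hr.2]
  have hγ : 0 ≤ x.energy := sqInt_nonneg (by linarith) _
  have h1 : ∀ r ∈ Icc s (s + h), ‖x.fn t‖ ^ 2 ≤ 2 * ‖x.fn r‖ ^ 2 + 2 * h * x.energy := by
    intro r hr
    have h2 := x.norm_fn_sub_sq_le (s := r) (t := t) ⟨hs.trans hr.1, hr.2.trans hsb⟩ ht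
    have h3 : ‖x.fn t‖ ≤ ‖x.fn t - x.fn r‖ + ‖x.fn r‖ := by
      simpa using norm_add_le (x.fn t - x.fn r) (x.fn r)
    have h4 := mul_le_mul_of_nonneg_right (hst r hr) hγ
    have h5 : ‖x.fn t‖ ^ 2 ≤ (‖x.fn t - x.fn r‖ + ‖x.fn r‖) ^ 2 :=
      pow_le_pow_left₀ (norm_nonneg _) h3 2
    nlinarith [sq_nonneg (‖x.fn t - x.fn r‖ - ‖x.fn r‖)]
  have hi := x.isBddMeas_fn.intervalIntegrable_sq s (s + h)
  have h6 := intervalIntegral.integral_mono_on (by linarith : s ≤ s + h)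
    (intervalIntegrable_const (μ := volume)) ((hi.const_mul 2).add intervalIntegrable_const) h1
  have h7 : ∫ r in s..(s + h), ‖x.fn r‖ ^ 2 ≤ x.mass :=
    intervalIntegral.integral_mono_interval hs (by linarith) hsb
      (Eventually.of_forall fun r => by positivity) (x.isBddMeas_fn.intervalIntegrable_sq _ _)
  rw [intervalIntegral.integral_add (hi.const_mul 2) intervalIntegrable_const,
    intervalIntegral.integral_const_mul, intervalIntegral.integral_const,
    intervalIntegral.integral_const, smul_eq_mul, smul_eq_mul, add_sub_cancel_left] at h6
  have h8 : h * ‖x.fn t‖ ^ 2 ≤ h * (2 / h * x.mass + 2 * h * x.energy) := by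
    have e : h * (2 / h * x.mass + 2 * h * x.energy) =
        2 * x.mass + h * (2 * h * x.energy) := by
      field_simp
    rw [e]
    linarith
  exact le_of_mul_le_mul_left h8 h0

end FormSpace

/-! ### The quadratic form of a Sturm-Liouville problem -/

section Problem

open Set ComplexConjugate

/-- Everywhere defined, bounded, Hermitian representatives of the coefficients, and of the inverse
`R` of the leading coefficient. -/
structure Model (d : ℕ) (a b : ℝ) where
  P : ℝ → Matrix (Fin d) (Fin d) ℂ
  Q : ℝ → Matrix (Fin d) (Fin d) ℂ
  W : ℝ → Matrix (Fin d) (Fin d) ℂ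
  R : ℝ → Matrix (Fin d) (Fin d) ℂ
  coeffP : IsCoeff a b P
  coeffQ : IsCoeff a b Q
  coeffW : IsCoeff a b W
  coeffR : IsCoeff a b R
  hermP : ∀ t, (P t).IsHermitian
  hermQ : ∀ t, (Q t).IsHermitian
  hermW : ∀ t, (W t).IsHermitian
  posP : ∃ μ : ℝ, 0 < μ ∧
    ∀ᵐ t ∂(volume.restrict (Icc a b)), ∀ v, μ * ‖v‖ ^ 2 ≤ (matForm (P t) v v).re
  posW : ∃ μ : ℝ, 0 < μ ∧
    ∀ᵐ t ∂(volume.restrict (Icc a b)), ∀ v, μ * ‖v‖ ^ 2 ≤ (matForm (W t) v v).re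
  mul_R : ∀ᵐ t ∂(volume.restrict (Icc a b)), P t * R t = 1
  R_mul : ∀ᵐ t ∂(volume.restrict (Icc a b)), R t * P t = 1

variable {d : ℕ} {a b : ℝ}

/-- The triples `(c, g, ξ)` with `(-y(a), y(b)) = B* ξ`. -/
def bdDomain (a b : ℝ) (M : BoundaryMatrix d) : Submodule ℂ (Triple d a b) where
  carrier := {x | Triple.bdry x = M.1.2ᴴ *ᵥ x.2.2}
  add_mem' := fun {x y} hx hy => by
    simp only [mem_ofPred_eq] at *
    rw [map_add, hx, hy, Prod.snd_add, Prod.snd_add, Matrix.mulVec_add]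
  zero_mem' := by simp
  smul_mem' := fun c x hx => by
    simp only [mem_ofPred_eq] at *
    rw [map_smul, hx, Prod.smul_snd, Prod.smul_snd, Matrix.mulVec_smul]

theorem mem_bdDomain {M : BoundaryMatrix d} {x : Triple d a b} :
    x ∈ bdDomain a b M ↔ Triple.bdry x = M.1.2ᴴ *ᵥ x.2.2 := Iff.rfl

/-- The boundary parameter of a triple. -/
def Triple.param : Triple d a b →ₗ[ℂ] (Fin d ⊕ Fin d → ℂ) :=
  LinearMap.snd ℂ _ _ ∘ₗ LinearMap.snd ℂ _ _

namespace Model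

variable (𝔐 : Model d a b) (M : BoundaryMatrix d)

/-- The form `∫ (g* P g + y* Q y) + ξ* B A* ξ`. -/
noncomputable def energyForm : SesqForm (Triple d a b) :=
  pullForm (intForm a b 𝔐.P 𝔐.coeffP) Triple.der + pullForm (intForm a b 𝔐.Q 𝔐.coeffQ) Triple.val +
    pullForm (matForm (M.1.2 * M.1.1ᴴ)) Triple.param

/-- The form `∫ y* W y`. -/
noncomputable def weightForm : SesqForm (Triple d a b) :=
  pullForm (intForm a b 𝔐.W 𝔐.coeffW) Triple.val

/-- The form of the operator minus `lam` on its form domain. -/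
noncomputable def qForm (lam : ℝ) : SesqForm (bdDomain a b M) :=
  pullForm (𝔐.energyForm M - (lam : ℂ) • 𝔐.weightForm) (bdDomain a b M).subtype

/-- The form of the weight on the form domain. -/
noncomputable def wForm : SesqForm (bdDomain a b M) :=
  pullForm 𝔐.weightForm (bdDomain a b M).subtype

theorem energyForm_apply (x y : Triple d a b) : 𝔐.energyForm M x y =
    intForm a b 𝔐.P 𝔐.coeffP (Triple.der x) (Triple.der y) +
      intForm a b 𝔐.Q 𝔐.coeffQ (Triple.val x) (Triple.val y) +
      matForm (M.1.2 * M.1.1ᴴ) x.2.2 y.2.2 := rfl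

theorem weightForm_apply (x y : Triple d a b) : 𝔐.weightForm x y =
    intForm a b 𝔐.W 𝔐.coeffW (Triple.val x) (Triple.val y) := rfl

theorem qForm_apply (lam : ℝ) (x y : bdDomain a b M) : 𝔐.qForm M lam x y =
    𝔐.energyForm M x y - lam * 𝔐.weightForm (x : Triple d a b) y := rfl

theorem wForm_apply (x y : bdDomain a b M) :
    𝔐.wForm M x y = 𝔐.weightForm (x : Triple d a b) y := rfl

theorem qForm_re (lam : ℝ) (x : bdDomain a b M) : (𝔐.qForm M lam x x).re =
    (𝔐.energyForm M x x).re - lam * (𝔐.weightForm (x : Triple d a b) x).re := by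
  rw [qForm_apply, Complex.sub_re, Complex.re_ofReal_mul]

theorem qForm_add (lam ε : ℝ) :
    𝔐.qForm M (lam + ε) = 𝔐.qForm M lam - (ε : ℂ) • 𝔐.wForm M := by
  refine LinearMap.ext₂ fun x y => ?_
  simp only [LinearMap.sub_apply, LinearMap.smul_apply, qForm_apply, wForm_apply, smul_eq_mul]
  push_cast
  ring

theorem isHermForm_energyForm : IsHermForm (𝔐.energyForm M) := by
  intro x y
  have h : (M.1.2 * M.1.1ᴴ).IsHermitian := by
    rw [Matrix.IsHermitian, Matrix.conjTranspose_mul, Matrix.conjTranspose_conjTranspose, M.2.2]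
  rw [energyForm_apply, energyForm_apply, map_add, map_add,
    isHermForm_intForm _ 𝔐.hermP, isHermForm_intForm _ 𝔐.hermQ, isHermForm_matForm h]

theorem isHermForm_weightForm : IsHermForm 𝔐.weightForm := by
  intro x y
  rw [weightForm_apply, weightForm_apply, isHermForm_intForm _ 𝔐.hermW]

theorem isHermForm_wForm : IsHermForm (𝔐.wForm M) := fun _ _ => 𝔐.isHermForm_weightForm _ _

theorem isHermForm_qForm (lam : ℝ) : IsHermForm (𝔐.qForm M lam) := by
  intro x y
  rw [qForm_apply, qForm_apply, map_sub, map_mul, 𝔐.isHermForm_energyForm M,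
    𝔐.isHermForm_weightForm, Complex.conj_ofReal]

/-- Quantitative bounds on a problem. -/
structure Bounded (μ C : ℝ) : Prop where
  posP : ∀ᵐ t ∂(volume.restrict (Icc a b)), ∀ v, μ * ‖v‖ ^ 2 ≤ (matForm (𝔐.P t) v v).re
  posW : ∀ᵐ t ∂(volume.restrict (Icc a b)), ∀ v, μ * ‖v‖ ^ 2 ≤ (matForm (𝔐.W t) v v).re
  bddP : ∀ᵐ t ∂(volume.restrict (Icc a b)), ∀ i j, ‖𝔐.P t i j‖ ≤ C
  bddQ : ∀ᵐ t ∂(volume.restrict (Icc a b)), ∀ i j, ‖𝔐.Q t i j‖ ≤ C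
  bddW : ∀ᵐ t ∂(volume.restrict (Icc a b)), ∀ i j, ‖𝔐.W t i j‖ ≤ C
  bddM : ∀ i j, ‖(M.1.2 * M.1.1ᴴ) i j‖ ≤ C
  lift : ∃ S : (Fin d ⊕ Fin d → ℂ) →ₗ[ℂ] (Fin d ⊕ Fin d → ℂ), ∀ ξ,
    M.1.2ᴴ *ᵥ S (M.1.2ᴴ *ᵥ ξ) = M.1.2ᴴ *ᵥ ξ ∧ ‖S (M.1.2ᴴ *ᵥ ξ)‖ ≤ C * ‖M.1.2ᴴ *ᵥ ξ‖

end Model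

/-- The boundary form depends on `ξ` only through `B* ξ`. -/
theorem matForm_boundary_congr {M : BoundaryMatrix d} {ξ ξ' : Fin d ⊕ Fin d → ℂ}
    (h : M.1.2ᴴ *ᵥ ξ = M.1.2ᴴ *ᵥ ξ') :
    matForm (M.1.2 * M.1.1ᴴ) ξ ξ = matForm (M.1.2 * M.1.1ᴴ) ξ' ξ' := by
  -- By `AB* = BA*`, the matrix `BA*` kills the kernel of `B*` acting from the right; acting from
  -- the left it does so directly.
  have e1 : (M.1.2 * M.1.1ᴴ) *ᵥ ξ = (M.1.2 * M.1.1ᴴ) *ᵥ ξ' := by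
    rw [← M.2.2, ← Matrix.mulVec_mulVec, ← Matrix.mulVec_mulVec, h]
  have e2 : ∀ ζ η, matForm (M.1.2 * M.1.1ᴴ) ζ η = star (M.1.2ᴴ *ᵥ ζ) ⬝ᵥ (M.1.1ᴴ *ᵥ η) := by
    intro ζ η
    rw [matForm_apply, Matrix.star_mulVec, Matrix.conjTranspose_conjTranspose,
      ← Matrix.dotProduct_mulVec, Matrix.mulVec_mulVec]
  calc matForm (M.1.2 * M.1.1ᴴ) ξ ξ = matForm (M.1.2 * M.1.1ᴴ) ξ ξ' := by
        rw [matForm_apply, e1, matForm_apply]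
    _ = matForm (M.1.2 * M.1.1ᴴ) ξ' ξ' := by rw [e2, h, ← e2]

theorem Triple.norm_bdry_sq_le (x : Triple d a b) {h : ℝ} (h0 : 0 < h) (hh : 2 * h ≤ b - a) :
    ‖Triple.bdry x‖ ^ 2 ≤ 2 / h * x.mass + 2 * h * x.energy := by
  have hab : a ≤ b := by linarith
  have h1 := x.norm_fn_sq_le h0 hh (left_mem_Icc.2 hab)
  have h2 := x.norm_fn_sq_le h0 hh (right_mem_Icc.2 hab)
  have h3 : ‖Triple.bdry x‖ ≤ max ‖x.fn a‖ ‖x.fn b‖ := by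
    refine (pi_norm_le_iff_of_nonneg (le_max_of_le_left (norm_nonneg _))).2 ?_
    rintro (i | i)
    · refine le_max_of_le_left ?_
      simpa [Triple.bdry] using norm_le_pi_norm (x.fn a) i
    · refine le_max_of_le_right ?_
      simpa [Triple.bdry] using norm_le_pi_norm (x.fn b) i
  refine (pow_le_pow_left₀ (norm_nonneg _) h3 2).trans ?_
  rcases max_choice ‖x.fn a‖ ‖x.fn b‖ with h | h <;> rw [h] <;> assumption

theorem Triple.mass_nonneg (hab : a ≤ b) (x : Triple d a b) : 0 ≤ x.mass := sqInt_nonneg hab _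

theorem Triple.energy_nonneg (hab : a ≤ b) (x : Triple d a b) : 0 ≤ x.energy := sqInt_nonneg hab _

namespace Model

theorem weightForm_re_ge (hab : a ≤ b) {𝔐 : Model d a b} {M : BoundaryMatrix d} {μ C : ℝ}
    (h : 𝔐.Bounded M μ C) (x : Triple d a b) : μ * x.mass ≤ (𝔐.weightForm x x).re :=
  intForm_re_ge hab 𝔐.coeffW h.posW _

theorem norm_weightForm_le (hab : a ≤ b) {𝔐 : Model d a b} {M : BoundaryMatrix d} {μ C : ℝ}
    (hC : 0 ≤ C) (h : 𝔐.Bounded M μ C) (x : Triple d a b) :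
    ‖𝔐.weightForm x x‖ ≤ d ^ 2 * C * x.mass :=
  norm_intForm_le hab 𝔐.coeffW hC h.bddW _

/-- Coercivity of the energy form (Gårding's inequality), with uniform constants. -/
theorem exists_coercive (hab : a < b) (d : ℕ) {μ C : ℝ} (hμ : 0 < μ) (hC : 0 ≤ C) :
    ∃ K : ℝ, 0 ≤ K ∧ ∀ (𝔐 : Model d a b) (M : BoundaryMatrix d), 𝔐.Bounded M μ C →
      ∀ x ∈ bdDomain a b M, μ / 2 * x.energy ≤ (𝔐.energyForm M x x).re + K * x.mass := by
  obtain ⟨D, hD⟩ : ∃ D : ℝ, D = (Fintype.card (Fin d ⊕ Fin d) : ℝ) ^ 2 * C * C ^ 2 := ⟨_, rfl⟩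
  have hD0 : 0 ≤ D := by rw [hD]; positivity
  -- The boundary form is at most `D` times the square of the boundary values. With this `h` in the
  -- Sobolev inequality it absorbs at most half of the energy supplied by `P`.
  obtain ⟨h, hh0, hhb, hhD⟩ : ∃ h : ℝ, 0 < h ∧ 2 * h ≤ b - a ∧ D * (2 * h) ≤ μ / 2 := by
    refine ⟨min ((b - a) / 2) (μ / (4 * (D + 1))), lt_min (by linarith) (by positivity), ?_, ?_⟩
    · linarith [min_le_left ((b - a) / 2) (μ / (4 * (D + 1)))]
    · have h1 := min_le_right ((b - a) / 2) (μ / (4 * (D + 1)))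
      have h2 : (D + 1) * (2 * (μ / (4 * (D + 1)))) = μ / 2 := by field_simp; ring
      have h3 : 0 < μ / (4 * (D + 1)) := by positivity
      nlinarith [mul_le_mul_of_nonneg_left h1 hD0]
  refine ⟨d ^ 2 * C + D * (2 / h), by positivity, fun 𝔐 M hM x hx => ?_⟩
  have h1 : μ * x.energy ≤ _ := intForm_re_ge hab.le 𝔐.coeffP hM.posP (Triple.der x)
  have h2 : _ ≤ d ^ 2 * C * x.mass := norm_intForm_le hab.le 𝔐.coeffQ hC hM.bddQ (Triple.val x)
  have h3 := (Complex.abs_re_le_norm _).trans h2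
  obtain ⟨S, hS⟩ := hM.lift
  -- The parameter `x.2.2` is controlled only modulo the kernel of `B*`. The boundary form does not
  -- see that kernel, so the parameter may be replaced by its bounded lift.
  have h4 : ‖matForm (M.1.2 * M.1.1ᴴ) x.2.2 x.2.2‖ ≤ D * ‖Triple.bdry x‖ ^ 2 := by
    rw [mem_bdDomain.1 hx, matForm_boundary_congr (hS x.2.2).1.symm]
    refine (norm_matForm_le hC hM.bddM _ _).trans ?_
    have h5 := mul_self_le_mul_self (norm_nonneg _) (hS x.2.2).2
    calc _ ≤ (Fintype.card (Fin d ⊕ Fin d) : ℝ) ^ 2 * C * _ :=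
          mul_le_mul_of_nonneg_left h5 (by positivity)
      _ = _ := by rw [hD]; ring
  have h5 := (Complex.abs_re_le_norm _).trans (h4.trans
    (mul_le_mul_of_nonneg_left (x.norm_bdry_sq_le hh0 hhb) hD0))
  have h6 := mul_le_mul_of_nonneg_right hhD (x.energy_nonneg hab.le)
  rw [energyForm_apply, Complex.add_re, Complex.add_re]
  have h7 := (abs_le.1 h3).1
  have h8 := (abs_le.1 h5).1
  have h9 : (d ^ 2 * C + D * (2 / h)) * x.mass = d ^ 2 * C * x.mass + D * (2 / h * x.mass) := by
    ring
  nlinarith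

/-- Every single problem has such bounds. They are collected in two numbers because the coercivity
and comparison constants must depend on these alone, so as to be uniform over neighbouring problems.
-/
theorem exists_bounded (𝔐 : Model d a b) (M : BoundaryMatrix d) :
    ∃ μ C : ℝ, 0 < μ ∧ 0 ≤ C ∧ 𝔐.Bounded M μ C := by
  obtain ⟨μ₁, h1, h1'⟩ := 𝔐.posP
  obtain ⟨μ₂, h2, h2'⟩ := 𝔐.posW
  obtain ⟨C₁, h3, h3'⟩ := 𝔐.coeffP.exists_bound
  obtain ⟨C₂, h4, h4'⟩ := 𝔐.coeffQ.exists_bound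
  obtain ⟨C₃, h5, h5'⟩ := 𝔐.coeffW.exists_bound
  obtain ⟨C₄, h6⟩ : ∃ C₄ : ℝ, ∀ i j, ‖(M.1.2 * M.1.1ᴴ) i j‖ ≤ C₄ := by
    obtain ⟨C, hC⟩ := (Set.finite_range fun p : (Fin d ⊕ Fin d) × (Fin d ⊕ Fin d) =>
      ‖(M.1.2 * M.1.1ᴴ) p.1 p.2‖).bddAbove
    exact ⟨C, fun i j => hC ⟨(i, j), rfl⟩⟩
  -- A linear right inverse of `B*` on its range, extended to the whole space, serves as the lift.
  let T := (M.1.2ᴴ).mulVecLin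
  obtain ⟨S, hS⟩ := T.rangeRestrict.exists_rightInverse_of_surjective T.range_rangeRestrict
  obtain ⟨S', hS'⟩ := S.exists_extend
  have hSS : ∀ ξ, M.1.2ᴴ *ᵥ S' (M.1.2ᴴ *ᵥ ξ) = M.1.2ᴴ *ᵥ ξ := by
    intro ξ
    have e1 : S' (M.1.2ᴴ *ᵥ ξ) = S (T.rangeRestrict ξ) :=
      LinearMap.congr_fun hS' (T.rangeRestrict ξ)
    have e2 := congrArg Subtype.val (LinearMap.congr_fun hS (T.rangeRestrict ξ))
    rw [e1]
    exact e2
  obtain ⟨μ, hμ⟩ : ∃ μ, μ = min μ₁ μ₂ := ⟨_, rfl⟩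
  obtain ⟨C₅, hC₅⟩ : ∃ C₅ : ℝ, C₅ = ‖LinearMap.toContinuousLinearMap S'‖ := ⟨_, rfl⟩
  have hC₅0 : 0 ≤ C₅ := hC₅ ▸ norm_nonneg _
  obtain ⟨C, hC⟩ : ∃ C, C = C₁ + C₂ + C₃ + |C₄| + C₅ := ⟨_, rfl⟩
  have hC₄ := abs_nonneg C₄
  have hC₄' := le_abs_self C₄
  refine ⟨μ, C, hμ ▸ lt_min h1 h2, by rw [hC]; positivity, ?_⟩
  refine ⟨h1'.mono fun t ht v => ?_, h2'.mono fun t ht v => ?_,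
    Eventually.of_forall fun t i j => (h3' t i j).trans (by linarith),
    Eventually.of_forall fun t i j => (h4' t i j).trans (by linarith),
    Eventually.of_forall fun t i j => (h5' t i j).trans (by linarith),
    fun i j => (h6 i j).trans (by linarith), S', fun ξ => ⟨hSS ξ, ?_⟩⟩
  · exact (mul_le_mul_of_nonneg_right (hμ ▸ min_le_left _ _) (by positivity)).trans (ht v)
  · exact (mul_le_mul_of_nonneg_right (hμ ▸ min_le_right _ _) (by positivity)).trans (ht v)
  · refine ((LinearMap.toContinuousLinearMap S').le_opNorm _).trans ?_
    exact mul_le_mul_of_nonneg_right (by linarith) (norm_nonneg _)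

variable (𝔐 : Model d a b) (M : BoundaryMatrix d)

theorem wForm_nonneg (hab : a ≤ b) (x : bdDomain a b M) : 0 ≤ (𝔐.wForm M x x).re := by
  obtain ⟨μ, C, hμ, hC, h⟩ := 𝔐.exists_bounded M
  exact (mul_nonneg hμ.le (Triple.mass_nonneg hab _)).trans (weightForm_re_ge hab h x)

theorem qForm_anti (hab : a ≤ b) {lam lam' : ℝ} (h : lam ≤ lam') (x : bdDomain a b M) :
    (𝔐.qForm M lam' x x).re ≤ (𝔐.qForm M lam x x).re := by
  rw [qForm_re, qForm_re]
  have h1 : 0 ≤ (𝔐.weightForm (x : Triple d a b) x).re := 𝔐.wForm_nonneg M hab x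
  nlinarith

/-- For very negative `lam` the form is nonnegative. -/
theorem exists_not_indexGE_one (hab : a < b) : ∃ lam : ℝ, ¬ IndexGE (𝔐.qForm M lam) 1 := by
  obtain ⟨μ, C, hμ, hC, h⟩ := 𝔐.exists_bounded M
  obtain ⟨K, hK0, hK⟩ := exists_coercive hab d hμ hC
  -- The weight form is at least `μ` times the mass, so this parameter outweighs the defect `K *
  -- mass` in the coercivity estimate.
  refine ⟨-(K / μ), ?_⟩
  refine not_indexGE_one_of_nonneg fun x => ?_
  rw [qForm_re]
  have h2 := hK 𝔐 M h x x.2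
  have h3 := weightForm_re_ge hab.le h x
  have h4 := Triple.energy_nonneg hab.le (x : Triple d a b)
  have h5 := mul_le_mul_of_nonneg_left h3 (div_nonneg hK0 hμ.le)
  have h6 : K / μ * (μ * Triple.mass (x : Triple d a b)) = K * Triple.mass (x : Triple d a b) := by
    field_simp
  nlinarith

/-- The index is finite. -/
theorem exists_not_indexGE (hab : a < b) (lam : ℝ) : ∃ n, ¬ IndexGE (𝔐.qForm M lam) n := by
  obtain ⟨μ, C, hμ, hC, h⟩ := 𝔐.exists_bounded M
  obtain ⟨K, hK0, hK⟩ := exists_coercive hab d hμ hC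
  obtain ⟨L, hL⟩ : ∃ L : ℝ, L = K + |lam| * (d ^ 2 * C) := ⟨_, rfl⟩
  have hL0 : 0 ≤ L := by rw [hL]; positivity
  have hba : 0 < b - a := sub_pos.2 hab
  -- A function vanishing at `k` equidistant nodes has mass at most `(b - a) ^ 2 / k` times its
  -- energy. For this `k`, `L * mass` is then at most `μ / 2 * energy`, and the form is nonnegative.
  -- Vanishing at the nodes amounts to `k * d` linear conditions.
  obtain ⟨k, hk⟩ := exists_nat_gt (2 * L * (b - a) ^ 2 / μ)
  have hk0 : (0 : ℝ) < k := lt_of_le_of_lt (by positivity) hk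
  let p : Fin k → ℝ := fun i => a + (b - a) * (i / k)
  have hp : ∀ i, p i ∈ Icc a b := fun i => by
    have h1 : (i : ℝ) / k ≤ 1 := by
      rw [div_le_one hk0]
      exact_mod_cast i.2.le
    have h2 : 0 ≤ (i : ℝ) / k := by positivity
    constructor <;> simp only [p] <;> nlinarith
  refine ⟨k * d + 1, ?_⟩
  intro hidx
  let ev : Triple d a b →ₗ[ℂ] (Fin k → Fin d → ℂ) := LinearMap.pi fun i =>
    { toFun := fun x => Triple.fn x (p i)
      map_add' := fun x y => Triple.fn_add _ _ _
      map_smul' := fun c x => Triple.fn_smul _ _ _ }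
  have hle := hidx.le_finrank (ev ∘ₗ (bdDomain a b M).subtype) fun u hu => by
    by_contra! h1
    set x : Triple d a b := (u : Triple d a b)
    have hz : ∀ i, x.fn (p i) = 0 := fun i => congrFun hu i
    have hE := x.energy_nonneg hab.le
    have h2 : ∀ t ∈ Icc a b, ‖x.fn t‖ ^ 2 ≤ (b - a) / k * x.energy := by
      intro t ht
      obtain ⟨i, hi⟩ : ∃ i : Fin k, |t - p i| ≤ (b - a) / k := by
        have hs0 : 0 ≤ (t - a) / (b - a) * k := by
          have := sub_nonneg.2 ht.1
          positivity
        have hpi : ∀ i : ℕ, (i : ℝ) ≤ (t - a) / (b - a) * k →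
            (t - a) / (b - a) * k ≤ i + 1 → |t - (a + (b - a) * (i / k))| ≤ (b - a) / k := by
          intro i h1 h2
          have e : t - (a + (b - a) * (i / k)) =
              (b - a) / k * ((t - a) / (b - a) * k - i) := by
            field_simp
            ring
          rw [e, abs_mul, abs_of_pos (by positivity), abs_of_nonneg (by linarith)]
          exact mul_le_of_le_one_right (by positivity) (by linarith)
        -- The nodes are the left ends of the `k` cells. The floor reaches `k` only at `t = b`,
        -- which belongs to the last cell, with index `k - 1`.
        rcases lt_or_ge ⌊(t - a) / (b - a) * k⌋₊ k with hlt | hge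
        · exact ⟨⟨_, hlt⟩, hpi _ (Nat.floor_le hs0) (Nat.lt_floor_add_one _).le⟩
        · have hk1 : 1 ≤ k := by exact_mod_cast hk0
          have h3 : (t - a) / (b - a) * k ≤ k := by
            refine mul_le_of_le_one_left hk0.le ?_
            rw [div_le_one hba]
            linarith [ht.2]
          have h4 : (k : ℝ) ≤ (t - a) / (b - a) * k :=
            (Nat.cast_le.2 hge).trans (Nat.floor_le hs0)
          refine ⟨⟨k - 1, by omega⟩, hpi _ ?_ ?_⟩ <;> rw [Nat.cast_sub hk1] <;> push_cast <;> linarith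
      have h3 := x.norm_fn_sub_sq_le (hp i) ht
      rw [hz, sub_zero] at h3
      exact h3.trans (mul_le_mul_of_nonneg_right hi hE)
    have h3 : x.mass ≤ (b - a) * ((b - a) / k * x.energy) := by
      have := intervalIntegral.integral_mono_on hab.le (x.isBddMeas_fn.intervalIntegrable_sq a b)
        intervalIntegrable_const h2
      rwa [intervalIntegral.integral_const, smul_eq_mul] at this
    have h4 := hK 𝔐 M h x u.2
    have h5 := (Complex.abs_re_le_norm _).trans (norm_weightForm_le hab.le hC h x)
    rw [qForm_re] at h1
    have h6 : lam * (𝔐.weightForm x x).re ≤ |lam| * (d ^ 2 * C * x.mass) :=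
      (le_abs_self _).trans ((abs_mul _ _).trans_le (mul_le_mul_of_nonneg_left h5 (abs_nonneg _)))
    have h7 : μ / 2 * x.energy < L * x.mass := by
      have h1' : (𝔐.energyForm M x x).re - lam * (𝔐.weightForm x x).re < 0 := h1
      rw [hL]
      nlinarith
    have h8 : L * ((b - a) * ((b - a) / k)) ≤ μ / 2 := by
      rw [div_lt_iff₀ hμ] at hk
      have e : L * ((b - a) * ((b - a) / k)) = (2 * L * (b - a) ^ 2) / (2 * k) := by
        field_simp
      rw [e, div_le_iff₀ (by positivity)]
      linarith
    have h9 := mul_le_mul_of_nonneg_right h8 hE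
    have h10 := mul_le_mul_of_nonneg_left h3 hL0
    nlinarith
  simp [Module.finrank_pi_fintype] at hle

end Model
end Problem

/-! ### Vanishing integrals, absolutely continuous functions and integration by parts -/

section Calculus

open Set ComplexConjugate

variable {a b : ℝ}

theorem IsBddMeas.ae_eq_zero {κ : Type*} [Fintype κ] {f : ℝ → κ → ℂ} (hab : a ≤ b)
    (hf : IsBddMeas f) (h : sqInt a b f = 0) : ∀ᵐ t ∂(volume.restrict (Icc a b)), f t = 0 := by
  rw [sqInt, intervalIntegral.integral_of_le hab, ← integral_Icc_eq_integral_Ioc] at h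
  have hi : Integrable (fun t => ‖f t‖ ^ 2) (volume.restrict (Icc a b)) :=
    ((intervalIntegrable_iff_integrableOn_Icc_of_le hab).1 (hf.intervalIntegrable_sq a b))
  rw [integral_eq_zero_iff_of_nonneg (fun t => by positivity) hi] at h
  filter_upwards [h] with t ht
  simpa using ht

theorem eqOn_zero_of_ae_eq_zero {E : Type*} [TopologicalSpace E] [T2Space E] [Zero E] {f : ℝ → E}
    (hab : a < b) (hf : Continuous f) (h : ∀ᵐ t ∂(volume.restrict (Icc a b)), f t = 0) :
    ∀ t ∈ Icc a b, f t = 0 :=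
  Measure.eqOn_Icc_of_ae_eq volume hab.ne h hf.continuousOn continuousOn_const

/-! ### Primitives and the fundamental theorem of calculus for absolutely continuous functions. -/

section FTC

variable {E : Type*} [NormedAddCommGroup E] [NormedSpace ℝ E]

theorem lipschitzWith_primitive {f : ℝ → E} (hf : ∀ s t, IntervalIntegrable f volume s t) {C : ℝ}
    (hC : ∀ t, ‖f t‖ ≤ C) : LipschitzWith C.toNNReal fun t => ∫ s in a..t, f s := by
  refine LipschitzWith.of_dist_le' fun s t => ?_
  rw [dist_eq_norm, intervalIntegral.integral_interval_sub_left (hf _ _) (hf _ _), Real.dist_eq]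
  exact intervalIntegral.norm_integral_le_of_norm_le_const fun r _ => hC r

theorem absolutelyContinuous_primitive {f : ℝ → E} (hf : ∀ s t, IntervalIntegrable f volume s t)
    {C : ℝ} (hC : ∀ t, ‖f t‖ ≤ C) :
    AbsolutelyContinuousOnInterval (fun t => ∫ s in a..t, f s) a b :=
  (lipschitzWith_primitive hf hC).lipschitzOnWith.absolutelyContinuousOnInterval

theorem ae_hasDerivAt_primitive [CompleteSpace E] {f : ℝ → E}
    (hf : ∀ s t, IntervalIntegrable f volume s t) :
    ∀ᵐ t, HasDerivAt (fun t => ∫ s in a..t, f s) (f t) t := by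
  have h : LocallyIntegrable f volume := by
    intro t
    refine ⟨Ioo (t - 1) (t + 1), Ioo_mem_nhds (by linarith) (by linarith), ?_⟩
    exact (((intervalIntegrable_iff_integrableOn_Ioo_of_le (by linarith)).1
      (hf (t - 1) (t + 1))))
  exact (LocallyIntegrable.ae_hasDerivAt_integral h).mono fun t ht => ht a

/-- The fundamental theorem of calculus for absolutely continuous functions with a bounded
derivative. -/
theorem eq_add_integral_of_absolutelyContinuous [CompleteSpace E] (hab : a ≤ b) {F f : ℝ → E}
    (hF : AbsolutelyContinuousOnInterval F a b)
    (hf : ∀ s t, IntervalIntegrable f volume s t) {C : ℝ} (hC : ∀ t, ‖f t‖ ≤ C)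
    (hd : ∀ᵐ t, t ∈ Icc a b → HasDerivAt F (f t) t) :
    ∀ t ∈ Icc a b, F t = F a + ∫ s in a..t, f s := by
  -- The difference of `F` and the primitive of `f` is absolutely continuous with derivative zero
  -- almost everywhere, hence constant.
  have h1 := hF.fun_sub (absolutelyContinuous_primitive (a := a) (b := b) hf hC)
  obtain ⟨c, hc⟩ := h1.const_of_ae_hasDerivAt_zero (by
    filter_upwards [hd, ae_hasDerivAt_primitive (a := a) hf] with t h2 h3 h4
    rw [uIcc_of_le hab] at h4
    have h5 := (h2 h4).fun_sub h3
    rwa [sub_self] at h5)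
  rw [uIcc_of_le hab] at hc
  intro t ht
  have h2 := hc t ht
  have h3 := hc a (left_mem_Icc.2 hab)
  simp only [intervalIntegral.integral_same, sub_zero] at h3
  rw [h3, ← h2]
  abel

end FTC

/-- Integration by parts. -/
theorem integral_mul_add_mul (hab : a ≤ b) {f g y z : ℝ → ℂ} (hf : Measurable f)
    (hg : Measurable g) {C : ℝ} (hfC : ∀ t, ‖f t‖ ≤ C) (hgC : ∀ t, ‖g t‖ ≤ C)
    (hy : ∀ t, y t = y a + ∫ s in a..t, f s) (hz : ∀ t, z t = z a + ∫ s in a..t, g s)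
    {D : ℝ} (hyD : ∀ t, ‖y t‖ ≤ D) (hzD : ∀ t, ‖z t‖ ≤ D) :
    ∫ t in a..b, (f t * z t + y t * g t) = y b * z b - y a * z a := by
  have hfi := intervalIntegrable_of_bounded_complex hf hfC
  have hgi := intervalIntegrable_of_bounded_complex hg hgC
  have hy' : y = fun t => y a + ∫ s in a..t, f s := funext hy
  have hz' : z = fun t => z a + ∫ s in a..t, g s := funext hz
  have hyc : Continuous y := by
    rw [hy']
    exact continuous_const.add (intervalIntegral.continuous_primitive hfi a)
  have hzc : Continuous z := by
    rw [hz']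
    exact continuous_const.add (intervalIntegral.continuous_primitive hgi a)
  have hyL : LipschitzWith C.toNNReal y := by
    rw [hy']
    refine LipschitzWith.of_dist_le_mul fun s t => ?_
    rw [dist_add_left]
    exact (lipschitzWith_primitive (a := a) hfi hfC).dist_le_mul s t
  have hzL : LipschitzWith C.toNNReal z := by
    rw [hz']
    refine LipschitzWith.of_dist_le_mul fun s t => ?_
    rw [dist_add_left]
    exact (lipschitzWith_primitive (a := a) hgi hgC).dist_le_mul s t
  have hD0 : 0 ≤ D := (norm_nonneg _).trans (hyD a)
  have hC0 : 0 ≤ C := (norm_nonneg _).trans (hfC a)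
  have hB : ∀ t, ‖f t * z t + y t * g t‖ ≤ C * D + D * C := fun t =>
    (norm_add_le _ _).trans (add_le_add
      ((norm_mul _ _).trans_le (mul_le_mul (hfC t) (hzD t) (norm_nonneg _) hC0))
      ((norm_mul _ _).trans_le (mul_le_mul (hyD t) (hgC t) (norm_nonneg _) hD0)))
  have hi := intervalIntegrable_of_bounded_complex
    ((hf.mul hzc.measurable).add (hyc.measurable.mul hg)) hB
  have hAC : AbsolutelyContinuousOnInterval (fun t => y t * z t) a b :=
    (hyL.lipschitzOnWith.absolutelyContinuousOnInterval).fun_smul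
      hzL.lipschitzOnWith.absolutelyContinuousOnInterval
  have := eq_add_integral_of_absolutelyContinuous hab hAC hi hB (by
    filter_upwards [ae_hasDerivAt_primitive (a := a) hfi, ae_hasDerivAt_primitive (a := a) hgi]
      with t h1 h2 _
    have h3 : HasDerivAt y (f t) t := by
      rw [hy']
      exact h1.const_add _
    have h4 : HasDerivAt z (g t) t := by
      rw [hz']
      exact h2.const_add _
    exact h3.mul h4) b (right_mem_Icc.2 hab)
  rw [this, add_sub_cancel_left]
  rfl

theorem integral_apply {κ : Type*} [Fintype κ] {f : ℝ → κ → ℂ} (hf : IsBddMeas f) (s t : ℝ)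
    (i : κ) : (∫ r in s..t, f r) i = ∫ r in s..t, f r i :=
  ((ContinuousLinearMap.proj (R := ℂ) (φ := fun _ : κ => ℂ) i).intervalIntegral_comp_comm
    (hf.intervalIntegrable s t)).symm

/-- Integration by parts for vector functions. -/
theorem integral_dotProduct_add {κ : Type*} [Fintype κ] (hab : a ≤ b) {f g y z : ℝ → κ → ℂ}
    (hf : IsBddMeas f) (hg : IsBddMeas g) (hyb : IsBddMeas y) (hzb : IsBddMeas z)
    (hy : ∀ t, y t = y a + ∫ s in a..t, f s) (hz : ∀ t, z t = z a + ∫ s in a..t, g s) :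
    ∫ t in a..b, (star (f t) ⬝ᵥ z t + star (y t) ⬝ᵥ g t) =
      star (y b) ⬝ᵥ z b - star (y a) ⬝ᵥ z a := by
  obtain ⟨C₁, h1⟩ := hf.2
  obtain ⟨C₂, h2⟩ := hg.2
  obtain ⟨C₃, h3⟩ := hyb.2
  obtain ⟨C₄, h4⟩ := hzb.2
  have key : ∀ i, ∫ t in a..b, (conj (f t i) * z t i + conj (y t i) * g t i) =
      conj (y b i) * z b i - conj (y a i) * z a i := by
    intro i
    refine integral_mul_add_mul hab (f := fun t => conj (f t i)) (y := fun t => conj (y t i))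
      (z := fun t => z t i) (g := fun t => g t i) (C := max C₁ C₂) (D := max C₃ C₄)
      (continuous_star.measurable.comp ((measurable_pi_apply i).comp hf.1))
      ((measurable_pi_apply i).comp hg.1) (fun t => ?_) (fun t => ?_) (fun t => ?_) (fun t => ?_)
      (fun t => ?_) (fun t => ?_)
    · rw [RCLike.norm_conj]
      exact (norm_le_pi_norm _ i).trans ((h1 t).trans (le_max_left _ _))
    · exact (norm_le_pi_norm _ i).trans ((h2 t).trans (le_max_right _ _))
    · have e := congrArg (fun v : κ → ℂ => conj (v i)) (hy t)
      simp only [Pi.add_apply, map_add, integral_apply hf] at e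
      rw [e, intervalIntegral, intervalIntegral, map_sub, ← integral_conj, ← integral_conj]
    · have e := congrArg (fun v : κ → ℂ => v i) (hz t)
      simpa only [Pi.add_apply, integral_apply hg] using e
    · rw [RCLike.norm_conj]
      exact (norm_le_pi_norm _ i).trans ((h3 t).trans (le_max_left _ _))
    · exact (norm_le_pi_norm _ i).trans ((h4 t).trans (le_max_right _ _))
  simp only [dotProduct, ← Finset.sum_add_distrib, ← Finset.sum_sub_distrib]
  rw [intervalIntegral.integral_finsetSum]
  · exact Finset.sum_congr rfl fun i _ => key i
  · intro i _
    refine intervalIntegrable_of_bounded_complex (C := C₁ * C₄ + C₃ * C₂) ?_ (fun t => ?_) _ _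
    · exact ((continuous_star.measurable.comp ((measurable_pi_apply i).comp hf.1)).mul
        ((measurable_pi_apply i).comp hzb.1)).add
        ((continuous_star.measurable.comp ((measurable_pi_apply i).comp hyb.1)).mul
        ((measurable_pi_apply i).comp hg.1))
    · refine (norm_add_le _ _).trans (add_le_add ?_ ?_) <;>
        rw [norm_mul, Pi.star_apply, norm_star]
      · exact mul_le_mul ((norm_le_pi_norm _ i).trans (h1 t)) ((norm_le_pi_norm _ i).trans (h4 t))
          (norm_nonneg _) ((norm_nonneg _).trans (h1 t))
      · exact mul_le_mul ((norm_le_pi_norm _ i).trans (h3 t)) ((norm_le_pi_norm _ i).trans (h2 t))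
          (norm_nonneg _) ((norm_nonneg _).trans (h3 t))

end Calculus

/-! ### The index is unbounded -/

section Polynomial

open Set Polynomial

variable {d : ℕ} {a b : ℝ}

theorem hasDerivAt_eval_ofReal (p : ℂ[X]) (t : ℝ) :
    HasDerivAt (fun t : ℝ => p.eval (t : ℂ)) (p.derivative.eval (t : ℂ)) t :=
  (p.hasDerivAt (t : ℂ)).comp_ofReal

theorem continuous_eval_ofReal (p : ℂ[X]) : Continuous fun t : ℝ => p.eval (t : ℂ) :=
  p.continuous.comp Complex.continuous_ofReal

theorem isBddMeas_single (i₀ : Fin d) (p : ℂ[X]) :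
    IsBddMeas ((Ioc a b).indicator fun t : ℝ =>
      (Pi.single i₀ (p.eval (t : ℂ)) : Fin d → ℂ)) := by
  have hc : Continuous fun t : ℝ => (Pi.single i₀ (p.eval (t : ℂ)) : Fin d → ℂ) :=
    (continuous_single i₀).comp (continuous_eval_ofReal p)
  refine ⟨hc.measurable.indicator measurableSet_Ioc, ?_⟩
  obtain ⟨C, hC⟩ := isCompact_Icc.exists_bound_of_continuousOn (hc.continuousOn (s := Icc a b))
  refine ⟨max C 0, fun t => ?_⟩
  by_cases ht : t ∈ Ioc a b
  · rw [indicator_of_mem ht]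
    exact (hC t (Ioc_subset_Icc_self ht)).trans (le_max_left _ _)
  · rw [indicator_of_notMem ht, norm_zero]
    exact le_max_right _ _

/-- The triple of a polynomial function with values in a coordinate line. -/
noncomputable def polyTriple (a b : ℝ) (i₀ : Fin d) : ℂ[X] →ₗ[ℂ] Triple d a b where
  toFun p := (Pi.single i₀ (p.eval (a : ℂ)), ⟨(Ioc a b).indicator fun t : ℝ =>
      (Pi.single i₀ (p.derivative.eval (t : ℂ)) : Fin d → ℂ), isBddMeas_single i₀ _,
      fun _ ht => indicator_of_notMem ht _⟩, 0)
  map_add' p q := by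
    refine Prod.ext ?_ (Prod.ext (Subtype.ext ?_) ?_)
    · simp [Pi.single_add]
    · funext t
      by_cases ht : t ∈ Ioc a b <;> simp [ht, Pi.single_add]
    · simp
  map_smul' c p := by
    refine Prod.ext ?_ (Prod.ext (Subtype.ext ?_) ?_)
    · simp [← Pi.single_smul]
    · funext t
      by_cases ht : t ∈ Ioc a b <;> simp [ht, ← Pi.single_smul]
    · simp

theorem polyTriple_fn (i₀ : Fin d) (p : ℂ[X]) {t : ℝ} (ht : t ∈ Icc a b) :
    (polyTriple a b i₀ p).fn t = Pi.single i₀ (p.eval (t : ℂ)) := by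
  have h1 : ∫ s in a..t, ((polyTriple a b i₀ p).2.1 : ℝ → Fin d → ℂ) s =
      ∫ s in a..t, (Pi.single i₀ (p.derivative.eval (s : ℂ)) : Fin d → ℂ) := by
    refine intervalIntegral.integral_congr_ae (Eventually.of_forall fun s hs => ?_)
    rw [uIoc_of_le ht.1] at hs
    exact indicator_of_mem (show s ∈ Ioc a b from ⟨hs.1, hs.2.trans ht.2⟩)
      (fun t : ℝ => (Pi.single i₀ (p.derivative.eval (t : ℂ)) : Fin d → ℂ))
  have hc : Continuous fun t : ℝ => (Pi.single i₀ (p.derivative.eval (t : ℂ)) : Fin d → ℂ) :=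
    (continuous_single i₀).comp (continuous_eval_ofReal p.derivative)
  have h2 := intervalIntegral.integral_eq_sub_of_hasDerivAt (a := a) (b := t)
    (f := fun t : ℝ => (Pi.single i₀ (p.eval (t : ℂ)) : Fin d → ℂ))
    (fun s _ => by
      rw [hasDerivAt_pi]
      intro i
      rcases eq_or_ne i i₀ with rfl | hi
      · simpa using hasDerivAt_eval_ofReal p s
      · simpa [Pi.single_eq_of_ne hi] using hasDerivAt_const s (0 : ℂ))
    (hc.intervalIntegrable _ _)
  rw [Triple.fn, h1, h2]
  simp [polyTriple]

theorem Triple.fn_eq_zero_of_mass (hab : a < b) {x : Triple d a b} (h : x.mass = 0) :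
    ∀ t ∈ Icc a b, x.fn t = 0 :=
  eqOn_zero_of_ae_eq_zero hab x.continuous_fn (x.isBddMeas_fn.ae_eq_zero hab.le h)

/-- Polynomial multiples of `(X - a)(X - b)` in one coordinate vanish at both ends, so with
parameter `0` they lie in every form domain. The weight is positive on this infinite-dimensional
space, and for large `lam` it dominates the energy on any finite-dimensional part. -/
theorem Model.exists_indexGE (𝔐 : Model d a b) (M : BoundaryMatrix d) (hab : a < b) (hd : 0 < d)
    (n : ℕ) : ∃ lam : ℝ, IndexGE (𝔐.qForm M lam) n := by
  obtain ⟨μ, C, hμ, hC, h⟩ := 𝔐.exists_bounded M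
  let i₀ : Fin d := ⟨0, hd⟩
  let v : ℂ[X] := (X - Polynomial.C (a : ℂ)) * (X - Polynomial.C (b : ℂ))
  have hv : v ≠ 0 := mul_ne_zero (X_sub_C_ne_zero _) (X_sub_C_ne_zero _)
  let L : ℂ[X] →ₗ[ℂ] Triple d a b := polyTriple a b i₀ ∘ₗ LinearMap.mulLeft ℂ v
  have hL : ∀ p, L p ∈ bdDomain a b M := by
    intro p
    have e1 : (L p).fn a = 0 := by
      refine (polyTriple_fn i₀ (v * p) (left_mem_Icc.2 hab.le)).trans ?_
      simp [v]
    have e2 : (L p).fn b = 0 := by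
      refine (polyTriple_fn i₀ (v * p) (right_mem_Icc.2 hab.le)).trans ?_
      simp [v]
    have e3 : (L p).2.2 = 0 := rfl
    rw [mem_bdDomain, e3, Matrix.mulVec_zero]
    funext i
    rcases i with i | i
    · exact (congrArg (fun v : Fin d → ℂ => (-v) i) e1).trans (by simp)
    · exact congrFun e2 i
  let T : ℂ[X] →ₗ[ℂ] bdDomain a b M := L.codRestrict _ hL
  have hpos : ∀ p, p ≠ 0 → 0 < (𝔐.wForm M (T p) (T p)).re := by
    intro p hp
    have h1 : μ * (L p).mass ≤ (𝔐.wForm M (T p) (T p)).re := Model.weightForm_re_ge hab.le h (L p)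
    refine lt_of_lt_of_le (mul_pos hμ ((Triple.mass_nonneg hab.le _).lt_of_ne' fun h0 => ?_)) h1
    have h2 := Triple.fn_eq_zero_of_mass hab h0
    -- Zero mass makes the polynomial `v * p` vanish on all of `[a,b]`, an infinite set of roots.
    refine mul_ne_zero hv hp (eq_zero_of_infinite_isRoot _ ?_)
    refine ((Icc_infinite hab).image Complex.ofReal_injective.injOn).mono ?_
    rintro _ ⟨t, ht, rfl⟩
    have h3 := (polyTriple_fn i₀ (v * p) ht).symm.trans (h2 t ht)
    simpa using congrFun h3 i₀
  have hfd : FiniteDimensional ℂ (degreeLT ℂ n) :=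
    (degreeLTEquiv ℂ n).symm.finiteDimensional
  obtain ⟨κ, hκ⟩ := exists_indexGE_sub_smul (q := 𝔐.qForm M 0) (w := 𝔐.wForm M)
    (T.domRestrict (degreeLT ℂ n)) fun p hp => hpos p fun h0 => hp (Subtype.ext h0)
  rw [(degreeLTEquiv ℂ n).finrank_eq, Module.finrank_fin_fun, ← 𝔐.qForm_add M 0 κ] at hκ
  exact ⟨_, hκ⟩

end Polynomial

/-! ### The first order system -/

section System

open Set ComplexConjugate
open scoped _root_.BoundedContinuousFunction

variable {d : ℕ} {a b : ℝ}

/-- Constant functions. -/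
noncomputable def constMap (κ : Type*) [Fintype κ] : (κ → ℂ) →L[ℂ] (ℝ →ᵇ (κ → ℂ)) :=
  LinearMap.toContinuousLinearMap
    { toFun := fun u => BoundedContinuousFunction.const ℝ u
      map_add' := fun _ _ => rfl
      map_smul' := fun _ _ => rfl }

@[simp]
theorem constMap_apply {κ : Type*} [Fintype κ] (u : κ → ℂ) (t : ℝ) : constMap κ u t = u := rfl

namespace Model

variable (𝔐 : Model d a b)

/-- The coefficient matrix of the first order system for `lam = 0`. -/
def sysMatrix (t : ℝ) : Matrix (Fin d ⊕ Fin d) (Fin d ⊕ Fin d) ℂ :=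
  Matrix.fromBlocks 0 (𝔐.R t) (𝔐.Q t) 0

/-- The derivative of the coefficient matrix of the first order system with respect to `lam`. -/
def weightMatrix (t : ℝ) : Matrix (Fin d ⊕ Fin d) (Fin d ⊕ Fin d) ℂ :=
  Matrix.fromBlocks 0 0 (-𝔐.W t) 0

theorem isCoeff_sysMatrix : IsCoeff a b 𝔐.sysMatrix := by
  obtain ⟨C, hC0, hC⟩ := 𝔐.coeffR.exists_bound
  obtain ⟨C', hC0', hC'⟩ := 𝔐.coeffQ.exists_bound
  refine ⟨?_, ⟨max C C', ?_⟩, fun t ht => ?_⟩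
  · rintro (i | i) (j | j)
    · exact measurable_const
    · exact 𝔐.coeffR.meas i j
    · exact 𝔐.coeffQ.meas i j
    · exact measurable_const
  · rintro t (i | i) (j | j)
    · simp [sysMatrix, hC0]
    · exact (hC t i j).trans (le_max_left _ _)
    · exact (hC' t i j).trans (le_max_right _ _)
    · simp [sysMatrix, hC0]
  · rw [sysMatrix, 𝔐.coeffR.supp t ht, 𝔐.coeffQ.supp t ht, Matrix.fromBlocks_zero]

theorem isCoeff_weightMatrix : IsCoeff a b 𝔐.weightMatrix := by
  obtain ⟨C, hC0, hC⟩ := 𝔐.coeffW.exists_bound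
  refine ⟨?_, ⟨C, ?_⟩, fun t ht => ?_⟩
  · rintro (i | i) (j | j)
    · exact measurable_const
    · exact measurable_const
    · exact (𝔐.coeffW.meas i j).neg
    · exact measurable_const
  · rintro t (i | i) (j | j)
    · simp [weightMatrix, hC0]
    · simp [weightMatrix, hC0]
    · simpa [weightMatrix] using hC t i j
    · simp [weightMatrix, hC0]
  · rw [weightMatrix, 𝔐.coeffW.supp t ht, neg_zero, Matrix.fromBlocks_zero]

/-- The integral operator of the first order system for `lam = 0`. -/
noncomputable def sysOp : (ℝ →ᵇ (Fin d ⊕ Fin d → ℂ)) →L[ℂ] (ℝ →ᵇ (Fin d ⊕ Fin d → ℂ)) :=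
  volterra a b 𝔐.sysMatrix

/-- The integral operator of the weight. -/
noncomputable def weightOp : (ℝ →ᵇ (Fin d ⊕ Fin d → ℂ)) →L[ℂ] (ℝ →ᵇ (Fin d ⊕ Fin d → ℂ)) :=
  volterra a b 𝔐.weightMatrix

/-- `Y = (y, z)` solves `y' = R z`, `z' = Q y - lam W y - W f` where `F = (f, _)`. -/
def Solves (lam : ℂ) (F Y : ℝ →ᵇ (Fin d ⊕ Fin d → ℂ)) : Prop :=
  Y = constMap _ (Y a) + 𝔐.weightOp F + (𝔐.sysOp Y + lam • 𝔐.weightOp Y)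

/-- The solution with a prescribed initial value and right hand side. -/
noncomputable def solve (lam : ℂ) : (ℝ →ᵇ (Fin d ⊕ Fin d → ℂ)) →L[ℂ] (ℝ →ᵇ (Fin d ⊕ Fin d → ℂ)) :=
  solOp 𝔐.sysOp 𝔐.weightOp lam

theorem isUnit_system (hab : a ≤ b) (lam : ℂ) : IsUnit (1 - (𝔐.sysOp + lam • 𝔐.weightOp)) :=
  isUnit_one_sub_volterra_add hab 𝔐.isCoeff_sysMatrix 𝔐.isCoeff_weightMatrix lam

theorem sysOp_left (hab : a ≤ b) (Y : ℝ →ᵇ (Fin d ⊕ Fin d → ℂ)) : 𝔐.sysOp Y a = 0 :=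
  volterra_apply_left hab 𝔐.isCoeff_sysMatrix Y

theorem weightOp_left (hab : a ≤ b) (Y : ℝ →ᵇ (Fin d ⊕ Fin d → ℂ)) : 𝔐.weightOp Y a = 0 :=
  volterra_apply_left hab 𝔐.isCoeff_weightMatrix Y

variable {𝔐}

theorem Solves.of_eq (hab : a ≤ b) {lam : ℂ} {F Y : ℝ →ᵇ (Fin d ⊕ Fin d → ℂ)}
    {u : Fin d ⊕ Fin d → ℂ}
    (h : Y = constMap _ u + 𝔐.weightOp F + (𝔐.sysOp Y + lam • 𝔐.weightOp Y)) :
    Y a = u ∧ 𝔐.Solves lam F Y := by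
  have h1 := congrArg (fun Z : ℝ →ᵇ (Fin d ⊕ Fin d → ℂ) => Z a) h
  simp only [BoundedContinuousFunction.coe_add, BoundedContinuousFunction.coe_smul, Pi.add_apply,
    constMap_apply, sysOp_left _ hab, weightOp_left _ hab, smul_zero, add_zero] at h1
  refine ⟨h1, ?_⟩
  rw [Solves, h1]
  exact h

theorem solve_spec (𝔐 : Model d a b) (hab : a ≤ b) (lam : ℂ) (F : ℝ →ᵇ (Fin d ⊕ Fin d → ℂ))
    (u : Fin d ⊕ Fin d → ℂ) : (𝔐.solve lam (constMap _ u + 𝔐.weightOp F)) a = u ∧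
      𝔐.Solves lam F (𝔐.solve lam (constMap _ u + 𝔐.weightOp F)) :=
  Solves.of_eq hab (solOp_eq (𝔐.isUnit_system hab lam) _)

theorem solve_const_spec (𝔐 : Model d a b) (hab : a ≤ b) (lam : ℂ) (u : Fin d ⊕ Fin d → ℂ) :
    (𝔐.solve lam (constMap _ u)) a = u ∧ 𝔐.Solves lam 0 (𝔐.solve lam (constMap _ u)) := by
  simpa using 𝔐.solve_spec hab lam 0 u

theorem Solves.eq_solve (hab : a ≤ b) {lam : ℂ} {F Y : ℝ →ᵇ (Fin d ⊕ Fin d → ℂ)}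
    (h : 𝔐.Solves lam F Y) : Y = 𝔐.solve lam (constMap _ (Y a) + 𝔐.weightOp F) :=
  eq_solOp (𝔐.isUnit_system hab lam) h

theorem Solves.sub {lam : ℂ} {F G Y Z : ℝ →ᵇ (Fin d ⊕ Fin d → ℂ)}
    (h : 𝔐.Solves lam F Y) (h' : 𝔐.Solves lam G Z) : 𝔐.Solves lam (F - G) (Y - Z) := by
  rw [Solves, BoundedContinuousFunction.coe_sub, Pi.sub_apply]
  simp only [map_sub, smul_sub]
  nth_rewrite 1 [h, h']
  abel

/-- Differentiating the integral equation in `lam` gives the inhomogeneous system whose right hand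
side is the solution itself; the initial value is fixed, so its derivative is zero. -/
theorem solves_deriv (𝔐 : Model d a b) (hab : a ≤ b) (lam : ℂ) (u : Fin d ⊕ Fin d → ℂ) :
    𝔐.Solves lam (𝔐.solve lam (constMap _ u)) (deriv 𝔐.solve lam (constMap _ u)) := by
  refine (Solves.of_eq hab (u := 0) ?_).2
  rw [map_zero, zero_add]
  exact deriv_solOp_eq (fun lam => 𝔐.isUnit_system hab lam) lam _

theorem sysMatrix_mulVec (𝔐 : Model d a b) (t : ℝ) (v : Fin d ⊕ Fin d → ℂ) : 𝔐.sysMatrix t *ᵥ v =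
    Sum.elim (𝔐.R t *ᵥ (v ∘ Sum.inr)) (𝔐.Q t *ᵥ (v ∘ Sum.inl)) := by
  rw [sysMatrix, Matrix.fromBlocks_mulVec]
  simp

theorem weightMatrix_mulVec (𝔐 : Model d a b) (t : ℝ) (v : Fin d ⊕ Fin d → ℂ) :
    𝔐.weightMatrix t *ᵥ v = Sum.elim (0 : Fin d → ℂ) (-(𝔐.W t *ᵥ (v ∘ Sum.inl))) := by
  rw [weightMatrix, Matrix.fromBlocks_mulVec]
  simp [Matrix.neg_mulVec]

theorem isBddMeas_comp {ι κ : Type*} [Fintype ι] [Fintype κ] {f : ℝ → ι → ℂ} (hf : IsBddMeas f)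
    (e : κ → ι) : IsBddMeas fun t => f t ∘ e := by
  obtain ⟨h1, C, hC⟩ := hf
  refine ⟨measurable_pi_lambda _ fun i => (measurable_pi_apply (e i)).comp h1, C, fun t => ?_⟩
  exact (pi_norm_le_iff_of_nonneg ((norm_nonneg _).trans (hC t))).2 fun i =>
    (norm_le_pi_norm (f t) (e i)).trans (hC t)

theorem integral_comp_index {ι κ : Type*} [Fintype ι] [Fintype κ] {f : ℝ → ι → ℂ}
    (hf : IsBddMeas f) (e : κ → ι) (s t : ℝ) :
    (∫ r in s..t, f r) ∘ e = ∫ r in s..t, f r ∘ e := by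
  funext i
  rw [Function.comp_apply, integral_apply hf, integral_apply (isBddMeas_comp hf e)]
  rfl

variable (𝔐) in
/-- The right hand side of the equation for the quasi-derivative. -/
def quasiRhs (lam : ℂ) (F Y : ℝ → Fin d ⊕ Fin d → ℂ) (t : ℝ) : Fin d → ℂ :=
  𝔐.Q t *ᵥ (Y t ∘ Sum.inl) - lam • (𝔐.W t *ᵥ (Y t ∘ Sum.inl)) - 𝔐.W t *ᵥ (F t ∘ Sum.inl)

theorem isBddMeas_quasiRhs (𝔐 : Model d a b) (lam : ℂ) {F Y : ℝ → Fin d ⊕ Fin d → ℂ}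
    (hF : IsBddMeas F) (hY : IsBddMeas Y) : IsBddMeas (𝔐.quasiRhs lam F Y) := by
  have h1 := 𝔐.coeffQ.isBddMeas_mulVec (isBddMeas_comp hY Sum.inl)
  have h2 := 𝔐.coeffW.isBddMeas_mulVec (isBddMeas_comp hY Sum.inl)
  have h3 := 𝔐.coeffW.isBddMeas_mulVec (isBddMeas_comp hF Sum.inl)
  have h4 := (h1.add (h2.const_smul (-lam))).add (h3.const_smul (-1))
  have e : 𝔐.quasiRhs lam F Y = ((fun t => 𝔐.Q t *ᵥ (Y t ∘ Sum.inl)) +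
      (-lam) • (fun t => 𝔐.W t *ᵥ (Y t ∘ Sum.inl))) +
      (-1 : ℂ) • (fun t => 𝔐.W t *ᵥ (F t ∘ Sum.inl)) := by
    funext t
    simp only [quasiRhs, Pi.add_apply, Pi.smul_apply]
    module
  rw [e]
  exact h4

/-- The first order system, written as a pair of integral equations. -/
theorem solves_iff (hab : a ≤ b) {lam : ℂ} {F Y : ℝ →ᵇ (Fin d ⊕ Fin d → ℂ)} :
    𝔐.Solves lam F Y ↔ ∀ t,
      Y t ∘ Sum.inl = Y a ∘ Sum.inl + ∫ s in a..t, 𝔐.R s *ᵥ (Y s ∘ Sum.inr) ∧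
      Y t ∘ Sum.inr = Y a ∘ Sum.inr + ∫ s in a..t, 𝔐.quasiRhs lam F Y s := by
  have hY := BoundedContinuousFunction.isBddMeas Y
  have hF := BoundedContinuousFunction.isBddMeas F
  have h1 := 𝔐.isCoeff_sysMatrix.isBddMeas_mulVec hY
  have h2 := 𝔐.isCoeff_weightMatrix.isBddMeas_mulVec hY
  have h3 := 𝔐.isCoeff_weightMatrix.isBddMeas_mulVec hF
  have h4 := (h3.add (h1.add (h2.const_smul lam)))
  have key : ∀ t, (constMap _ (Y a) + 𝔐.weightOp F + (𝔐.sysOp Y + lam • 𝔐.weightOp Y)) t =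
      Y a + ∫ s in a..t, ((fun t => 𝔐.weightMatrix t *ᵥ F t) + ((fun t => 𝔐.sysMatrix t *ᵥ Y t) +
        lam • fun t => 𝔐.weightMatrix t *ᵥ Y t)) s := by
    intro t
    have e1 : ∫ s in a..t, ((fun t => 𝔐.weightMatrix t *ᵥ F t) + ((fun t => 𝔐.sysMatrix t *ᵥ Y t) +
        lam • fun t => 𝔐.weightMatrix t *ᵥ Y t)) s = (∫ s in a..t, 𝔐.weightMatrix s *ᵥ F s) +
        ((∫ s in a..t, 𝔐.sysMatrix s *ᵥ Y s) + lam • ∫ s in a..t, 𝔐.weightMatrix s *ᵥ Y s) := by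
      rw [← intervalIntegral.integral_smul]
      refine (intervalIntegral.integral_add (h3.intervalIntegrable _ _)
        ((h1.add (h2.const_smul lam)).intervalIntegrable _ _)).trans ?_
      exact congrArg _ (intervalIntegral.integral_add (h1.intervalIntegrable _ _)
        ((h2.const_smul lam).intervalIntegrable _ _))
    rw [e1]
    simp only [BoundedContinuousFunction.coe_add, BoundedContinuousFunction.coe_smul, Pi.add_apply,
      constMap_apply, sysOp, weightOp, volterra_apply hab 𝔐.isCoeff_sysMatrix,
      volterra_apply hab 𝔐.isCoeff_weightMatrix, add_assoc]
  have key2 : 𝔐.Solves lam F Y ↔ ∀ t, Y t =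
      Y a + ∫ s in a..t, ((fun t => 𝔐.weightMatrix t *ᵥ F t) + ((fun t => 𝔐.sysMatrix t *ᵥ Y t) +
        lam • fun t => 𝔐.weightMatrix t *ᵥ Y t)) s := by
    constructor
    · intro h t
      rw [← key]
      exact congrArg (fun Z : ℝ →ᵇ (Fin d ⊕ Fin d → ℂ) => Z t) h
    · intro h
      refine BoundedContinuousFunction.ext fun t => ?_
      rw [key]
      exact h t
  rw [key2]
  refine forall_congr' fun t => ?_
  have e1 : ∀ u v : Fin d ⊕ Fin d → ℂ, u = v ↔ u ∘ Sum.inl = v ∘ Sum.inl ∧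
      u ∘ Sum.inr = v ∘ Sum.inr := by
    intro u v
    refine ⟨fun h => h ▸ ⟨rfl, rfl⟩, fun h => ?_⟩
    funext i
    rcases i with i | i
    · exact congrFun h.1 i
    · exact congrFun h.2 i
  have e2 : ∀ (u v : Fin d ⊕ Fin d → ℂ) (e : Fin d → Fin d ⊕ Fin d), (u + v) ∘ e = u ∘ e + v ∘ e :=
    fun _ _ _ => rfl
  have e3 : ∀ s, ((fun t => 𝔐.weightMatrix t *ᵥ F t) + ((fun t => 𝔐.sysMatrix t *ᵥ Y t) +
        lam • fun t => 𝔐.weightMatrix t *ᵥ Y t)) s ∘ Sum.inl = 𝔐.R s *ᵥ (Y s ∘ Sum.inr) := by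
    intro s
    funext i
    simp [sysMatrix_mulVec, weightMatrix_mulVec]
  have e4 : ∀ s, ((fun t => 𝔐.weightMatrix t *ᵥ F t) + ((fun t => 𝔐.sysMatrix t *ᵥ Y t) +
        lam • fun t => 𝔐.weightMatrix t *ᵥ Y t)) s ∘ Sum.inr = 𝔐.quasiRhs lam F Y s := by
    intro s
    funext i
    simp [sysMatrix_mulVec, weightMatrix_mulVec, quasiRhs]
    ring
  rw [e1 (Y t), e2, e2, integral_comp_index h4, integral_comp_index h4]
  simp only [e3, e4]

end Model
end System

/-! ### Boundary conditions and the characteristic matrix -/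

section BoundaryParameter

variable {d : ℕ}

/-- The parametrization `ξ ↦ (B* ξ, -A* ξ)` of the kernel of `(A | B)`. -/
noncomputable def boundaryParam (M : BoundaryMatrix d) : (Fin d ⊕ Fin d → ℂ) →ₗ[ℂ]
    (Fin d ⊕ Fin d → ℂ) × (Fin d ⊕ Fin d → ℂ) :=
  (M.1.2ᴴ).mulVecLin.prod (-(M.1.1ᴴ).mulVecLin)

/-- The map `(u, v) ↦ A u + B v`. -/
noncomputable def boundaryMap (M : BoundaryMatrix d) :
    (Fin d ⊕ Fin d → ℂ) × (Fin d ⊕ Fin d → ℂ) →ₗ[ℂ] (Fin d ⊕ Fin d → ℂ) :=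
  M.1.1.mulVecLin.coprod M.1.2.mulVecLin

theorem boundaryMap_apply (M : BoundaryMatrix d) (u v : Fin d ⊕ Fin d → ℂ) :
    boundaryMap M (u, v) = M.1.1 *ᵥ u + M.1.2 *ᵥ v := rfl

theorem boundaryMap_surjective (M : BoundaryMatrix d) :
    LinearMap.range (boundaryMap M) = ⊤ := by
  refine Submodule.eq_top_of_finrank_eq ?_
  have h1 : LinearMap.range (boundaryMap M) =
      LinearMap.range (Matrix.fromCols M.1.1 M.1.2).mulVecLin := by
    apply le_antisymm
    · rintro _ ⟨⟨u, v⟩, rfl⟩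
      exact ⟨Sum.elim u v, by rw [Matrix.mulVecLin_apply, Matrix.fromCols_mulVec_sumElim]; rfl⟩
    · rintro _ ⟨w, rfl⟩
      exact ⟨(w ∘ Sum.inl, w ∘ Sum.inr), by rw [Matrix.mulVecLin_apply, Matrix.fromCols_mulVec]; rfl⟩
  have h2 := M.2.1
  rw [Matrix.rank, ← h1] at h2
  rw [h2, Module.finrank_fintype_fun_eq_card, Fintype.card_sum, Fintype.card_fin]
  ring

-- If `A*ξ = B*ξ = 0`, then `ξ` is orthogonal to the range of `(A | B)`, which is everything by the
-- rank condition.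
open scoped ComplexOrder in
theorem boundaryParam_injective (M : BoundaryMatrix d) : Function.Injective (boundaryParam M) := by
  rw [← LinearMap.ker_eq_bot, LinearMap.ker_eq_bot']
  intro ξ hξ
  have h1 : M.1.2ᴴ *ᵥ ξ = 0 := congrArg Prod.fst hξ
  have h2 : M.1.1ᴴ *ᵥ ξ = 0 := by simpa [boundaryParam] using congrArg Prod.snd hξ
  have h3 : ∀ u v, star ξ ⬝ᵥ boundaryMap M (u, v) = 0 := by
    intro u v
    rw [boundaryMap_apply, dotProduct_add, Matrix.dotProduct_mulVec, Matrix.dotProduct_mulVec]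
    have e1 := congrArg star h1
    have e2 := congrArg star h2
    rw [Matrix.star_mulVec, Matrix.conjTranspose_conjTranspose, star_zero] at e1 e2
    rw [e1, e2, zero_dotProduct, zero_dotProduct, add_zero]
  obtain ⟨⟨u, v⟩, huv⟩ : ξ ∈ LinearMap.range (boundaryMap M) := by
    rw [boundaryMap_surjective]
    trivial
  have h4 := h3 u v
  rw [huv] at h4
  exact dotProduct_star_self_eq_zero.1 h4

/-- The relation `AB* = BA*` gives one inclusion, and both spaces have dimension `2d`: the kernel of
`(A | B)` is Lagrangian. -/
theorem range_boundaryParam (M : BoundaryMatrix d) :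
    LinearMap.range (boundaryParam M) = LinearMap.ker (boundaryMap M) := by
  refine Submodule.eq_of_le_of_finrank_eq ?_ ?_
  · rintro _ ⟨ξ, rfl⟩
    rw [LinearMap.mem_ker]
    have e : boundaryParam M ξ = (M.1.2ᴴ *ᵥ ξ, -(M.1.1ᴴ *ᵥ ξ)) := rfl
    rw [e, boundaryMap_apply, Matrix.mulVec_neg, Matrix.mulVec_mulVec, Matrix.mulVec_mulVec, M.2.2,
      add_neg_cancel]
  · rw [LinearMap.finrank_range_of_inj (boundaryParam_injective M)]
    have h := (boundaryMap M).finrank_range_add_finrank_ker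
    rw [boundaryMap_surjective, finrank_top, Module.finrank_prod] at h
    omega

/-- A left inverse of the parametrization of the boundary condition. -/
noncomputable def boundaryCoord (M : BoundaryMatrix d) :
    (Fin d ⊕ Fin d → ℂ) × (Fin d ⊕ Fin d → ℂ) →ₗ[ℂ] (Fin d ⊕ Fin d → ℂ) :=
  ((boundaryParam M).exists_leftInverse_of_injective
    (LinearMap.ker_eq_bot.2 (boundaryParam_injective M))).choose

theorem boundaryCoord_spec {M : BoundaryMatrix d} {u v : Fin d ⊕ Fin d → ℂ}
    (h : M.1.1 *ᵥ u + M.1.2 *ᵥ v = 0) :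
    u = M.1.2ᴴ *ᵥ boundaryCoord M (u, v) ∧ v = -(M.1.1ᴴ *ᵥ boundaryCoord M (u, v)) := by
  obtain ⟨ξ, hξ⟩ : (u, v) ∈ LinearMap.range (boundaryParam M) := by
    rw [range_boundaryParam]
    exact h
  have h1 : boundaryCoord M (boundaryParam M ξ) = ξ :=
    LinearMap.congr_fun ((boundaryParam M).exists_leftInverse_of_injective
      (LinearMap.ker_eq_bot.2 (boundaryParam_injective M))).choose_spec ξ
  rw [← hξ, h1]
  exact ⟨(congrArg Prod.fst hξ).symm, (congrArg Prod.snd hξ).symm⟩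

end BoundaryParameter

/-! ### The characteristic matrix and the weak form of the boundary value problem. -/

section Characteristic

open Set ComplexConjugate
open scoped _root_.BoundedContinuousFunction

variable {d : ℕ} {a b : ℝ}

/-- The boundary values `(-y(a), y(b))` of `Y = (y, z)`. -/
noncomputable def traceFst (a b : ℝ) : (ℝ →ᵇ (Fin d ⊕ Fin d → ℂ)) →L[ℂ] (Fin d ⊕ Fin d → ℂ) :=
  ContinuousLinearMap.pi fun i => Sum.elim
    (fun i => -((ContinuousLinearMap.proj (R := ℂ) (φ := fun _ : Fin d ⊕ Fin d => ℂ)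
      (Sum.inl i)).comp (BoundedContinuousFunction.evalCLM ℂ a)))
    (fun i => (ContinuousLinearMap.proj (R := ℂ) (φ := fun _ : Fin d ⊕ Fin d => ℂ)
      (Sum.inl i)).comp (BoundedContinuousFunction.evalCLM ℂ b)) i

/-- The boundary values `(z(a), z(b))` of `Y = (y, z)`. -/
noncomputable def traceSnd (a b : ℝ) : (ℝ →ᵇ (Fin d ⊕ Fin d → ℂ)) →L[ℂ] (Fin d ⊕ Fin d → ℂ) :=
  ContinuousLinearMap.pi fun i => Sum.elim
    (fun i => (ContinuousLinearMap.proj (R := ℂ) (φ := fun _ : Fin d ⊕ Fin d => ℂ)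
      (Sum.inr i)).comp (BoundedContinuousFunction.evalCLM ℂ a))
    (fun i => (ContinuousLinearMap.proj (R := ℂ) (φ := fun _ : Fin d ⊕ Fin d => ℂ)
      (Sum.inr i)).comp (BoundedContinuousFunction.evalCLM ℂ b)) i

theorem traceFst_apply (Y : ℝ →ᵇ (Fin d ⊕ Fin d → ℂ)) :
    traceFst a b Y = Sum.elim (-(Y a ∘ Sum.inl)) (Y b ∘ Sum.inl) := by
  funext i
  rcases i with i | i <;> simp [traceFst]

theorem traceSnd_apply (Y : ℝ →ᵇ (Fin d ⊕ Fin d → ℂ)) :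
    traceSnd a b Y = Sum.elim (Y a ∘ Sum.inr) (Y b ∘ Sum.inr) := by
  funext i
  rcases i with i | i <;> simp [traceSnd]

/-- The left hand side of the boundary condition. -/
noncomputable def bdryOp (a b : ℝ) (M : BoundaryMatrix d) :
    (ℝ →ᵇ (Fin d ⊕ Fin d → ℂ)) →L[ℂ] (Fin d ⊕ Fin d → ℂ) :=
  (LinearMap.toContinuousLinearMap (boundaryMap M)).comp ((traceFst a b).prod (traceSnd a b))

theorem bdryOp_apply (M : BoundaryMatrix d) (Y : ℝ →ᵇ (Fin d ⊕ Fin d → ℂ)) :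
    bdryOp a b M Y = M.1.1 *ᵥ traceFst a b Y + M.1.2 *ᵥ traceSnd a b Y := rfl

namespace Model

variable (𝔐 : Model d a b) (M : BoundaryMatrix d)

/-- The map that takes the initial value of a solution to the left hand side of the boundary
condition. -/
noncomputable def charMap (lam : ℂ) : (Fin d ⊕ Fin d → ℂ) →ₗ[ℂ] (Fin d ⊕ Fin d → ℂ) :=
  (bdryOp a b M).toLinearMap ∘ₗ (𝔐.solve lam).toLinearMap ∘ₗ (constMap (Fin d ⊕ Fin d)).toLinearMap

/-- The matrix whose determinant is the characteristic function. -/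
noncomputable def charMatrix (lam : ℂ) : Matrix (Fin d ⊕ Fin d) (Fin d ⊕ Fin d) ℂ :=
  LinearMap.toMatrix' (𝔐.charMap M lam)

theorem charMatrix_mulVec (lam : ℂ) (u : Fin d ⊕ Fin d → ℂ) :
    𝔐.charMatrix M lam *ᵥ u = bdryOp a b M (𝔐.solve lam (constMap _ u)) :=
  LinearMap.toMatrix'_mulVec _ _

theorem hasDerivAt_charMatrix_mulVec (hab : a ≤ b) (lam : ℂ) (u : Fin d ⊕ Fin d → ℂ) :
    HasDerivAt (fun z => 𝔐.charMatrix M z *ᵥ u)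
      (bdryOp a b M (deriv 𝔐.solve lam (constMap _ u))) lam := by
  simp only [charMatrix_mulVec]
  have h : HasDerivAt 𝔐.solve (deriv 𝔐.solve lam) lam :=
    (differentiable_solOp (fun lam => 𝔐.isUnit_system hab lam) lam).hasDerivAt
  have h1 := h.clm_apply (hasDerivAt_const lam (constMap _ u))
  have h2 := ((bdryOp a b M).hasFDerivAt (x := 𝔐.solve lam (constMap _ u))).comp_hasDerivAt lam h1
  rw [map_zero, add_zero] at h2
  exact h2

theorem charMatrix_apply (lam : ℂ) (i j : Fin d ⊕ Fin d) :
    𝔐.charMatrix M lam i j = (𝔐.charMatrix M lam *ᵥ Pi.single j 1) i := by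
  rw [Matrix.mulVec_single_one]
  rfl

theorem hasDerivAt_charMatrix (hab : a ≤ b) (lam : ℂ) (i j : Fin d ⊕ Fin d) :
    HasDerivAt (fun z => 𝔐.charMatrix M z i j)
      (bdryOp a b M (deriv 𝔐.solve lam (constMap _ (Pi.single j 1))) i) lam := by
  simp only [charMatrix_apply]
  exact hasDerivAt_pi.1 (𝔐.hasDerivAt_charMatrix_mulVec M hab lam (Pi.single j 1)) i

theorem analyticAt_charMatrix (hab : a ≤ b) (lam : ℂ) (i j : Fin d ⊕ Fin d) :
    AnalyticAt ℂ (fun z => 𝔐.charMatrix M z i j) lam :=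
  Differentiable.analyticAt (fun z => (𝔐.hasDerivAt_charMatrix M hab z i j).differentiableAt) lam

theorem deriv_charMatrix_mulVec (hab : a ≤ b) (lam : ℂ) (u : Fin d ⊕ Fin d → ℂ) :
    (Matrix.of fun i j => deriv (fun z => 𝔐.charMatrix M z i j) lam) *ᵥ u =
      bdryOp a b M (deriv 𝔐.solve lam (constMap _ u)) := by
  refine HasDerivAt.unique (f := fun z => 𝔐.charMatrix M z *ᵥ u) (x := lam) ?_
    (𝔐.hasDerivAt_charMatrix_mulVec M hab lam u)
  rw [hasDerivAt_pi]
  intro i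
  simp only [Matrix.mulVec, dotProduct, Matrix.of_apply]
  exact HasDerivAt.fun_sum fun j _ =>
    ((𝔐.hasDerivAt_charMatrix M hab lam i j).differentiableAt.hasDerivAt).mul_const _

/-- The triple of a function `Y = (y, z)`. -/
noncomputable def tripleOf : (ℝ →ᵇ (Fin d ⊕ Fin d → ℂ)) →ₗ[ℂ] Triple d a b where
  toFun Y := (Y a ∘ Sum.inl, ⟨fun t => 𝔐.R t *ᵥ (Y t ∘ Sum.inr),
      𝔐.coeffR.isBddMeas_mulVec (isBddMeas_comp (BoundedContinuousFunction.isBddMeas Y) Sum.inr),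
      fun t ht => by
        simp only [𝔐.coeffR.supp t ht, Matrix.zero_mulVec]⟩,
    (boundaryCoord M ∘ₗ ((traceFst a b).prod (traceSnd a b)).toLinearMap) Y)
  map_add' Y Z := Prod.ext rfl (Prod.ext (Subtype.ext (funext fun t =>
    Matrix.mulVec_add (𝔐.R t) (Y t ∘ Sum.inr) (Z t ∘ Sum.inr))) (map_add _ Y Z))
  map_smul' c Y := Prod.ext rfl (Prod.ext (Subtype.ext (funext fun t =>
    Matrix.mulVec_smul (𝔐.R t) c (Y t ∘ Sum.inr))) (map_smul _ c Y))

variable {𝔐 M}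

theorem Solves.fn_tripleOf (hab : a ≤ b) {lam : ℂ} {F Y : ℝ →ᵇ (Fin d ⊕ Fin d → ℂ)}
    (h : 𝔐.Solves lam F Y) (t : ℝ) : (𝔐.tripleOf M Y).fn t = Y t ∘ Sum.inl :=
  (((solves_iff hab).1 h t).1).symm

theorem Solves.bdry_tripleOf (hab : a ≤ b) {lam : ℂ} {F Y : ℝ →ᵇ (Fin d ⊕ Fin d → ℂ)}
    (h : 𝔐.Solves lam F Y) : Triple.bdry (𝔐.tripleOf M Y) = traceFst a b Y := by
  rw [traceFst_apply, ← h.fn_tripleOf (M := M) hab, ← h.fn_tripleOf (M := M) hab]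
  rfl

theorem Solves.tripleOf_mem (hab : a ≤ b) {lam : ℂ} {F Y : ℝ →ᵇ (Fin d ⊕ Fin d → ℂ)}
    (h : 𝔐.Solves lam F Y) (hY : bdryOp a b M Y = 0) : 𝔐.tripleOf M Y ∈ bdDomain a b M := by
  rw [mem_bdDomain, h.bdry_tripleOf hab]
  exact (boundaryCoord_spec hY).1

theorem ae_uIoc {p : ℝ → Prop} (hab : a ≤ b) (h : ∀ᵐ t ∂(volume.restrict (Icc a b)), p t) :
    ∀ᵐ t, t ∈ uIoc a b → p t := by
  rw [uIoc_of_le hab, ← ae_restrict_iff' measurableSet_Ioc]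
  exact ae_restrict_of_ae_restrict_of_subset Ioc_subset_Icc_self h

/-- The weak form of the boundary value problem. -/
theorem Solves.weak (hab : a ≤ b) {lam : ℂ} {F Y : ℝ →ᵇ (Fin d ⊕ Fin d → ℂ)}
    (h : 𝔐.Solves lam F Y) (hY : bdryOp a b M Y = 0) (y η : Triple d a b)
    (hF : ∀ t, F t ∘ Sum.inl = y.fn t) (hη : η ∈ bdDomain a b M) :
    𝔐.energyForm M η (𝔐.tripleOf M Y) - lam * 𝔐.weightForm η (𝔐.tripleOf M Y) =
      𝔐.weightForm η y := by
  have hYb := BoundedContinuousFunction.isBddMeas Y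
  have hFb := BoundedContinuousFunction.isBddMeas F
  have hz := isBddMeas_comp hYb (Sum.inr : Fin d → Fin d ⊕ Fin d)
  have hy := isBddMeas_comp hYb (Sum.inl : Fin d → Fin d ⊕ Fin d)
  have hg := isBddMeas_quasiRhs 𝔐 lam hFb hYb
  have key := integral_dotProduct_add hab η.isBddMeas hg η.isBddMeas_fn hz
    (fun t => by rw [η.fn_left]; rfl) (fun t => ((solves_iff hab).1 h t).2)
  have hb : star (η.fn b) ⬝ᵥ (Y b ∘ Sum.inr) - star (η.fn a) ⬝ᵥ (Y a ∘ Sum.inr) =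
      star (Triple.bdry η) ⬝ᵥ traceSnd a b Y := by
    rw [traceSnd_apply]
    have e : star (Triple.bdry η) = Sum.elim (-star (η.fn a)) (star (η.fn b)) := by
      funext i
      rcases i with i | i <;> simp [Triple.bdry]
    rw [e, sumElim_dotProduct_sumElim, neg_dotProduct]
    ring
  -- The boundary term is `(B*ξ_η)* (-A*ξ) = -ξ_η* BA* ξ`, where `ξ_η` and `ξ` are the parameters of
  -- `η` and of the solution. This is why the boundary form of the problem is `BA*`.
  rw [hb, mem_bdDomain.1 hη, (boundaryCoord_spec (u := traceFst a b Y)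
    (v := traceSnd a b Y) hY).2, Matrix.star_mulVec,
    Matrix.conjTranspose_conjTranspose, dotProduct_neg, ← Matrix.dotProduct_mulVec,
    Matrix.mulVec_mulVec] at key
  have hP : intForm a b 𝔐.P 𝔐.coeffP (Triple.der η) (Triple.der (𝔐.tripleOf M Y)) =
      ∫ t in a..b, star ((η.2.1 : ℝ → Fin d → ℂ) t) ⬝ᵥ (Y t ∘ Sum.inr) := by
    rw [intForm_apply]
    refine intervalIntegral.integral_congr_ae ?_
    filter_upwards [ae_uIoc hab 𝔐.mul_R] with t ht htm
    change star ((η.2.1 : ℝ → Fin d → ℂ) t) ⬝ᵥ (𝔐.P t *ᵥ (𝔐.R t *ᵥ (Y t ∘ Sum.inr))) = _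
    rw [Matrix.mulVec_mulVec, ht htm, Matrix.one_mulVec]
  have hval : ∀ t, ((Triple.val (𝔐.tripleOf M Y) : bddVec d) : ℝ → Fin d → ℂ) t = Y t ∘ Sum.inl :=
    fun t => h.fn_tripleOf hab t
  have hQ : intForm a b 𝔐.Q 𝔐.coeffQ (Triple.val η) (Triple.val (𝔐.tripleOf M Y)) =
      ∫ t in a..b, matForm (𝔐.Q t) (η.fn t) (Y t ∘ Sum.inl) := by
    rw [intForm_apply]
    simp only [hval]
    rfl
  have hW : 𝔐.weightForm η (𝔐.tripleOf M Y) =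
      ∫ t in a..b, matForm (𝔐.W t) (η.fn t) (Y t ∘ Sum.inl) := by
    rw [weightForm_apply, intForm_apply]
    simp only [hval]
    rfl
  have hW' : 𝔐.weightForm η y = ∫ t in a..b, matForm (𝔐.W t) (η.fn t) (F t ∘ Sum.inl) := by
    simp only [hF]
    rfl
  have i1 : IntervalIntegrable (fun t => star ((η.2.1 : ℝ → Fin d → ℂ) t) ⬝ᵥ (Y t ∘ Sum.inr))
      volume a b := by
    obtain ⟨C₁, h1⟩ := η.isBddMeas.2
    obtain ⟨C₂, h2⟩ := hz.2
    have e : ∀ t, star ((η.2.1 : ℝ → Fin d → ℂ) t) ⬝ᵥ (Y t ∘ Sum.inr) =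
        matForm (1 : Matrix (Fin d) (Fin d) ℂ) ((η.2.1 : ℝ → Fin d → ℂ) t) (Y t ∘ Sum.inr) :=
      fun t => by rw [matForm_apply, Matrix.one_mulVec]
    simp only [e]
    refine intervalIntegrable_of_bounded_complex (measurable_matForm
      (N := fun _ => 1) (fun _ _ => measurable_const) η.isBddMeas.1 hz.1)
      (C := Fintype.card (Fin d) ^ 2 * 1 * (C₁ * C₂)) (fun t => ?_) a b
    refine (norm_matForm_le zero_le_one (fun i j => ?_) _ _).trans (mul_le_mul_of_nonneg_left
      (mul_le_mul (h1 t) (h2 t) (norm_nonneg _) ((norm_nonneg _).trans (h1 t))) (by positivity))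
    rw [Matrix.one_apply]
    split_ifs <;> simp
  have i2 := 𝔐.coeffQ.intervalIntegrable_matForm η.isBddMeas_fn hy a b
  have i3 := 𝔐.coeffW.intervalIntegrable_matForm η.isBddMeas_fn hy a b
  have i4 := 𝔐.coeffW.intervalIntegrable_matForm η.isBddMeas_fn
    (isBddMeas_comp hFb (Sum.inl : Fin d → Fin d ⊕ Fin d)) a b
  have hsplit : ∫ t in a..b, (star ((η.2.1 : ℝ → Fin d → ℂ) t) ⬝ᵥ (Y t ∘ Sum.inr) +
      star (η.fn t) ⬝ᵥ 𝔐.quasiRhs lam F Y t) =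
      (∫ t in a..b, star ((η.2.1 : ℝ → Fin d → ℂ) t) ⬝ᵥ (Y t ∘ Sum.inr)) +
      ((∫ t in a..b, matForm (𝔐.Q t) (η.fn t) (Y t ∘ Sum.inl)) -
        lam * (∫ t in a..b, matForm (𝔐.W t) (η.fn t) (Y t ∘ Sum.inl)) -
        ∫ t in a..b, matForm (𝔐.W t) (η.fn t) (F t ∘ Sum.inl)) := by
    rw [← intervalIntegral.integral_const_mul, ← intervalIntegral.integral_sub i2 (i3.const_mul lam),
      ← intervalIntegral.integral_sub (i2.sub (i3.const_mul lam)) i4,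
      ← intervalIntegral.integral_add i1 ((i2.sub (i3.const_mul lam)).sub i4)]
    simp only [quasiRhs, dotProduct_sub, dotProduct_smul, matForm_apply, smul_eq_mul]
  rw [hsplit] at key
  have hξ : (𝔐.tripleOf M Y).2.2 = boundaryCoord M (traceFst a b Y, traceSnd a b Y) := rfl
  rw [energyForm_apply, hP, hQ, hW, hW', matForm_apply, hξ]
  linear_combination key

/-- A solution of the boundary value problem without mass vanishes. -/
theorem Solves.eq_zero_of_mass (hab : a < b) {lam : ℂ} {Y : ℝ →ᵇ (Fin d ⊕ Fin d → ℂ)}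
    (h : 𝔐.Solves lam 0 Y) (hY : bdryOp a b M Y = 0)
    (hw : (𝔐.weightForm (𝔐.tripleOf M Y) (𝔐.tripleOf M Y)).re = 0) : Y a = 0 := by
  obtain ⟨μ, C, hμ, hC, hM⟩ := 𝔐.exists_bounded M
  obtain ⟨K, hK0, hK⟩ := exists_coercive hab d hμ hC
  set x := 𝔐.tripleOf M Y with hx
  have h1 := weightForm_re_ge hab.le hM x
  have hm : x.mass = 0 := by
    have := x.mass_nonneg hab.le
    nlinarith
  have hmem : x ∈ bdDomain a b M := h.tripleOf_mem hab.le hY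
  have h2 := hK 𝔐 M hM x hmem
  have h3 := norm_weightForm_le hab.le hC hM x
  rw [hm, mul_zero, norm_le_zero_iff] at h3
  -- Testing the homogeneous equation with the solution itself: without mass the energy form
  -- vanishes, and coercivity forces the energy to vanish too. Then `R z = 0`, hence `z = 0`.
  have h4 := h.weak hab.le hY 0 x (fun t => by simp [Triple.fn]) hmem
  rw [map_zero, ← hx, h3, mul_zero, sub_zero] at h4
  rw [h4, hm] at h2
  have he : x.energy = 0 := by
    have := x.energy_nonneg hab.le
    simp at h2
    nlinarith
  have h5 := x.isBddMeas.ae_eq_zero hab.le he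
  have h6 : ∀ t ∈ Icc a b, Y t ∘ (Sum.inr : Fin d → Fin d ⊕ Fin d) = 0 := by
    refine eqOn_zero_of_ae_eq_zero hab ?_ ?_
    · exact (continuous_pi fun i => continuous_apply _).comp Y.continuous
    · filter_upwards [h5, 𝔐.mul_R] with t h7 h8
      have h9 : 𝔐.R t *ᵥ (Y t ∘ Sum.inr) = 0 := h7
      have h10 := congrArg (fun v => 𝔐.P t *ᵥ v) h9
      simpa [Matrix.mulVec_mulVec, h8] using h10
  have h7 := Triple.fn_eq_zero_of_mass hab hm a (left_mem_Icc.2 hab.le)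
  rw [hx, h.fn_tripleOf hab.le] at h7
  have h8 := h6 a (left_mem_Icc.2 hab.le)
  funext i
  rcases i with i | i
  · exact congrFun h7 i
  · exact congrFun h8 i

end Model
end Characteristic

/-! ### The index jumps at the eigenvalues -/

section Jump

open Set ComplexConjugate
open scoped _root_.BoundedContinuousFunction

variable {d : ℕ} {a b : ℝ}

namespace Model

variable (𝔐 : Model d a b) (M : BoundaryMatrix d)

/-- The triple of the solution with initial value `u`. -/
noncomputable def solTriple (lam : ℂ) : (Fin d ⊕ Fin d → ℂ) →ₗ[ℂ] Triple d a b :=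
  𝔐.tripleOf M ∘ₗ (𝔐.solve lam).toLinearMap ∘ₗ (constMap (Fin d ⊕ Fin d)).toLinearMap

variable {𝔐 M}

theorem solTriple_mem (hab : a ≤ b) {lam : ℂ} {u : Fin d ⊕ Fin d → ℂ}
    (hu : 𝔐.charMatrix M lam *ᵥ u = 0) : 𝔐.solTriple M lam u ∈ bdDomain a b M :=
  (𝔐.solve_const_spec hab lam u).2.tripleOf_mem hab (by rwa [← charMatrix_mulVec])

theorem solTriple_weak (hab : a ≤ b) {lam : ℂ} {u : Fin d ⊕ Fin d → ℂ}
    (hu : 𝔐.charMatrix M lam *ᵥ u = 0) {η : Triple d a b} (hη : η ∈ bdDomain a b M) :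
    𝔐.energyForm M η (𝔐.solTriple M lam u) - lam * 𝔐.weightForm η (𝔐.solTriple M lam u) = 0 :=
  ((𝔐.solve_const_spec hab lam u).2.weak hab (by rwa [← charMatrix_mulVec]) 0 η
    (fun t => by simp [Triple.fn]) hη).trans (map_zero _)

theorem solTriple_pos (hab : a < b) {lam : ℂ} {u : Fin d ⊕ Fin d → ℂ}
    (hu : 𝔐.charMatrix M lam *ᵥ u = 0) (hu0 : u ≠ 0) :
    0 < (𝔐.weightForm (𝔐.solTriple M lam u) (𝔐.solTriple M lam u)).re := by
  refine lt_of_le_of_ne (𝔐.wForm_nonneg M hab.le ⟨_, solTriple_mem hab.le hu⟩) fun h => hu0 ?_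
  obtain ⟨h1, h2⟩ := 𝔐.solve_const_spec hab.le lam u
  rw [← h1]
  exact h2.eq_zero_of_mass hab (by rwa [← charMatrix_mulVec]) h.symm

theorem IsHermForm.im_eq_zero {D : Type*} [AddCommGroup D] [Module ℂ D] {q : SesqForm D}
    (h : IsHermForm q) (x : D) : (q x x).im = 0 := by
  have := congrArg Complex.im (h x x)
  rw [Complex.conj_im] at this
  linarith

/-- Eigenvalues are real. -/
theorem im_eq_zero_of_charMatrix (hab : a < b) {lam : ℂ} {u : Fin d ⊕ Fin d → ℂ}
    (hu : 𝔐.charMatrix M lam *ᵥ u = 0) (hu0 : u ≠ 0) : lam.im = 0 := by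
  have h1 := solTriple_weak hab.le hu (solTriple_mem hab.le hu)
  have h2 := congrArg Complex.im h1
  rw [Complex.sub_im, Complex.mul_im, IsHermForm.im_eq_zero (𝔐.isHermForm_energyForm M),
    IsHermForm.im_eq_zero 𝔐.isHermForm_weightForm, mul_zero, zero_add, zero_sub, Complex.zero_im,
    neg_eq_zero] at h2
  exact (mul_eq_zero.1 h2).resolve_right (solTriple_pos hab hu hu0).ne'

/-- There are no Jordan chains. Under the hypothesis, the `lam`-derivative of the solution `Y`
starting at `u`, minus the solution starting at `v`, satisfies the boundary condition and solves the
problem with right hand side `Y`. Testing with `Y`, and using that `Y` is itself a null vector and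
`lam` is real, the Hermitian symmetry makes the weight of `Y` zero. -/
theorem charMatrix_ker_deriv (hab : a < b) {lam : ℝ} {u v : Fin d ⊕ Fin d → ℂ}
    (hu : 𝔐.charMatrix M lam *ᵥ u = 0)
    (hv : bdryOp a b M (deriv 𝔐.solve lam (constMap _ u)) = 𝔐.charMatrix M lam *ᵥ v) : u = 0 := by
  by_contra hu0
  obtain ⟨-, h1⟩ := 𝔐.solve_const_spec hab.le lam v
  have h2 := (𝔐.solves_deriv hab.le lam u).sub h1
  rw [sub_zero] at h2
  have h3 : bdryOp a b M (deriv 𝔐.solve lam (constMap _ u) - 𝔐.solve lam (constMap _ v)) = 0 := by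
    rw [map_sub, hv, charMatrix_mulVec, sub_self]
  have hmem := solTriple_mem hab.le hu
  have h4 := h2.weak hab.le h3 (𝔐.solTriple M lam u) (𝔐.solTriple M lam u)
    (fun t => ((𝔐.solve_const_spec hab.le lam u).2.fn_tripleOf hab.le t).symm) hmem
  have h5 := congrArg conj (solTriple_weak hab.le hu (h2.tripleOf_mem hab.le h3))
  rw [map_sub, map_mul, Complex.conj_ofReal, 𝔐.isHermForm_energyForm M, 𝔐.isHermForm_weightForm,
    map_zero, h4] at h5
  have h6 := solTriple_pos hab hu hu0
  rw [h5] at h6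
  exact lt_irrefl _ h6

/-- The order of the characteristic determinant at a real point is the nullity. -/
theorem analyticOrderAt_det_charMatrix (hab : a < b) (lam : ℝ) :
    analyticOrderAt (fun z => (𝔐.charMatrix M z).det) (lam : ℂ) =
      Module.finrank ℂ (LinearMap.ker (𝔐.charMatrix M lam).mulVecLin) := by
  refine analyticOrderAt_det (𝔐.analyticAt_charMatrix M hab.le lam) fun u hu => ?_
  rintro ⟨v, hv⟩
  rw [𝔐.deriv_charMatrix_mulVec M hab.le] at hv
  exact charMatrix_ker_deriv hab hu hv

/-- The solutions of the boundary value problem are null vectors of the form at `lam` with positive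
weight. They enlarge a negative subspace as soon as the parameter is increased at all. -/
theorem le_index_add (hab : a < b) {lam : ℝ} {N : ℕ} (hN : IndexGE (𝔐.qForm M lam) N) {ε : ℝ}
    (hε : 0 < ε) : IndexGE (𝔐.qForm M (lam + ε))
      (N + Module.finrank ℂ (LinearMap.ker (𝔐.charMatrix M lam).mulVecLin)) := by
  rw [qForm_add]
  refine IndexGE.sub_smul (𝔐.isHermForm_qForm M lam) (𝔐.wForm_nonneg M hab.le) hN
    (((𝔐.solTriple M lam).domRestrict (LinearMap.ker (𝔐.charMatrix M lam).mulVecLin)).codRestrict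
      (bdDomain a b M) fun u => solTriple_mem hab.le u.2) (fun u η => ?_) (fun u hu => ?_) hε
  · exact solTriple_weak hab.le u.2 η.2
  · exact solTriple_pos hab u.2 fun h => hu (Subtype.ext h)

variable (𝔐) in
/-- The function of a triple, as the first component of a bounded continuous function. -/
noncomputable def liftFn (a b : ℝ) : Triple d a b →ₗ[ℂ] (ℝ →ᵇ (Fin d ⊕ Fin d → ℂ)) where
  toFun x := BoundedContinuousFunction.ofNormedAddCommGroup (fun t => Sum.elim (x.fn t) 0)
    (continuous_pi fun i => by
      rcases i with i | i
      · exact (continuous_apply i).comp x.continuous_fn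
      · exact continuous_const) x.isBddMeas_fn.2.choose (fun t => by
      have h := x.isBddMeas_fn.2.choose_spec t
      refine (pi_norm_le_iff_of_nonneg ((norm_nonneg _).trans h)).2 fun i => ?_
      rcases i with i | i
      · exact (norm_le_pi_norm (x.fn t) i).trans h
      · simpa using (norm_nonneg _).trans h)
  map_add' x y := BoundedContinuousFunction.ext fun t => by
    funext i
    rcases i with i | i
    · exact congrFun (x.fn_add y t) i
    · exact (add_zero (0 : ℂ)).symm
  map_smul' c x := BoundedContinuousFunction.ext fun t => by
    funext i
    rcases i with i | i
    · exact congrFun (x.fn_smul c t) i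
    · exact (smul_zero c).symm

theorem liftFn_apply (x : Triple d a b) (t : ℝ) : liftFn a b x t ∘ Sum.inl = x.fn t := rfl

/-- The right hand side enters a solution only through the primitive of `W y`, which Cauchy-Schwarz
bounds in the supremum norm by the mass of `y`. So bounds for operators on continuous functions
yield the bound in the weight norm that the index estimate requires. -/
theorem exists_norm_weightOp_le (hab : a ≤ b) (𝔐 : Model d a b) : ∃ C : ℝ, 0 ≤ C ∧
    ∀ y : Triple d a b, ‖𝔐.weightOp (liftFn a b y)‖ ^ 2 ≤ C * y.mass := by
  obtain ⟨C, hC0, hC⟩ := 𝔐.isCoeff_weightMatrix.exists_bound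
  have hba := sub_nonneg.2 hab
  refine ⟨(b - a) * (Fintype.card (Fin d ⊕ Fin d) * C) ^ 2, by positivity, fun y => ?_⟩
  have hy0 := y.mass_nonneg hab
  have hb := BoundedContinuousFunction.isBddMeas (liftFn a b y)
  have hWb := 𝔐.isCoeff_weightMatrix.isBddMeas_mulVec hb
  have hn : ∀ t, ‖liftFn a b y t‖ = ‖y.fn t‖ := by
    intro t
    refine le_antisymm ((pi_norm_le_iff_of_nonneg (norm_nonneg _)).2 fun i => ?_)
      ((pi_norm_le_iff_of_nonneg (norm_nonneg _)).2 fun i => norm_le_pi_norm (liftFn a b y t) (Sum.inl i))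
    rcases i with i | i
    · exact norm_le_pi_norm (y.fn t) i
    · exact (norm_zero (E := ℂ)).trans_le (norm_nonneg _)
  have h1 : sqInt a b (fun t => 𝔐.weightMatrix t *ᵥ liftFn a b y t) ≤
      (Fintype.card (Fin d ⊕ Fin d) * C) ^ 2 * y.mass := by
    rw [sqInt, Triple.mass, sqInt, ← intervalIntegral.integral_const_mul]
    refine intervalIntegral.integral_mono_on hab (hWb.intervalIntegrable_sq _ _)
      ((y.isBddMeas_fn.intervalIntegrable_sq _ _).const_mul _) fun t _ => ?_
    have h2 := norm_mulVec_le (fun i j => hC t i j) hC0 (liftFn a b y t)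
    rw [hn] at h2
    calc _ ≤ _ := pow_le_pow_left₀ (norm_nonneg _) h2 2
      _ = _ := mul_pow _ _ _
  have h2 : ‖𝔐.weightOp (liftFn a b y)‖ ≤
      Real.sqrt ((b - a) * (Fintype.card (Fin d ⊕ Fin d) * C) ^ 2 * y.mass) := by
    refine (BoundedContinuousFunction.norm_le (Real.sqrt_nonneg _)).2 fun t => Real.le_sqrt_of_sq_le ?_
    rw [weightOp, volterra_apply hab 𝔐.isCoeff_weightMatrix, integral_eq_clamp hab hWb
      (fun t ht => by simp [𝔐.isCoeff_weightMatrix.supp t ht])]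
    have hm : max a (min b t) ∈ Icc a b := ⟨le_max_left _ _, max_le hab (min_le_left _ _)⟩
    refine (norm_integral_sq_le hWb (left_mem_Icc.2 hab) hm).trans ?_
    rw [mul_assoc]
    refine mul_le_mul ?_ h1 (sqInt_nonneg hab _) hba
    rw [abs_of_nonneg (sub_nonneg.2 hm.1)]
    linarith [hm.2]
  calc _ ≤ _ := pow_le_pow_left₀ (norm_nonneg _) h2 2
    _ = _ := Real.sq_sqrt (by positivity)

/-- The boundary value problem with right hand side is boundedly solvable on a space of codimension
equal to the nullity. -/
theorem exists_green (hab : a < b) (lam : ℝ) : ∃ C : ℝ, 0 ≤ C ∧ ∀ y : Triple d a b,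
    bdryOp a b M (𝔐.solve lam (𝔐.weightOp (liftFn a b y))) ∈
      LinearMap.range (𝔐.charMatrix M lam).mulVecLin →
    ∃ x ∈ bdDomain a b M, (∀ η ∈ bdDomain a b M,
      𝔐.energyForm M η x - lam * 𝔐.weightForm η x = 𝔐.weightForm η y) ∧
      (𝔐.weightForm x x).re ≤ C ^ 2 * (𝔐.weightForm y y).re := by
  obtain ⟨μ, B, hμ, hB, hM⟩ := 𝔐.exists_bounded M
  obtain ⟨C₁, hC₁, h1⟩ := 𝔐.exists_norm_weightOp_le hab.le
  let T := (𝔐.charMatrix M lam).mulVecLin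
  obtain ⟨S, hS⟩ := T.rangeRestrict.exists_rightInverse_of_surjective T.range_rangeRestrict
  obtain ⟨S', hS'⟩ := S.exists_extend
  have hSS : ∀ r ∈ LinearMap.range T, T (S' r) = r := by
    intro r hr
    have e1 : S' r = S ⟨r, hr⟩ := LinearMap.congr_fun hS' ⟨r, hr⟩
    rw [e1]
    exact congrArg Subtype.val (LinearMap.congr_fun hS ⟨r, hr⟩)
  -- A bounded Green operator: from the solution with zero initial value it subtracts the
  -- homogeneous solution that cancels its boundary defect. The initial value of the correction
  -- depends linearly on the defect through the fixed right inverse `S'`.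
  let G : (ℝ →ᵇ (Fin d ⊕ Fin d → ℂ)) →L[ℂ] (ℝ →ᵇ (Fin d ⊕ Fin d → ℂ)) := 𝔐.solve lam -
    (((𝔐.solve lam).comp (constMap _)).comp (LinearMap.toContinuousLinearMap S')).comp
      ((bdryOp a b M).comp (𝔐.solve lam))
  have hba : 0 ≤ b - a := sub_nonneg.2 hab.le
  obtain ⟨D, hD⟩ : ∃ D, D = d ^ 2 * B * ((b - a) * ‖G‖ ^ 2 * C₁) / μ := ⟨_, rfl⟩
  have hD0 : 0 ≤ D := by
    rw [hD]
    positivity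
  refine ⟨Real.sqrt D, Real.sqrt_nonneg _, fun y hy => ?_⟩
  set Z := 𝔐.weightOp (liftFn a b y) with hZ
  set r := bdryOp a b M (𝔐.solve lam Z) with hr
  have hG : G Z = 𝔐.solve lam Z - 𝔐.solve lam (constMap _ (S' r)) := rfl
  obtain ⟨-, s1⟩ := 𝔐.solve_spec hab.le lam (liftFn a b y) 0
  rw [map_zero, zero_add, ← hZ] at s1
  have s2 := s1.sub (𝔐.solve_const_spec hab.le lam (S' r)).2
  rw [sub_zero, ← hG] at s2
  have s3 : bdryOp a b M (G Z) = 0 := by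
    rw [hG, map_sub, ← hr, ← charMatrix_mulVec, sub_eq_zero]
    exact (hSS r hy).symm
  refine ⟨𝔐.tripleOf M (G Z), s2.tripleOf_mem hab.le s3,
    fun η hη => s2.weak hab.le s3 y η (fun t => liftFn_apply y t) hη, ?_⟩
  have h2 : (𝔐.tripleOf M (G Z)).mass ≤ (b - a) * ‖G Z‖ ^ 2 := by
    have h3 : ∀ t ∈ Icc a b, ‖(𝔐.tripleOf M (G Z)).fn t‖ ^ 2 ≤ ‖G Z‖ ^ 2 := by
      intro t _
      rw [s2.fn_tripleOf hab.le]
      refine pow_le_pow_left₀ (norm_nonneg _) ?_ 2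
      refine (pi_norm_le_iff_of_nonneg (norm_nonneg _)).2 fun i => ?_
      exact (norm_le_pi_norm (G Z t) (Sum.inl i)).trans ((G Z).norm_coe_le_norm t)
    have := intervalIntegral.integral_mono_on hab.le
      ((𝔐.tripleOf M (G Z)).isBddMeas_fn.intervalIntegrable_sq a b) intervalIntegrable_const h3
    rwa [intervalIntegral.integral_const, smul_eq_mul] at this
  have h3 := (Complex.re_le_norm _).trans (norm_weightForm_le hab.le hB hM (𝔐.tripleOf M (G Z)))
  have h4 := weightForm_re_ge hab.le hM y
  have h5 : ‖G Z‖ ^ 2 ≤ ‖G‖ ^ 2 * (C₁ * y.mass) := by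
    calc _ ≤ (‖G‖ * ‖Z‖) ^ 2 := pow_le_pow_left₀ (norm_nonneg _) (G.le_opNorm Z) 2
      _ = ‖G‖ ^ 2 * ‖Z‖ ^ 2 := mul_pow _ _ _
      _ ≤ _ := mul_le_mul_of_nonneg_left (h1 y) (by positivity)
  rw [Real.sq_sqrt hD0]
  calc _ ≤ d ^ 2 * B * ((b - a) * (‖G‖ ^ 2 * (C₁ * y.mass))) := h3.trans
        (mul_le_mul_of_nonneg_left (h2.trans (mul_le_mul_of_nonneg_left h5 hba)) (by positivity))
    _ = D * (μ * y.mass) := by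
        rw [hD]
        field_simp
    _ ≤ _ := mul_le_mul_of_nonneg_left h4 hD0

/-- The obstruction to solving the inhomogeneous problem lies in the cokernel of the characteristic
matrix, whose dimension is the nullity because the matrix is square. -/
theorem exists_index_add_le (hab : a < b) {lam : ℝ} {N : ℕ} (hN : IndexGE (𝔐.qForm M lam) N)
    (hN' : ¬ IndexGE (𝔐.qForm M lam) (N + 1)) : ∃ ε : ℝ, 0 < ε ∧
      ¬ IndexGE (𝔐.qForm M (lam + ε))
        (N + Module.finrank ℂ (LinearMap.ker (𝔐.charMatrix M lam).mulVecLin) + 1) := by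
  obtain ⟨C, hC, hG⟩ := exists_green (𝔐 := 𝔐) (M := M) hab lam
  let τ : Triple d a b →ₗ[ℂ] (Fin d ⊕ Fin d → ℂ) ⧸ LinearMap.range (𝔐.charMatrix M lam).mulVecLin :=
    (LinearMap.range (𝔐.charMatrix M lam).mulVecLin).mkQ ∘ₗ (bdryOp a b M).toLinearMap ∘ₗ
      (𝔐.solve lam).toLinearMap ∘ₗ 𝔐.weightOp.toLinearMap ∘ₗ liftFn a b
  obtain ⟨ε, hε, h⟩ := exists_index_sub_smul_le (𝔐.isHermForm_qForm M lam) (𝔐.isHermForm_wForm M)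
    (𝔐.wForm_nonneg M hab.le) hN hN' (τ ∘ₗ (bdDomain a b M).subtype) hC (fun y hy => by
      obtain ⟨x, hx, h1, h2⟩ := hG y ((Submodule.Quotient.mk_eq_zero _).1 hy)
      exact ⟨⟨x, hx⟩, fun η => h1 η η.2, h2⟩)
  refine ⟨ε, hε, fun h1 => ?_⟩
  rw [qForm_add] at h1
  have h2 := h _ h1
  have h3 := (LinearMap.range (𝔐.charMatrix M lam).mulVecLin).finrank_quotient_add_finrank
  have h4 := (𝔐.charMatrix M lam).mulVecLin.finrank_range_add_finrank_ker
  omega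

end Model
end Jump

/-! ### The sequence of jumps of the index -/

section Sequence

open Set

variable {d : ℕ} {a b : ℝ}

namespace Model

variable (𝔐 : Model d a b) (M : BoundaryMatrix d)

/-- The infimum of the numbers `lam` at which the index exceeds `n`. -/
noncomputable def jump (n : ℕ) : ℝ := sInf {lam : ℝ | IndexGE (𝔐.qForm M lam) (n + 1)}

variable {𝔐 M}

theorem indexGE_of_le (hab : a ≤ b) {lam lam' : ℝ} {n : ℕ} (h : IndexGE (𝔐.qForm M lam) n)
    (hle : lam ≤ lam') : IndexGE (𝔐.qForm M lam') n :=
  h.mono_form (𝔐.qForm_anti M hab hle)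

/-- The set of parameters with index above `n` is an up-set, bounded below and nonempty. It is an
open half-line because the index is left-continuous, whence the strict inequality. -/
theorem indexGE_iff (hab : a < b) (hd : 0 < d) {lam : ℝ} {n : ℕ} :
    IndexGE (𝔐.qForm M lam) (n + 1) ↔ 𝔐.jump M n < lam := by
  obtain ⟨l₀, h0⟩ := 𝔐.exists_not_indexGE_one M hab
  have hbdd : BddBelow {lam : ℝ | IndexGE (𝔐.qForm M lam) (n + 1)} := by
    refine ⟨l₀, fun l hl => ?_⟩
    by_contra! hlt
    exact h0 (indexGE_of_le hab.le (IndexGE.of_le hl (by omega)) hlt.le)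
  constructor
  · intro h
    obtain ⟨ε, hε, h1⟩ := h.exists_add_smul (w := 𝔐.wForm M)
    have e : 𝔐.qForm M lam + (ε : ℂ) • 𝔐.wForm M = 𝔐.qForm M (lam + -ε) := by
      refine LinearMap.ext₂ fun x y => ?_
      simp only [LinearMap.add_apply, LinearMap.smul_apply, qForm_apply, wForm_apply, smul_eq_mul]
      push_cast
      ring
    rw [e] at h1
    exact (csInf_le hbdd h1).trans_lt (by linarith)
  · intro h
    obtain ⟨l, hl, hlt⟩ := exists_lt_of_csInf_lt (𝔐.exists_indexGE M hab hd (n + 1)) h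
    exact indexGE_of_le hab.le hl hlt.le

theorem monotone_jump (hab : a < b) (hd : 0 < d) : Monotone (𝔐.jump M) := by
  intro m n hmn
  refine le_of_forall_gt fun l hl => ?_
  rw [← indexGE_iff hab hd] at hl ⊢
  exact hl.of_le (by omega)

theorem tendsto_jump (hab : a < b) (hd : 0 < d) : Tendsto (𝔐.jump M) atTop atTop := by
  refine tendsto_atTop_atTop_of_monotone (monotone_jump hab hd) fun l => ?_
  obtain ⟨n, hn⟩ := 𝔐.exists_not_indexGE M hab l
  refine ⟨n, ?_⟩
  by_contra! h
  exact hn (((indexGE_iff hab hd).2 h).of_le (by omega))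

theorem exists_index (hab : a < b) (lam : ℝ) :
    ∃ N, IndexGE (𝔐.qForm M lam) N ∧ ¬ IndexGE (𝔐.qForm M lam) (N + 1) := by
  classical
  have h := 𝔐.exists_not_indexGE M hab lam
  have h0 : Nat.find h ≠ 0 := fun h1 => by
    have := Nat.find_spec h
    rw [h1] at this
    exact this (indexGE_zero _)
  obtain ⟨N, hN⟩ := Nat.exists_eq_succ_of_ne_zero h0
  refine ⟨N, ?_, ?_⟩
  · exact not_not.1 (Nat.find_min h (m := N) (by omega))
  · have := Nat.find_spec h
    rwa [hN] at this

/-- If `N` is the index at `lam` and `k` the nullity, then exactly the first `N` jumps lie below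
`lam` and, since the index just above `lam` is `N + k`, exactly the first `N + k` lie at or below
it. -/
theorem encard_jump_eq (hab : a < b) (hd : 0 < d) (lam : ℝ) :
    {n | 𝔐.jump M n = lam}.encard =
      Module.finrank ℂ (LinearMap.ker (𝔐.charMatrix M lam).mulVecLin) := by
  obtain ⟨N, h1, h2⟩ := exists_index (𝔐 := 𝔐) (M := M) hab lam
  set k := Module.finrank ℂ (LinearMap.ker (𝔐.charMatrix M lam).mulVecLin) with hk
  have h3 : ∀ n, 𝔐.jump M n < lam ↔ n < N := by
    intro n
    rw [← indexGE_iff hab hd]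
    refine ⟨fun h => ?_, fun h => h1.of_le h⟩
    by_contra! hn
    exact h2 (h.of_le (by omega))
  have h4 : ∀ n, 𝔐.jump M n ≤ lam ↔ n < N + k := by
    intro n
    refine ⟨fun h => ?_, fun h => le_of_forall_pos_lt_add fun ε hε => ?_⟩
    · by_contra! hn
      obtain ⟨ε, hε, h5⟩ := exists_index_add_le hab h1 h2
      refine h5 (IndexGE.of_le ((indexGE_iff hab hd (n := n)).2 (by linarith)) (by omega))
    · rw [← indexGE_iff hab hd]
      exact (le_index_add hab h1 hε).of_le (by omega)
  have h5 : {n | 𝔐.jump M n = lam} = (Finset.Ico N (N + k) : Set ℕ) := by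
    ext n
    have := h3 n
    have := h4 n
    simp only [mem_ofPred_eq, Finset.coe_Ico, mem_Ico]
    rw [← not_lt, ← h3, ← h4, and_comm, le_antisymm_iff, not_lt]
  rw [h5, Set.encard_coe_eq_coe_finsetCard]
  simp

end Model
end Sequence

/-! ### Representatives of the coefficients -/

section Representative

open Set

variable {d : ℕ} {a b : ℝ}

theorem Coeff.ae_norm_le (P : Coeff d a b) :
    ∀ᵐ t ∂(volume.restrict (Icc a b)), ‖P t‖ ≤ ‖P‖ := by
  have h1 : eLpNorm P ∞ (volume.restrict (Icc a b)) ≠ ∞ := Lp.eLpNorm_ne_top P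
  filter_upwards [ae_le_eLpNormEssSup (f := P) (μ := volume.restrict (Icc a b))] with t ht
  rw [Lp.norm_def, ← toReal_enorm]
  exact ENNReal.toReal_mono h1 (by rwa [eLpNorm_exponent_top])

theorem Coeff.norm_cmat_le (P : Coeff d a b) (t : ℝ) (i j : Fin d) : ‖P.cmat t i j‖ ≤ ‖P t‖ := by
  have : P.cmat t i j = ((P t i j : ℝ) : ℂ) := rfl
  rw [this, Complex.norm_real]
  exact (norm_le_pi_norm (P t i) j).trans (norm_le_pi_norm (P t) i)

theorem Coeff.ae_norm_sub_le (P P' : Coeff d a b) :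
    ∀ᵐ t ∂(volume.restrict (Icc a b)), ∀ i j, ‖(P'.cmat t - P.cmat t) i j‖ ≤ ‖P' - P‖ := by
  filter_upwards [(P' - P).ae_norm_le, Lp.coeFn_sub P' P] with t h1 h2 i j
  refine le_trans ?_ h1
  refine le_trans (le_of_eq ?_) ((P' - P).norm_cmat_le t i j)
  have e : (P' - P) t i j = P' t i j - P t i j := congrFun (congrFun h2 i) j
  have e2 : (P' - P).cmat t i j = (((P' - P) t i j : ℝ) : ℂ) := rfl
  rw [e2, e, Complex.ofReal_sub]
  rfl

theorem ae_mem_Ioc (a b : ℝ) : ∀ᵐ t ∂(volume.restrict (Icc a b)), t ∈ Ioc a b := by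
  rw [← restrict_Ioc_eq_restrict_Icc]
  exact ae_restrict_mem measurableSet_Ioc

theorem measurableSet_forall_forall {κ : Type*} [Countable κ] {p : κ → κ → ℝ → Prop}
    (h : ∀ i j, MeasurableSet {t | p i j t}) : MeasurableSet {t | ∀ i j, p i j t} := by
  have e : {t | ∀ i j, p i j t} = ⋂ i, ⋂ j, {t | p i j t} := by
    ext t
    simp
  rw [e]
  exact MeasurableSet.iInter fun i => MeasurableSet.iInter fun j => h i j

open Classical in
/-- An everywhere bounded and Hermitian representative. -/
noncomputable def Coeff.rep (P : Coeff d a b) (t : ℝ) : Matrix (Fin d) (Fin d) ℂ :=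
  if t ∈ Ioc a b ∧ ‖P t‖ ≤ ‖P‖ ∧ ∀ i j, P t i j = P t j i then P.cmat t else 0

theorem Coeff.measurable_apply (P : Coeff d a b) (i j : Fin d) : Measurable fun t => P t i j :=
  (measurable_pi_apply j).comp ((measurable_pi_apply i).comp (Lp.stronglyMeasurable P).measurable)

theorem Coeff.isCoeff_rep (P : Coeff d a b) : IsCoeff a b P.rep := by
  refine ⟨fun i j => ?_, ⟨‖P‖, fun t i j => ?_⟩, fun t ht => if_neg fun h => ht h.1⟩
  · have hS : MeasurableSet {t : ℝ | t ∈ Ioc a b ∧ ‖P t‖ ≤ ‖P‖ ∧ ∀ i j, P t i j = P t j i} := by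
      refine measurableSet_Ioc.inter (MeasurableSet.inter ?_ ?_)
      · exact measurableSet_le (Lp.stronglyMeasurable P).measurable.norm measurable_const
      · exact measurableSet_forall_forall fun i j =>
          measurableSet_eq_fun (P.measurable_apply i j) (P.measurable_apply j i)
    have e : (fun t => P.rep t i j) =
        {t : ℝ | t ∈ Ioc a b ∧ ‖P t‖ ≤ ‖P‖ ∧ ∀ i j, P t i j = P t j i}.indicator
          fun t => ((P t i j : ℝ) : ℂ) := by
      funext t
      by_cases h : t ∈ Ioc a b ∧ ‖P t‖ ≤ ‖P‖ ∧ ∀ i j, P t i j = P t j i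
      · refine Eq.trans ?_ (indicator_of_mem (s := {t : ℝ | t ∈ Ioc a b ∧ ‖P t‖ ≤ ‖P‖ ∧
          ∀ i j, P t i j = P t j i}) h _).symm
        simp only [Coeff.rep, if_pos h]
        rfl
      · refine Eq.trans ?_ (indicator_of_notMem (s := {t : ℝ | t ∈ Ioc a b ∧ ‖P t‖ ≤ ‖P‖ ∧
          ∀ i j, P t i j = P t j i}) h _).symm
        simp only [Coeff.rep, if_neg h]
        rfl
    rw [e]
    exact (Complex.measurable_ofReal.comp (P.measurable_apply i j)).indicator hS
  · rw [Coeff.rep]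
    split_ifs with h
    · exact (P.norm_cmat_le t i j).trans h.2.1
    · simp

theorem Coeff.isHermitian_rep (P : Coeff d a b) (t : ℝ) : (P.rep t).IsHermitian := by
  rw [Coeff.rep]
  split_ifs with h
  · ext i j
    change star ((P t j i : ℝ) : ℂ) = ((P t i j : ℝ) : ℂ)
    rw [h.2.2 i j]
    exact Complex.conj_ofReal _
  · exact Matrix.isHermitian_zero

theorem Coeff.rep_ae_eq {P : Coeff d a b} (h : P.Symmetric) :
    ∀ᵐ t ∂(volume.restrict (Icc a b)), P.rep t = P.cmat t := by
  filter_upwards [P.ae_norm_le, h, ae_mem_Ioc a b] with t h3 h4 h5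
  exact if_pos ⟨h5, h3, fun i j => h4.apply j i⟩

theorem pi_norm_sq_le {κ : Type*} [Fintype κ] (v : κ → ℂ) : ‖v‖ ^ 2 ≤ ∑ i, ‖v i‖ ^ 2 := by
  have h : ‖v‖ ≤ Real.sqrt (∑ i, ‖v i‖ ^ 2) :=
    (pi_norm_le_iff_of_nonneg (Real.sqrt_nonneg _)).2 fun i => Real.le_sqrt_of_sq_le
      (Finset.single_le_sum (f := fun i => ‖v i‖ ^ 2) (fun _ _ => by positivity) (Finset.mem_univ i))
  calc _ ≤ _ := pow_le_pow_left₀ (norm_nonneg _) h 2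
    _ = _ := Real.sq_sqrt (Finset.sum_nonneg fun _ _ => by positivity)

/-- Positivity of a real symmetric matrix passes to its complexification. -/
theorem le_matForm_of_posSemidef {N : Matrix (Fin d) (Fin d) ℝ} {μ : ℝ} (hμ : 0 ≤ μ)
    (h : (N - μ • (1 : Matrix (Fin d) (Fin d) ℝ)).PosSemidef) (v : Fin d → ℂ) :
    μ * ‖v‖ ^ 2 ≤ (matForm (N.map Complex.ofReal) v v).re := by
  have h1 : ∀ x : Fin d → ℝ, μ * ∑ i, x i ^ 2 ≤ ∑ i, ∑ j, x i * (N i j * x j) := by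
    intro x
    have h2 := h.dotProduct_mulVec_nonneg x
    rw [Matrix.sub_mulVec, Matrix.smul_mulVec, Matrix.one_mulVec, dotProduct_sub,
      dotProduct_smul] at h2
    simp only [dotProduct, Matrix.mulVec, Pi.star_apply, star_trivial, smul_eq_mul,
      Finset.mul_sum] at h2
    simp only [pow_two, Finset.mul_sum]
    linarith
  -- For a real matrix the real part of the form splits into its values at the real and at the
  -- imaginary part of `v`. The lower bound is in the Euclidean norm, which dominates the supremum
  -- norm.
  have h2 : (matForm (N.map Complex.ofReal) v v).re =
      ∑ i, ∑ j, (v i).re * (N i j * (v j).re) + ∑ i, ∑ j, (v i).im * (N i j * (v j).im) := by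
    simp only [matForm_apply, dotProduct, Matrix.mulVec, Finset.mul_sum, Complex.re_sum,
      ← Finset.sum_add_distrib]
    refine Finset.sum_congr rfl fun i _ => Finset.sum_congr rfl fun j _ => ?_
    simp [Complex.mul_re, Complex.mul_im]
  have h3 := h1 fun i => (v i).re
  have h4 := h1 fun i => (v i).im
  have h5 : ∑ i, ‖v i‖ ^ 2 = ∑ i, (v i).re ^ 2 + ∑ i, (v i).im ^ 2 := by
    rw [← Finset.sum_add_distrib]
    refine Finset.sum_congr rfl fun i _ => ?_
    rw [← Complex.normSq_eq_norm_sq, Complex.normSq_apply]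
    ring
  have h6 := mul_le_mul_of_nonneg_left ((pi_norm_sq_le v).trans_eq h5) hμ
  rw [h2]
  linarith

theorem Coeff.le_matForm_rep {P : Coeff d a b} (hs : P.Symmetric) {μ : ℝ} (hμ : 0 ≤ μ)
    (h : ∀ᵐ t ∂(volume.restrict (Icc a b)),
      (P.mat t - μ • (1 : Matrix (Fin d) (Fin d) ℝ)).PosSemidef) :
    ∀ᵐ t ∂(volume.restrict (Icc a b)), ∀ v, μ * ‖v‖ ^ 2 ≤ (matForm (P.rep t) v v).re := by
  filter_upwards [h, Coeff.rep_ae_eq hs] with t h1 h2 v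
  rw [h2]
  exact le_matForm_of_posSemidef hμ h1 v

theorem measurable_det {N : ℝ → Matrix (Fin d) (Fin d) ℂ} (hN : ∀ i j, Measurable fun t => N t i j) :
    Measurable fun t => (N t).det := by
  simp only [Matrix.det_apply']
  exact Finset.measurable_sum _ fun σ _ => measurable_const.mul
    (Finset.measurable_prod _ fun i _ => hN (σ i) i)

/-- Cramer's rule: the entries of the inverse are quotients of determinants, with the value zero
where the determinant vanishes. -/
theorem measurable_inv_apply {N : ℝ → Matrix (Fin d) (Fin d) ℂ}
    (hN : ∀ i j, Measurable fun t => N t i j) (i j : Fin d) : Measurable fun t => (N t)⁻¹ i j := by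
  simp only [Matrix.inv_def, Matrix.smul_apply, Matrix.adjugate_apply, Ring.inverse_eq_inv',
    smul_eq_mul]
  refine (measurable_det hN).inv.mul (measurable_det fun k l => ?_)
  by_cases hk : k = j
  · simp only [hk, Matrix.updateRow_self]
    exact measurable_const
  · simp only [Matrix.updateRow_ne hk]
    exact hN k l

/-- Coercivity together with `|v* N v| ≤ d ‖v‖ ‖N v‖`; the factor `d` is due to the supremum norm.
This provides both the invertibility of `P` and the bound `d / μ` for its inverse. -/
theorem norm_le_of_pos {N : Matrix (Fin d) (Fin d) ℂ} {μ : ℝ} (hμ : 0 < μ)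
    (h : ∀ v, μ * ‖v‖ ^ 2 ≤ (matForm N v v).re) (v : Fin d → ℂ) : ‖v‖ ≤ d / μ * ‖N *ᵥ v‖ := by
  have h1 : (matForm N v v).re ≤ d * (‖v‖ * ‖N *ᵥ v‖) := by
    refine (Complex.re_le_norm _).trans ?_
    rw [matForm_apply]
    refine (norm_sum_le _ _).trans ?_
    refine (Finset.sum_le_card_nsmul _ _ (‖v‖ * ‖N *ᵥ v‖) fun i _ => ?_).trans_eq (by simp)
    rw [norm_mul, Pi.star_apply, norm_star]
    exact mul_le_mul (norm_le_pi_norm _ _) (norm_le_pi_norm _ _) (norm_nonneg _) (norm_nonneg _)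
  rcases (norm_nonneg v).eq_or_lt with h0 | h0
  · rw [← h0]
    positivity
  · have h2 := (h v).trans h1
    have h3 : ‖v‖ * (μ * ‖v‖) ≤ ‖v‖ * (d * ‖N *ᵥ v‖) := by nlinarith
    have h4 := le_of_mul_le_mul_left h3 h0
    rw [div_mul_eq_mul_div, le_div_iff₀ hμ]
    linarith

theorem isUnit_det_of_pos {N : Matrix (Fin d) (Fin d) ℂ} {μ : ℝ} (hμ : 0 < μ)
    (h : ∀ v, μ * ‖v‖ ^ 2 ≤ (matForm N v v).re) : IsUnit N.det := by
  rw [isUnit_iff_ne_zero]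
  intro h0
  obtain ⟨v, hv, hv0⟩ := Matrix.exists_mulVec_eq_zero_iff.2 h0
  have := norm_le_of_pos hμ h v
  rw [hv0, norm_zero, mul_zero] at this
  exact hv (norm_le_zero_iff.1 this)

/-- A bounded representative of the inverse of a uniformly positive matrix function. -/
theorem exists_isCoeff_inv {N : ℝ → Matrix (Fin d) (Fin d) ℂ} (hN : IsCoeff a b N)
    (h : ∃ μ : ℝ, 0 < μ ∧
      ∀ᵐ t ∂(volume.restrict (Icc a b)), ∀ v, μ * ‖v‖ ^ 2 ≤ (matForm (N t) v v).re) :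
    ∃ R, IsCoeff a b R ∧ (∀ᵐ t ∂(volume.restrict (Icc a b)), N t * R t = 1) ∧
      ∀ᵐ t ∂(volume.restrict (Icc a b)), R t * N t = 1 := by
  classical
  obtain ⟨μ, hμ, h⟩ := h
  have hm := measurable_inv_apply hN.meas
  let S : Set ℝ := {t | t ∈ Ioc a b ∧ ∀ i j, ‖(N t)⁻¹ i j‖ ≤ d / μ}
  have hS : MeasurableSet S := by
    exact measurableSet_Ioc.inter <| measurableSet_forall_forall fun i j =>
      measurableSet_le (hm i j).norm measurable_const
  let R : ℝ → Matrix (Fin d) (Fin d) ℂ := fun t => if t ∈ S then (N t)⁻¹ else 0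
  have hR : ∀ᵐ t ∂(volume.restrict (Icc a b)), R t = (N t)⁻¹ := by
    filter_upwards [h, ae_mem_Ioc a b] with t h1 h2
    refine if_pos ⟨h2, fun i j => ?_⟩
    have h3 := norm_le_of_pos hμ h1 ((N t)⁻¹ *ᵥ Pi.single j 1)
    rw [Matrix.mulVec_mulVec, Matrix.mul_nonsing_inv _ (isUnit_det_of_pos hμ h1),
      Matrix.one_mulVec, Pi.norm_single, norm_one, mul_one, Matrix.mulVec_single_one] at h3
    exact (norm_le_pi_norm ((N t)⁻¹.col j) i).trans h3
  refine ⟨R, ⟨fun i j => ?_, ⟨d / μ, fun t i j => ?_⟩, fun t ht => if_neg fun h => ht h.1⟩, ?_, ?_⟩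
  · have e : (fun t => R t i j) = S.indicator fun t => (N t)⁻¹ i j := by
      funext t
      by_cases ht : t ∈ S <;> simp [R, ht]
    rw [e]
    exact (hm i j).indicator hS
  · by_cases ht : t ∈ S
    · simpa [R, ht] using ht.2 i j
    · simp only [R, ht, if_false, Matrix.zero_apply, norm_zero]
      positivity
  · filter_upwards [hR, h] with t h1 h2
    rw [h1, Matrix.mul_nonsing_inv _ (isUnit_det_of_pos hμ h2)]
  · filter_upwards [hR, h] with t h1 h2
    rw [h1, Matrix.nonsing_inv_mul _ (isUnit_det_of_pos hμ h2)]

namespace Equation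

variable (ω : Equation d a b)

theorem symmP : ω.P.Symmetric := ω.2.1.1
theorem symmQ : ω.Q.Symmetric := ω.2.1.2.1
theorem symmW : ω.W.Symmetric := ω.2.1.2.2

theorem posP_rep : ∃ μ : ℝ, 0 < μ ∧ ∀ᵐ t ∂(volume.restrict (Icc a b)),
    ∀ v, μ * ‖v‖ ^ 2 ≤ (matForm (ω.P.rep t) v v).re := by
  obtain ⟨μ, hμ, h⟩ := ω.2.2.1
  exact ⟨μ, hμ, Coeff.le_matForm_rep ω.symmP hμ.le h⟩

theorem posW_rep : ∃ μ : ℝ, 0 < μ ∧ ∀ᵐ t ∂(volume.restrict (Icc a b)),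
    ∀ v, μ * ‖v‖ ^ 2 ≤ (matForm (ω.W.rep t) v v).re := by
  obtain ⟨μ, hμ, h⟩ := ω.2.2.2
  exact ⟨μ, hμ, Coeff.le_matForm_rep ω.symmW hμ.le h⟩

/-- The everywhere defined coefficients of an equation. -/
noncomputable def model : Model d a b where
  P := ω.P.rep
  Q := ω.Q.rep
  W := ω.W.rep
  R := (exists_isCoeff_inv ω.P.isCoeff_rep ω.posP_rep).choose
  coeffP := ω.P.isCoeff_rep
  coeffQ := ω.Q.isCoeff_rep
  coeffW := ω.W.isCoeff_rep
  coeffR := (exists_isCoeff_inv ω.P.isCoeff_rep ω.posP_rep).choose_spec.1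
  hermP := ω.P.isHermitian_rep
  hermQ := ω.Q.isHermitian_rep
  hermW := ω.W.isHermitian_rep
  posP := ω.posP_rep
  posW := ω.posW_rep
  mul_R := (exists_isCoeff_inv ω.P.isCoeff_rep ω.posP_rep).choose_spec.2.1
  R_mul := (exists_isCoeff_inv ω.P.isCoeff_rep ω.posP_rep).choose_spec.2.2

theorem model_P_ae : ∀ᵐ t ∂(volume.restrict (Icc a b)), ω.model.P t = ω.P.cmat t :=
  Coeff.rep_ae_eq ω.symmP

theorem model_Q_ae : ∀ᵐ t ∂(volume.restrict (Icc a b)), ω.model.Q t = ω.Q.cmat t :=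
  Coeff.rep_ae_eq ω.symmQ

theorem model_W_ae : ∀ᵐ t ∂(volume.restrict (Icc a b)), ω.model.W t = ω.W.cmat t :=
  Coeff.rep_ae_eq ω.symmW

end Equation
end Representative

/-! ### Solutions, eigenvalues and the eigenvalue sequence -/

section Solutions

open Set
open scoped _root_.BoundedContinuousFunction

variable {d : ℕ} {a b : ℝ}

theorem ae_hasDerivAt_of_absolutelyContinuous {F : ℝ → Fin d → ℂ} (hab : a ≤ b)
    (hF : AbsolutelyContinuousOnInterval F a b) :
    ∀ᵐ t, t ∈ Icc a b → HasDerivAt F (deriv F t) t := by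
  have h := hF.boundedVariationOn.ae_differentiableAt_of_mem_uIcc
  rw [uIcc_of_le hab] at h
  exact h.mono fun t ht hm => (ht hm).hasDerivAt

namespace Equation

variable (ω : Equation d a b)

/-- The equation forces the derivatives of `y` and `z` to agree almost everywhere with bounded
functions, so both are given by the integral equations on `[a,b]`. Clamping the argument extends
them as constants to the line; the extension still satisfies the integral equations because the
coefficients vanish outside `(a,b]`. -/
theorem IsSolution.exists_solves (hab : a ≤ b) {ω : Equation d a b} {lam : ℂ}
    {y z : ℝ → Fin d → ℂ} (h : ω.IsSolution lam y z) :
    ∃ Y : ℝ →ᵇ (Fin d ⊕ Fin d → ℂ), ω.model.Solves lam 0 Y ∧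
      ∀ t ∈ Icc a b, Y t = Sum.elim (y t) (z t) := by
  let c : ℝ → ℝ := fun t => max a (min b t)
  have hcm : ∀ t, c t ∈ Icc a b := fun t => ⟨le_max_left _ _, max_le hab (min_le_left _ _)⟩
  have hcc : ∀ t ∈ Icc a b, c t = t := fun t ht => by
    simp only [c, min_eq_right ht.2, max_eq_right ht.1]
  have hcont : Continuous c := continuous_const.max (continuous_const.min continuous_id)
  have hy : Continuous fun t => y (c t) := by
    have := h.ac_fun.continuousOn
    rw [uIcc_of_le hab] at this
    exact this.comp_continuous hcont hcm
  have hz : Continuous fun t => z (c t) := by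
    have := h.ac_quasi.continuousOn
    rw [uIcc_of_le hab] at this
    exact this.comp_continuous hcont hcm
  obtain ⟨Cy, hCy⟩ := h.ac_fun.exists_bound
  obtain ⟨Cz, hCz⟩ := h.ac_quasi.exists_bound
  rw [uIcc_of_le hab] at hCy hCz
  let Y : ℝ →ᵇ (Fin d ⊕ Fin d → ℂ) := BoundedContinuousFunction.ofNormedAddCommGroup
    (fun t => Sum.elim (y (c t)) (z (c t)))
    (continuous_pi fun i => by
      rcases i with i | i
      · exact (continuous_apply i).comp hy
      · exact (continuous_apply i).comp hz) (max Cy Cz) (fun t => by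
      have hy0 := hCy _ (hcm t)
      have hz0 := hCz _ (hcm t)
      refine (pi_norm_le_iff_of_nonneg (le_max_of_le_left ((norm_nonneg _).trans hy0))).2 fun i => ?_
      rcases i with i | i
      · exact ((norm_le_pi_norm (y (c t)) i).trans hy0).trans (le_max_left _ _)
      · exact ((norm_le_pi_norm (z (c t)) i).trans hz0).trans (le_max_right _ _))
  have hYl : ∀ t, Y t ∘ Sum.inl = y (c t) := fun t => rfl
  have hYr : ∀ t, Y t ∘ Sum.inr = z (c t) := fun t => rfl
  have hYb := BoundedContinuousFunction.isBddMeas Y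
  have hRb := ω.model.coeffR.isBddMeas_mulVec (Model.isBddMeas_comp hYb (Sum.inr : Fin d → Fin d ⊕ Fin d))
  have hQb := ω.model.isBddMeas_quasiRhs lam
    (BoundedContinuousFunction.isBddMeas (0 : ℝ →ᵇ (Fin d ⊕ Fin d → ℂ))) hYb
  have hae : ∀ {p : ℝ → Prop}, (∀ᵐ t ∂(volume.restrict (Icc a b)), p t) → ∀ᵐ t, t ∈ Icc a b → p t :=
    fun h => (ae_restrict_iff' measurableSet_Icc).1 h
  have h1 := eq_add_integral_of_absolutelyContinuous hab h.ac_fun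
    (fun s t => hRb.intervalIntegrable s t) hRb.2.choose_spec (by
      filter_upwards [ae_hasDerivAt_of_absolutelyContinuous hab h.ac_fun, hae h.quasi_eq,
        hae ω.model_P_ae, hae ω.model.R_mul] with t h2 h3 h4 h5 ht
      have h6 := h2 ht
      have h7 : ω.model.R t *ᵥ (Y t ∘ Sum.inr) = deriv y t := by
        rw [hYr, hcc t ht, h3 ht, ← h4 ht, Matrix.mulVec_mulVec, h5 ht, Matrix.one_mulVec]
      rwa [h7])
  have h2 := eq_add_integral_of_absolutelyContinuous hab h.ac_quasi
    (fun s t => hQb.intervalIntegrable s t) hQb.2.choose_spec (by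
      filter_upwards [ae_hasDerivAt_of_absolutelyContinuous hab h.ac_quasi, hae h.eqn,
        hae ω.model_Q_ae, hae ω.model_W_ae] with t h2 h3 h4 h5 ht
      have h6 := h2 ht
      have h7 : ω.model.quasiRhs lam (0 : ℝ →ᵇ (Fin d ⊕ Fin d → ℂ)) Y t = deriv z t := by
        have e : ((0 : ℝ →ᵇ (Fin d ⊕ Fin d → ℂ)) t ∘ Sum.inl : Fin d → ℂ) = 0 := rfl
        rw [Model.quasiRhs, hYl, hcc t ht, e, Matrix.mulVec_zero, sub_zero, h4 ht, h5 ht, ← h3 ht]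
        abel
      rwa [h7])
  refine ⟨Y, (Model.solves_iff hab).2 fun t => ?_, fun t ht => ?_⟩
  · rw [hYl, hYr, hYl, hYr, hcc a (left_mem_Icc.2 hab), integral_eq_clamp hab hRb
      (fun t ht => by simp [ω.model.coeffR.supp t ht]), integral_eq_clamp hab hQb
      (fun t ht => by simp [Model.quasiRhs, ω.model.coeffQ.supp t ht, ω.model.coeffW.supp t ht])]
    exact ⟨h1 _ (hcm t), h2 _ (hcm t)⟩
  · change Sum.elim (y (c t)) (z (c t)) = _
    rw [hcc t ht]

theorem isSolution_of_solves (hab : a ≤ b) {ω : Equation d a b} {lam : ℂ}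
    {Y : ℝ →ᵇ (Fin d ⊕ Fin d → ℂ)} (h : ω.model.Solves lam 0 Y) :
    ω.IsSolution lam (fun t => Y t ∘ Sum.inl) (fun t => Y t ∘ Sum.inr) := by
  have hYb := BoundedContinuousFunction.isBddMeas Y
  have hRb := ω.model.coeffR.isBddMeas_mulVec (Model.isBddMeas_comp hYb (Sum.inr : Fin d → Fin d ⊕ Fin d))
  have hQb := ω.model.isBddMeas_quasiRhs lam
    (BoundedContinuousFunction.isBddMeas (0 : ℝ →ᵇ (Fin d ⊕ Fin d → ℂ))) hYb
  have h1 : (fun t => Y t ∘ Sum.inl) = fun t => Y a ∘ Sum.inl + _ :=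
    funext fun t => ((Model.solves_iff hab).1 h t).1
  have h2 : (fun t => Y t ∘ Sum.inr) = fun t => Y a ∘ Sum.inr + _ :=
    funext fun t => ((Model.solves_iff hab).1 h t).2
  have hc : ∀ v : Fin d → ℂ, AbsolutelyContinuousOnInterval (fun _ => v) a b := fun v =>
    (LipschitzWith.const v).lipschitzOnWith.absolutelyContinuousOnInterval
  refine ⟨?_, ?_, ?_, ?_⟩
  · rw [h1]
    exact (hc _).fun_add (absolutelyContinuous_primitive
      (fun s t => hRb.intervalIntegrable s t) hRb.2.choose_spec)
  · rw [h2]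
    exact (hc _).fun_add (absolutelyContinuous_primitive
      (fun s t => hQb.intervalIntegrable s t) hQb.2.choose_spec)
  · filter_upwards [ae_restrict_of_ae (ae_hasDerivAt_primitive (a := a)
      (fun s t => hRb.intervalIntegrable s t)), ω.model.mul_R, ω.model_P_ae] with t h3 h4 h5
    have h6 : deriv (fun t => Y t ∘ Sum.inl) t = ω.model.R t *ᵥ (Y t ∘ Sum.inr) := by
      rw [h1]
      exact (h3.const_add _).deriv
    rw [h6, ← h5, Matrix.mulVec_mulVec, h4, Matrix.one_mulVec]
  · filter_upwards [ae_restrict_of_ae (ae_hasDerivAt_primitive (a := a)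
      (fun s t => hQb.intervalIntegrable s t)), ω.model_Q_ae, ω.model_W_ae] with t h3 h4 h5
    have h6 : deriv (fun t => Y t ∘ Sum.inr) t =
        ω.model.quasiRhs lam (0 : ℝ →ᵇ (Fin d ⊕ Fin d → ℂ)) Y t := by
      rw [h2]
      exact (h3.const_add _).deriv
    have e : ((0 : ℝ →ᵇ (Fin d ⊕ Fin d → ℂ)) t ∘ Sum.inl : Fin d → ℂ) = 0 := rfl
    rw [h6, Model.quasiRhs, e, Matrix.mulVec_zero, sub_zero, h4, h5]
    abel

end Equation
end Solutions

/-! ### Identification of eigenvalues, multiplicities and the eigenvalue sequence. -/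

section Eigenvalues

open Set
open scoped _root_.BoundedContinuousFunction

variable {d : ℕ} {a b : ℝ}

namespace Equation

theorem exists_isFundamentalSystem (hab : a ≤ b) (ω : Equation d a b) (lam : ℂ) :
    ∃ q : (Fin d ⊕ Fin d → ℝ → Fin d → ℂ) × (Fin d ⊕ Fin d → ℝ → Fin d → ℂ),
      ω.IsFundamentalSystem lam q.1 q.2 := by
  refine ⟨(fun j t => ω.model.solve lam (constMap _ (Pi.single j 1)) t ∘ Sum.inl,
    fun j t => ω.model.solve lam (constMap _ (Pi.single j 1)) t ∘ Sum.inr), fun j => ?_, ?_⟩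
  · exact isSolution_of_solves hab (ω.model.solve_const_spec hab lam _).2
  · ext i j
    have h := (ω.model.solve_const_spec hab lam (Pi.single j 1)).1
    have e : (Pi.single j 1 : Fin d ⊕ Fin d → ℂ) i = (1 : Matrix _ _ ℂ) i j := by
      rw [Matrix.one_apply, Pi.single_apply]
    rw [← e, ← h]
    rcases i with i | i <;> rfl

/-- The fundamental system is an arbitrary choice; uniqueness for the integral equation identifies
it, on `[a,b]`, with the solution operator applied to unit vectors. -/
theorem exists_solve_eq_fundamentalSystem (hab : a ≤ b) (ω : Equation d a b) (lam : ℂ)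
    (j : Fin d ⊕ Fin d) : ∀ t ∈ Icc a b, ω.model.solve lam (constMap _ (Pi.single j 1)) t =
      Sum.elim ((ω.fundamentalSystem lam).1 j t) ((ω.fundamentalSystem lam).2 j t) := by
  have h : ω.IsFundamentalSystem lam (ω.fundamentalSystem lam).1 (ω.fundamentalSystem lam).2 :=
    Classical.epsilon_spec (p := fun q : (Fin d ⊕ Fin d → ℝ → Fin d → ℂ) ×
      (Fin d ⊕ Fin d → ℝ → Fin d → ℂ) => ω.IsFundamentalSystem lam q.1 q.2)
      (exists_isFundamentalSystem hab ω lam)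
  obtain ⟨Y, hY, hY'⟩ := (h.1 j).exists_solves hab
  have h1 : Y a = Pi.single j 1 := by
    rw [hY' a (left_mem_Icc.2 hab)]
    funext i
    have := congrFun (congrFun h.2 i) j
    rw [Matrix.of_apply, Matrix.one_apply] at this
    rw [this, Pi.single_apply]
  have h2 := hY.eq_solve hab
  rw [h1, map_zero, add_zero] at h2
  rw [← h2]
  exact hY'

theorem charMatrix_eq (hab : a ≤ b) (ω : Equation d a b) (M : BoundaryMatrix d) (lam : ℂ) :
    ω.model.charMatrix M lam = M.1.1 * ω.Phi lam + M.1.2 * ω.Psi lam := by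
  ext i j
  have h := exists_solve_eq_fundamentalSystem hab ω lam j
  rw [Model.charMatrix_apply, Model.charMatrix_mulVec, bdryOp_apply, traceFst_apply, traceSnd_apply,
    h a (left_mem_Icc.2 hab), h b (right_mem_Icc.2 hab)]
  rfl

end Equation

theorem charFun_eq (hab : a ≤ b) (ω : Equation d a b) (M : BoundaryMatrix d) :
    charFun ω M = fun lam => (ω.model.charMatrix M lam).det := by
  funext lam
  rw [charFun, Equation.charMatrix_eq hab]

/-- A solution corresponds to its initial vector `u = (y(a), z(a))`. The point to check is that `u ≠
0` makes `y`, and not merely the pair `(y, z)`, nonzero. -/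
theorem isEigenvalue_iff (hab : a < b) (ω : Equation d a b) (M : BoundaryMatrix d) (lam : ℂ) :
    IsEigenvalue ω (Quotient.mk _ M) lam ↔ ∃ u, u ≠ 0 ∧ ω.model.charMatrix M lam *ᵥ u = 0 := by
  constructor
  · rintro ⟨y, z, hyz, ⟨t, ht, hyt⟩, hbc⟩
    obtain ⟨Y, hY, hY'⟩ := hyz.exists_solves hab.le
    have h1 := hY.eq_solve hab.le
    rw [map_zero, add_zero] at h1
    refine ⟨Y a, fun h0 => hyt ?_, ?_⟩
    · rw [h0, map_zero, map_zero] at h1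
      have h2 := hY' t ht
      rw [h1] at h2
      funext i
      exact (congrFun h2 (Sum.inl i)).symm
    · rw [Model.charMatrix_mulVec, ← h1, bdryOp_apply, traceFst_apply, traceSnd_apply,
        hY' a (left_mem_Icc.2 hab.le), hY' b (right_mem_Icc.2 hab.le)]
      exact hbc
  · rintro ⟨u, hu0, hu⟩
    have hY := (ω.model.solve_const_spec hab.le lam u).2
    refine ⟨_, _, Equation.isSolution_of_solves hab.le hY, ?_, ?_⟩
    · by_contra! h0
      obtain ⟨μ, C, hμ, hC, hM⟩ := ω.model.exists_bounded M
      have h1 := Model.solTriple_pos hab hu hu0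
      have h2 : (ω.model.solTriple M lam u).mass = 0 := by
        refine intervalIntegral.integral_zero_ae (Eventually.of_forall fun t ht => ?_)
        rw [uIoc_of_le hab.le] at ht
        have h3 : (ω.model.solTriple M lam u).fn t = 0 :=
          (hY.fn_tripleOf hab.le t).trans (h0 t (Ioc_subset_Icc_self ht))
        change ‖(ω.model.solTriple M lam u).fn t‖ ^ 2 = 0
        rw [h3, norm_zero, zero_pow two_ne_zero]
      have h3 := (Complex.re_le_norm _).trans
        (Model.norm_weightForm_le hab.le hC hM (ω.model.solTriple M lam u))
      rw [h2, mul_zero] at h3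
      exact absurd h1 (not_lt.2 h3)
    · rw [Model.charMatrix_mulVec, bdryOp_apply, traceFst_apply, traceSnd_apply] at hu
      exact hu

theorem analyticMultiplicity_eq (hab : a < b) (ω : Equation d a b) (M : BoundaryMatrix d)
    (lam : ℝ) : analyticMultiplicity ω (Quotient.mk _ M) (lam : ℂ) =
      Module.finrank ℂ (LinearMap.ker (ω.model.charMatrix M lam).mulVecLin) := by
  change analyticOrderAt (charFun ω M) lam = _
  rw [charFun_eq hab.le]
  exact Model.analyticOrderAt_det_charMatrix hab lam

/-- The jumps of the index form the eigenvalue sequence. -/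
theorem isEigenvalueSequence_jump (hab : a < b) (hd : 0 < d) (ω : Equation d a b)
    (M : BoundaryMatrix d) :
    IsEigenvalueSequence ω (Quotient.mk _ M) (ω.model.jump M) := by
  refine ⟨Model.monotone_jump hab hd, Model.tendsto_jump hab hd, fun n => ?_, fun lam hlam => ?_⟩
  · rw [isEigenvalue_iff hab]
    by_contra! h0
    have h1 := Model.encard_jump_eq (𝔐 := ω.model) (M := M) hab hd (ω.model.jump M n)
    have h2 : LinearMap.ker (ω.model.charMatrix M (ω.model.jump M n)).mulVecLin = ⊥ :=
      LinearMap.ker_eq_bot'.2 fun u hu => by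
        by_contra hu0
        exact h0 u hu0 hu
    rw [h2, finrank_bot, Nat.cast_zero, encard_eq_zero] at h1
    exact notMem_empty n (h1 ▸ rfl)
  · obtain ⟨u, hu0, hu⟩ := (isEigenvalue_iff hab ω M lam).1 hlam
    have h1 : lam = (lam.re : ℂ) :=
      Complex.ext rfl (Model.im_eq_zero_of_charMatrix hab hu hu0)
    rw [h1, analyticMultiplicity_eq hab, ← Model.encard_jump_eq hab hd]
    simp only [Complex.ofReal_inj]

/-- At the first index where the sequences differ, say `s n < s' n`, the level set of `s'` at the
value `s n` consists of indices below `n`. It is therefore finite and contained in the corresponding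
level set of `s`, which also contains `n`, so the cardinalities differ. -/
theorem eq_of_monotone_of_encard_eq {s s' : ℕ → ℝ} (hs : Monotone s) (hs' : Monotone s')
    (h : ∀ l, {n | s n = l}.encard = {n | s' n = l}.encard) : s = s' := by
  funext n
  induction n using Nat.strong_induction_on with
  | _ n ih =>
  have key : ∀ {s s' : ℕ → ℝ}, Monotone s' →
      (∀ l, {n | s n = l}.encard = {n | s' n = l}.encard) → (∀ m < n, s m = s' m) →
      ¬ s n < s' n := by
    intro s s' hs' h ih hlt
    have h1 : {m | s' m = s n} ⊆ {m | s m = s n} := by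
      intro m hm
      have hmn : m < n := by
        by_contra! hnm
        have := hs' hnm
        rw [show s' m = s n from hm] at this
        linarith
      exact (ih m hmn).trans hm
    have h2 : {m | s' m = s n}.Finite := by
      refine (finite_Iio n).subset fun m hm => ?_
      by_contra hnm
      have := hs' (not_lt.1 hnm)
      rw [show s' m = s n from hm] at this
      linarith
    have h3 := h2.eq_of_subset_of_encard_le h1 (h (s n)).le
    have h4 : n ∈ {m | s' m = s n} := by
      rw [h3]
      exact rfl
    exact hlt.ne' h4
  exact le_antisymm (not_lt.1 (key hs (fun l => (h l).symm) fun m hm => (ih m hm).symm))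
    (not_lt.1 (key hs' h ih))

theorem IsEigenvalueSequence.unique {ω : Equation d a b} {bc : BoundaryCondition d} {s s' : ℕ → ℝ}
    (h : IsEigenvalueSequence ω bc s) (h' : IsEigenvalueSequence ω bc s') : s = s' := by
  refine eq_of_monotone_of_encard_eq h.mono h'.mono fun l => ?_
  have e : ∀ r : ℕ → ℝ, {n | r n = l} = {n | (r n : ℂ) = l} := fun r => by
    simp only [Complex.ofReal_inj]
  rw [e, e]
  by_cases hl : IsEigenvalue ω bc l
  · rw [h.multiplicity _ hl, h'.multiplicity _ hl]
  · have h0 : ∀ r : ℕ → ℝ, IsEigenvalueSequence ω bc r → {n | (r n : ℂ) = l} = ∅ := by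
      intro r hr
      refine eq_empty_of_forall_notMem fun n hn => hl ?_
      rw [← show (r n : ℂ) = l from hn]
      exact hr.isEigenvalue n
    rw [h0 s h, h0 s' h']

theorem nthEigenvalue_eq (hab : a < b) (hd : 0 < d) (ω : Equation d a b) (M : BoundaryMatrix d)
    (n : ℕ) : nthEigenvalue ω (Quotient.mk _ M) n = ω.model.jump M (n - 1) := by
  have h : ∃ s, IsEigenvalueSequence ω (Quotient.mk _ M) s := ⟨_, isEigenvalueSequence_jump hab hd ω M⟩
  rw [nthEigenvalue, dif_pos h]
  exact congrFun (h.choose_spec.unique (isEigenvalueSequence_jump hab hd ω M)) _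

end Eigenvalues

/-! ### Comparison of the indices of neighbouring problems -/

section Comparison

open Set

/-- A map that preserves negativity of vectors kills no nonzero vector of a negative subspace, so it
transports that subspace with its dimension. -/
theorem IndexGE.map {D D' : Type*} [AddCommGroup D] [Module ℂ D] [AddCommGroup D'] [Module ℂ D']
    {q : SesqForm D} {q' : SesqForm D'} {n : ℕ} (h : IndexGE q n) (T : D →ₗ[ℂ] D')
    (hT : ∀ x, (q x x).re < 0 → (q' (T x) (T x)).re < 0) : IndexGE q' n := by
  obtain ⟨U, hfd, rfl, hneg⟩ := h
  have hinj : Function.Injective (T ∘ₗ U.subtype) := by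
    rw [← LinearMap.ker_eq_bot, LinearMap.ker_eq_bot']
    intro u hu
    by_contra h0
    have h1 := hT u (hneg u u.2 fun h => h0 (Subtype.ext h))
    have h2 : T u = 0 := hu
    rw [h2] at h1
    simp at h1
  refine ⟨LinearMap.range (T ∘ₗ U.subtype), inferInstance,
    LinearMap.finrank_range_of_inj hinj, ?_⟩
  rintro _ ⟨u, rfl⟩ h0
  exact hT u (hneg u u.2 fun h => h0 (by simp [h]))

variable {d : ℕ} {a b : ℝ}

namespace Model

/-- The coefficients and the boundary data of two problems differ by at most `δ`. -/
structure Close (𝔐 𝔐' : Model d a b) (M M' : BoundaryMatrix d) (δ : ℝ) : Prop where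
  closeP : ∀ᵐ t ∂(volume.restrict (Icc a b)), ∀ i j, ‖(𝔐'.P t - 𝔐.P t) i j‖ ≤ δ
  closeQ : ∀ᵐ t ∂(volume.restrict (Icc a b)), ∀ i j, ‖(𝔐'.Q t - 𝔐.Q t) i j‖ ≤ δ
  closeW : ∀ᵐ t ∂(volume.restrict (Icc a b)), ∀ i j, ‖(𝔐'.W t - 𝔐.W t) i j‖ ≤ δ
  closeM : ∀ i j, ‖(M'.1.2 * M'.1.1ᴴ - M.1.2 * M.1.1ᴴ) i j‖ ≤ δ
  closeB : ∀ i j, ‖(M'.1.2ᴴ - M.1.2ᴴ) i j‖ ≤ δ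

theorem norm_sub_apply_comm {κ : Type*} {N N' : Matrix κ κ ℂ} {δ : ℝ}
    (h : ∀ i j, ‖(N' - N) i j‖ ≤ δ) (i j : κ) : ‖(N - N') i j‖ ≤ δ := by
  have := h i j
  rwa [Matrix.sub_apply, norm_sub_rev] at this

theorem Close.symm {𝔐 𝔐' : Model d a b} {M M' : BoundaryMatrix d} {δ : ℝ}
    (h : Close 𝔐 𝔐' M M' δ) : Close 𝔐' 𝔐 M' M δ :=
  ⟨h.closeP.mono fun _ => norm_sub_apply_comm, h.closeQ.mono fun _ => norm_sub_apply_comm,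
    h.closeW.mono fun _ => norm_sub_apply_comm, norm_sub_apply_comm h.closeM,
    norm_sub_apply_comm h.closeB⟩

theorem Close.mono {𝔐 𝔐' : Model d a b} {M M' : BoundaryMatrix d} {δ δ' : ℝ}
    (h : Close 𝔐 𝔐' M M' δ) (hδ : δ ≤ δ') : Close 𝔐 𝔐' M M' δ' :=
  ⟨h.closeP.mono fun _ ht i j => (ht i j).trans hδ, h.closeQ.mono fun _ ht i j => (ht i j).trans hδ,
    h.closeW.mono fun _ ht i j => (ht i j).trans hδ, fun i j => (h.closeM i j).trans hδ,
    fun i j => (h.closeB i j).trans hδ⟩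

theorem Close.refl (𝔐 : Model d a b) (M : BoundaryMatrix d) {δ : ℝ} (hδ : 0 ≤ δ) :
    Close 𝔐 𝔐 M M δ := by
  constructor <;> simp [hδ]

end Model

/-- The affine function with prescribed boundary values, as a triple. -/
noncomputable def affineTriple (a b : ℝ) :
    (Fin d ⊕ Fin d → ℂ) × (Fin d ⊕ Fin d → ℂ) →ₗ[ℂ] Triple d a b where
  toFun r := (-(r.1 ∘ Sum.inl), ⟨(Ioc a b).indicator fun _ =>
      ((b - a : ℝ) : ℂ)⁻¹ • (r.1 ∘ Sum.inl + r.1 ∘ Sum.inr),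
    ⟨measurable_const.indicator measurableSet_Ioc, ‖((b - a : ℝ) : ℂ)⁻¹ • (r.1 ∘ Sum.inl +
      r.1 ∘ (Sum.inr : Fin d → Fin d ⊕ Fin d))‖, fun t => norm_indicator_le_norm_self _ _⟩,
    fun t ht => indicator_of_notMem ht _⟩, r.2)
  map_add' r s := by
    refine Prod.ext ?_ (Prod.ext (Subtype.ext (funext fun t => ?_)) rfl)
    · exact neg_add _ _
    · by_cases ht : t ∈ Ioc a b
      · simp only [Prod.snd_add, Prod.fst_add, Submodule.coe_add, Pi.add_apply, indicator_of_mem ht]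
        rw [← smul_add]
        congr 1
        funext i
        simp only [Function.comp_apply, Pi.add_apply]
        ring
      · simp only [Prod.snd_add, Prod.fst_add, Submodule.coe_add, Pi.add_apply,
          indicator_of_notMem ht, add_zero]
  map_smul' c r := by
    refine Prod.ext ?_ (Prod.ext (Subtype.ext (funext fun t => ?_)) rfl)
    · exact (smul_neg c (r.1 ∘ Sum.inl)).symm
    · by_cases ht : t ∈ Ioc a b
      · simp only [Prod.smul_snd, Prod.smul_fst, Submodule.coe_smul, Pi.smul_apply,
          indicator_of_mem ht, RingHom.id_apply]
        rw [smul_comm c]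
        congr 1
        funext i
        simp only [Function.comp_apply, Pi.add_apply, Pi.smul_apply, smul_eq_mul]
        ring
      · simp only [Prod.smul_snd, Prod.smul_fst, Submodule.coe_smul, Pi.smul_apply,
          indicator_of_notMem ht, smul_zero]

theorem bdry_affineTriple (hab : a < b) (r ξ : Fin d ⊕ Fin d → ℂ) :
    Triple.bdry (affineTriple a b (r, ξ)) = r := by
  have h1 : ∫ s in a..b, ((affineTriple a b (r, ξ)).2.1 : ℝ → Fin d → ℂ) s =
      r ∘ Sum.inl + r ∘ Sum.inr := by
    have e : ∫ s in a..b, ((affineTriple a b (r, ξ)).2.1 : ℝ → Fin d → ℂ) s =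
        ∫ s in a..b, ((b - a : ℝ) : ℂ)⁻¹ • (r ∘ Sum.inl + r ∘ Sum.inr) := by
      refine intervalIntegral.integral_congr_ae (Eventually.of_forall fun s hs => ?_)
      rw [uIoc_of_le hab.le] at hs
      exact indicator_of_mem hs fun _ : ℝ => ((b - a : ℝ) : ℂ)⁻¹ • (r ∘ Sum.inl + r ∘ Sum.inr)
    have hba : ((b - a : ℝ) : ℂ) ≠ 0 := by exact_mod_cast (sub_pos.2 hab).ne'
    rw [e, intervalIntegral.integral_const, ← Complex.coe_smul, smul_smul, mul_inv_cancel₀ hba,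
      one_smul]
  have h2 : (affineTriple a b (r, ξ)).1 = -(r ∘ Sum.inl) := rfl
  funext i
  rcases i with i | i
  · change -((affineTriple a b (r, ξ)).fn a) i = _
    rw [Triple.fn_left, h2]
    simp
  · change (affineTriple a b (r, ξ)).fn b i = _
    rw [Triple.fn, h1, h2]
    simp

theorem energy_affineTriple_le (hab : a < b) (r ξ : Fin d ⊕ Fin d → ℂ) :
    (affineTriple a b (r, ξ)).energy ≤ 4 / (b - a) * ‖r‖ ^ 2 := by
  have hba := sub_pos.2 hab
  have hc : ∀ e : Fin d → Fin d ⊕ Fin d, ‖r ∘ e‖ ≤ ‖r‖ := fun e =>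
    (pi_norm_le_iff_of_nonneg (norm_nonneg _)).2 fun i => norm_le_pi_norm r _
  have h1 : ∀ t ∈ Icc a b, ‖((affineTriple a b (r, ξ)).2.1 : ℝ → Fin d → ℂ) t‖ ^ 2 ≤
      (2 / (b - a) * ‖r‖) ^ 2 := by
    intro t _
    refine pow_le_pow_left₀ (norm_nonneg _) ((norm_indicator_le_norm_self
      (fun _ : ℝ => ((b - a : ℝ) : ℂ)⁻¹ • (r ∘ Sum.inl + r ∘ Sum.inr)) t).trans ?_) 2
    rw [norm_smul, norm_inv, Complex.norm_real, Real.norm_of_nonneg hba.le]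
    have h2 := (norm_add_le _ _).trans (add_le_add (hc Sum.inl) (hc Sum.inr))
    calc _ ≤ (b - a)⁻¹ * (‖r‖ + ‖r‖) := mul_le_mul_of_nonneg_left h2 (by positivity)
      _ = _ := by ring
  have h2 := intervalIntegral.integral_mono_on hab.le
    ((affineTriple a b (r, ξ)).isBddMeas.intervalIntegrable_sq a b) intervalIntegrable_const h1
  rw [intervalIntegral.integral_const, smul_eq_mul] at h2
  refine h2.trans_eq ?_
  field_simp
  ring

theorem Triple.mass_le (hab : a ≤ b) (x : Triple d a b) :
    x.mass ≤ (b - a) * (2 * ‖x.1‖ ^ 2 + 2 * ((b - a) * x.energy)) := by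
  have h1 : ∀ t ∈ Icc a b, ‖x.fn t‖ ^ 2 ≤ 2 * ‖x.1‖ ^ 2 + 2 * ((b - a) * x.energy) := by
    intro t ht
    have h2 := x.norm_fn_sub_sq_le (left_mem_Icc.2 hab) ht
    rw [x.fn_left, abs_of_nonneg (sub_nonneg.2 ht.1)] at h2
    have h3 := mul_le_mul_of_nonneg_right (sub_le_sub_right ht.2 a) (x.energy_nonneg hab)
    have h4 : ‖x.fn t‖ ≤ ‖x.fn t - x.1‖ + ‖x.1‖ := by
      simpa using norm_add_le (x.fn t - x.1) x.1
    have h5 := pow_le_pow_left₀ (norm_nonneg _) h4 2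
    nlinarith [sq_nonneg (‖x.fn t - x.1‖ - ‖x.1‖)]
  have h2 := intervalIntegral.integral_mono_on hab
    (x.isBddMeas_fn.intervalIntegrable_sq a b) intervalIntegrable_const h1
  rwa [intervalIntegral.integral_const, smul_eq_mul] at h2

theorem mass_affineTriple_le (hab : a < b) (r ξ : Fin d ⊕ Fin d → ℂ) :
    (affineTriple a b (r, ξ)).mass ≤ 10 * (b - a) * ‖r‖ ^ 2 := by
  have hba := sub_pos.2 hab
  refine (Triple.mass_le hab.le _).trans ?_
  have h1 : ‖(affineTriple a b (r, ξ)).1‖ ^ 2 ≤ ‖r‖ ^ 2 := by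
    refine pow_le_pow_left₀ (norm_nonneg _) ?_ 2
    change ‖-(r ∘ Sum.inl)‖ ≤ _
    rw [norm_neg]
    exact (pi_norm_le_iff_of_nonneg (norm_nonneg _)).2 fun i => norm_le_pi_norm r _
  have h2 := mul_le_mul_of_nonneg_left (energy_affineTriple_le hab r ξ) hba.le
  have h3 : (b - a) * (4 / (b - a) * ‖r‖ ^ 2) = 4 * ‖r‖ ^ 2 := by
    field_simp
  rw [h3] at h2
  calc _ ≤ (b - a) * (2 * ‖r‖ ^ 2 + 2 * (4 * ‖r‖ ^ 2)) :=
        mul_le_mul_of_nonneg_left (by linarith) hba.le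
    _ = _ := by ring

end Comparison

/-! ### Transfer of form domains and stability of the index. -/

section Comparison

open Set

variable {d : ℕ} {a b : ℝ}

namespace Model

/-- The form domains of two neighbouring problems are nearly isometric. -/
theorem exists_transfer (hab : a < b) (d : ℕ) {μ C : ℝ} (hC : 0 ≤ C) : ∃ K : ℝ, 0 ≤ K ∧
    ∀ (𝔐 𝔐' : Model d a b) (M M' : BoundaryMatrix d), 𝔐.Bounded M μ C → 𝔐'.Bounded M' μ C →
      ∀ δ : ℝ, 0 < δ → δ ≤ 1 → Close 𝔐 𝔐' M M' δ →
        ∃ T : Triple d a b →ₗ[ℂ] Triple d a b, ∀ x ∈ bdDomain a b M, T x ∈ bdDomain a b M' ∧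
          ‖𝔐'.energyForm M' (T x) (T x) - 𝔐.energyForm M x x‖ ≤ K * δ * (x.mass + x.energy) ∧
          ‖𝔐'.weightForm (T x) (T x) - 𝔐.weightForm x x‖ ≤ K * δ * (x.mass + x.energy) := by
  have hs : 0 < b - a := sub_pos.2 hab
  obtain ⟨c, hc⟩ : ∃ c : ℝ, c = Fintype.card (Fin d ⊕ Fin d) := ⟨_, rfl⟩
  have hc0 : 0 ≤ c := hc ▸ Nat.cast_nonneg _
  -- `K₁` bounds the lifted parameter, by the Sobolev inequality with `h = (b - a) / 2`; `K₂` bounds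
  -- energy and mass of the affine correction; `K₃` is the resulting error of one integral form. The
  -- final constant counts two integral forms and the boundary form.
  obtain ⟨K₁, hK₁⟩ : ∃ K₁ : ℝ, K₁ = C ^ 2 * (4 / (b - a) + (b - a)) := ⟨_, rfl⟩
  have hK₁0 : 0 ≤ K₁ := by rw [hK₁]; positivity
  obtain ⟨K₂, hK₂⟩ : ∃ K₂ : ℝ, K₂ = (4 / (b - a) + 10 * (b - a)) * (c ^ 2 * K₁) := ⟨_, rfl⟩
  have hK₂0 : 0 ≤ K₂ := by rw [hK₂]; positivity
  obtain ⟨K₃, hK₃⟩ : ∃ K₃ : ℝ, K₃ = d ^ 2 * (1 + C + 2 * C * K₂) := ⟨_, rfl⟩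
  have hK₃0 : 0 ≤ K₃ := by rw [hK₃]; positivity
  refine ⟨2 * K₃ + c ^ 2 * K₁, by positivity, fun 𝔐 𝔐' M M' hM hM' δ hδ hδ1 hcl => ?_⟩
  obtain ⟨S, hS⟩ := hM.lift
  let X : Triple d a b →ₗ[ℂ] (Fin d ⊕ Fin d → ℂ) := S ∘ₗ Triple.bdry
  let N := M'.1.2ᴴ - M.1.2ᴴ
  -- The new parameter is the bounded lift `X x` rather than the uncontrolled `x.2.2`. The added
  -- affine function has boundary values `(B'* - B*) X x`, which turn `B* X x` into `B'* X x`; its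
  -- mass and energy are of order `δ ^ 2`.
  let H : Triple d a b →ₗ[ℂ] Triple d a b :=
    affineTriple a b ∘ₗ ((N.mulVecLin ∘ₗ X).prod (X - Triple.param))
  refine ⟨LinearMap.id + H, fun x hx => ?_⟩
  have hHx : H x = affineTriple a b (N *ᵥ X x, X x - x.2.2) := rfl
  have hT : (LinearMap.id + H : Triple d a b →ₗ[ℂ] Triple d a b) x = x + H x := rfl
  have hparam : (x + H x).2.2 = X x := by
    rw [hHx]
    exact add_sub_cancel _ _
  have hbx : Triple.bdry x = M.1.2ᴴ *ᵥ x.2.2 := hx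
  have hX : M.1.2ᴴ *ᵥ X x = M.1.2ᴴ *ᵥ x.2.2 := by
    change M.1.2ᴴ *ᵥ S (Triple.bdry x) = _
    rw [hbx]
    exact (hS _).1
  have hXn : ‖X x‖ ^ 2 ≤ K₁ * (x.mass + x.energy) := by
    have h1 : ‖X x‖ ≤ C * ‖Triple.bdry x‖ := by
      change ‖S (Triple.bdry x)‖ ≤ _
      rw [hbx]
      exact (hS _).2
    have h2 := x.norm_bdry_sq_le (half_pos hs) (by linarith)
    have hm := x.mass_nonneg hab.le
    have he := x.energy_nonneg hab.le
    have h3 : 2 / ((b - a) / 2) * x.mass + 2 * ((b - a) / 2) * x.energy ≤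
        (4 / (b - a) + (b - a)) * (x.mass + x.energy) := by
      have e1 : 2 / ((b - a) / 2) = 4 / (b - a) := by field_simp; norm_num
      have e2 : 0 ≤ 4 / (b - a) * x.energy := by positivity
      have e3 : 0 ≤ (b - a) * x.mass := by positivity
      rw [e1]
      linarith
    calc _ ≤ (C * ‖Triple.bdry x‖) ^ 2 := pow_le_pow_left₀ (norm_nonneg _) h1 2
      _ = C ^ 2 * ‖Triple.bdry x‖ ^ 2 := mul_pow _ _ _
      _ ≤ C ^ 2 * ((4 / (b - a) + (b - a)) * (x.mass + x.energy)) :=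
        mul_le_mul_of_nonneg_left (h2.trans h3) (by positivity)
      _ = _ := by rw [hK₁]; ring
  set R := x.mass + x.energy with hR
  have hR0 : 0 ≤ R := add_nonneg (x.mass_nonneg hab.le) (x.energy_nonneg hab.le)
  have hr : ‖N *ᵥ X x‖ ^ 2 ≤ c ^ 2 * K₁ * (δ ^ 2 * R) := by
    have h1 := norm_mulVec_le hcl.closeB hδ.le (X x)
    rw [← hc] at h1
    calc _ ≤ (c * δ * ‖X x‖) ^ 2 := pow_le_pow_left₀ (norm_nonneg _) h1 2
      _ = c ^ 2 * δ ^ 2 * ‖X x‖ ^ 2 := by ring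
      _ ≤ c ^ 2 * δ ^ 2 * (K₁ * R) := mul_le_mul_of_nonneg_left hXn (by positivity)
      _ = _ := by ring
  have hHe : (H x).energy ≤ K₂ * (δ ^ 2 * R) := by
    rw [hHx]
    refine (energy_affineTriple_le hab _ _).trans ?_
    have h1 := mul_le_mul_of_nonneg_left hr (show 0 ≤ 4 / (b - a) by positivity)
    have h2 : 0 ≤ 10 * (b - a) * (c ^ 2 * K₁ * (δ ^ 2 * R)) := by positivity
    rw [hK₂]
    linarith
  have hHm : (H x).mass ≤ K₂ * (δ ^ 2 * R) := by
    rw [hHx]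
    refine (mass_affineTriple_le hab _ _).trans ?_
    have h1 := mul_le_mul_of_nonneg_left hr (show 0 ≤ 10 * (b - a) by positivity)
    have h2 : 0 ≤ 4 / (b - a) * (c ^ 2 * K₁ * (δ ^ 2 * R)) := by positivity
    rw [hK₂]
    linarith
  -- The square of the correction compensates the factor `1 / δ` from Young's inequality.
  have hδ2 : (1 + 1 / δ) * δ ^ 2 ≤ 2 * δ := by
    have : (1 + 1 / δ) * δ ^ 2 = δ * δ + δ := by field_simp
    nlinarith
  have hest : ∀ {s t : ℝ}, s ≤ R → t ≤ K₂ * (δ ^ 2 * R) →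
      d ^ 2 * ((1 + C) * δ * s + C * (1 + 1 / δ) * t) ≤ K₃ * δ * R := by
    intro s t hs ht
    have h1 : (1 + C) * δ * s ≤ (1 + C) * δ * R := mul_le_mul_of_nonneg_left hs (by positivity)
    have h2 : C * (1 + 1 / δ) * t ≤ C * (1 + 1 / δ) * (K₂ * (δ ^ 2 * R)) :=
      mul_le_mul_of_nonneg_left ht (by positivity)
    have h3 : C * K₂ * R * ((1 + 1 / δ) * δ ^ 2) ≤ C * K₂ * R * (2 * δ) :=
      mul_le_mul_of_nonneg_left hδ2 (by positivity)
    calc _ ≤ (d : ℝ) ^ 2 * ((1 + C) * δ * R + C * K₂ * R * (2 * δ)) :=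
          mul_le_mul_of_nonneg_left (by linarith) (by positivity)
      _ = _ := by rw [hK₃]; ring
  have hmR : x.mass ≤ R := by linarith [x.energy_nonneg hab.le]
  have heR : x.energy ≤ R := by linarith [x.mass_nonneg hab.le]
  have hP := (norm_intForm_sub_le hab.le 𝔐.coeffP 𝔐'.coeffP hC hδ hM'.bddP hcl.closeP
    (Triple.der x) (Triple.der (H x))).trans (hest heR hHe)
  have hQ := (norm_intForm_sub_le hab.le 𝔐.coeffQ 𝔐'.coeffQ hC hδ hM'.bddQ hcl.closeQ
    (Triple.val x) (Triple.val (H x))).trans (hest hmR hHm)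
  have hW := (norm_intForm_sub_le hab.le 𝔐.coeffW 𝔐'.coeffW hC hδ hM'.bddW hcl.closeW
    (Triple.val x) (Triple.val (H x))).trans (hest hmR hHm)
  rw [hT]
  refine ⟨?_, ?_, ?_⟩
  · rw [mem_bdDomain, hparam, map_add, hHx, bdry_affineTriple hab, hbx, ← hX, ← Matrix.add_mulVec]
    congr 1
    exact add_sub_cancel _ _
  · have hB : ‖matForm (M'.1.2 * M'.1.1ᴴ) (X x) (X x) - matForm (M.1.2 * M.1.1ᴴ) (X x) (X x)‖ ≤
        c ^ 2 * K₁ * δ * R := by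
      have e : matForm (M'.1.2 * M'.1.1ᴴ) (X x) (X x) - matForm (M.1.2 * M.1.1ᴴ) (X x) (X x) =
          matForm (M'.1.2 * M'.1.1ᴴ - M.1.2 * M.1.1ᴴ) (X x) (X x) := by
        rw [matForm_apply, matForm_apply, matForm_apply, Matrix.sub_mulVec, dotProduct_sub]
      rw [e]
      have h1 := norm_matForm_le hδ.le hcl.closeM (X x) (X x)
      rw [← hc, ← pow_two] at h1
      calc _ ≤ _ := h1
        _ ≤ c ^ 2 * δ * (K₁ * R) := mul_le_mul_of_nonneg_left hXn (by positivity)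
        _ = _ := by ring
    rw [energyForm_apply, energyForm_apply, hparam, ← matForm_boundary_congr hX,
      map_add Triple.der x (H x), map_add Triple.val x (H x)]
    have e : ∀ p q r p' q' r' : ℂ, p + q + r - (p' + q' + r') = (p - p') + (q - q') + (r - r') :=
      fun _ _ _ _ _ _ => by ring
    rw [e]
    refine (norm_add_le _ _).trans ((add_le_add (norm_add_le _ _) le_rfl).trans ?_)
    have := add_le_add (add_le_add hP hQ) hB
    linarith
  · rw [weightForm_apply, weightForm_apply, map_add Triple.val x (H x)]
    have h1 : 0 ≤ K₃ * δ * R := by positivity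
    have h2 : 0 ≤ c ^ 2 * K₁ * δ * R := by positivity
    linarith

/-- A small perturbation of the problem lowers the index at most as much as a small decrease of the
spectral parameter. -/
theorem exists_index_le_of_close (hab : a < b) (d : ℕ) {μ C L ε : ℝ} (hμ : 0 < μ) (hC : 0 ≤ C)
    (hL : 0 ≤ L) (hε : 0 < ε) : ∃ δ : ℝ, 0 < δ ∧
    ∀ (𝔐 𝔐' : Model d a b) (M M' : BoundaryMatrix d), 𝔐.Bounded M μ C → 𝔐'.Bounded M' μ C →
      Close 𝔐 𝔐' M M' δ → ∀ (lam : ℝ) (n : ℕ), |lam| ≤ L → IndexGE (𝔐.qForm M lam) n →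
        IndexGE (𝔐'.qForm M' (lam + ε)) n := by
  obtain ⟨K, hK0, hK⟩ := exists_transfer (μ := μ) hab d hC
  obtain ⟨G, hG0, hG⟩ := exists_coercive hab d hμ hC
  -- Where the form at `lam` is negative, coercivity bounds the energy by `A` times the mass. The
  -- errors of the transfer, with weight `1` for the energy form and `L + ε` for the weight form,
  -- then add up to at most `B * δ * mass`.
  obtain ⟨A, hA⟩ : ∃ A : ℝ, A = 2 / μ * (L * (d ^ 2 * C) + G) := ⟨_, rfl⟩
  have hA0 : 0 ≤ A := by rw [hA]; positivity
  obtain ⟨B, hB⟩ : ∃ B : ℝ, B = (1 + (L + ε)) * K * (1 + A) := ⟨_, rfl⟩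
  have hB0 : 0 ≤ B := by rw [hB]; positivity
  -- With this `δ` the total error is at most `ε * μ * mass`, hence at most the gain `ε` times the
  -- weight form obtained from the shifted parameter.
  refine ⟨min 1 (ε * μ / (B + 1)), by positivity, fun 𝔐 𝔐' M M' hM hM' hcl lam n hlam hn => ?_⟩
  obtain ⟨δ, hδ⟩ : ∃ δ, δ = min 1 (ε * μ / (B + 1)) := ⟨_, rfl⟩
  rw [← hδ] at hcl
  have hδ0 : 0 < δ := by rw [hδ]; positivity
  have hBδ : B * δ ≤ ε * μ := by
    have h1 : δ ≤ ε * μ / (B + 1) := hδ ▸ min_le_right _ _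
    rw [le_div_iff₀ (by positivity)] at h1
    nlinarith
  obtain ⟨T, hT⟩ := hK 𝔐 𝔐' M M' hM hM' δ hδ0 (hδ ▸ min_le_left _ _) hcl
  refine hn.map ((T.domRestrict (bdDomain a b M)).codRestrict (bdDomain a b M')
    fun x => (hT x x.2).1) fun x hx => ?_
  obtain ⟨-, h1, h2⟩ := hT x x.2
  have e : (𝔐'.qForm M' (lam + ε) ((T.domRestrict (bdDomain a b M)).codRestrict (bdDomain a b M')
      (fun x => (hT x x.2).1) x) ((T.domRestrict (bdDomain a b M)).codRestrict (bdDomain a b M')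
      (fun x => (hT x x.2).1) x)).re = (𝔐'.energyForm M' (T x) (T x)).re -
      (lam + ε) * (𝔐'.weightForm (T x) (T x)).re := qForm_re _ _ _ _
  rw [qForm_re] at hx
  rw [e]
  set m := Triple.mass (x : Triple d a b)
  set γ := Triple.energy (x : Triple d a b)
  have hm : 0 ≤ m := Triple.mass_nonneg hab.le _
  have hγ : 0 ≤ γ := Triple.energy_nonneg hab.le _
  have h3 := weightForm_re_ge hab.le hM (x : Triple d a b)
  have h4 := (Complex.re_le_norm _).trans (norm_weightForm_le hab.le hC hM (x : Triple d a b))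
  have h5 := hG 𝔐 M hM x x.2
  have h6 := (le_abs_self _).trans ((Complex.abs_re_le_norm _).trans h1)
  have h7 := (Complex.abs_re_le_norm _).trans h2
  rw [Complex.sub_re] at h6 h7
  obtain ⟨w, hw⟩ : ∃ w, w = (𝔐.weightForm (x : Triple d a b) x).re := ⟨_, rfl⟩
  have hmm : Triple.mass (x : Triple d a b) = m := rfl
  rw [← hw] at h3 h4 h7 hx
  rw [hmm] at h3 h4
  have hw0 : 0 ≤ w := (mul_nonneg hμ.le hm).trans h3
  have h8 : lam * w ≤ L * (d ^ 2 * C * m) := by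
    calc lam * w ≤ |lam| * w := mul_le_mul_of_nonneg_right (le_abs_self _) hw0
      _ ≤ L * w := mul_le_mul_of_nonneg_right hlam hw0
      _ ≤ _ := mul_le_mul_of_nonneg_left h4 hL
  have h9 : γ ≤ A * m := by
    have h10 : μ / 2 * γ ≤ (L * (d ^ 2 * C) + G) * m := by linarith
    have h11 : γ = 2 / μ * (μ / 2 * γ) := by field_simp
    rw [h11, hA, mul_assoc]
    exact mul_le_mul_of_nonneg_left h10 (by positivity)
  have h10 : K * δ * (m + γ) ≤ K * δ * ((1 + A) * m) :=
    mul_le_mul_of_nonneg_left (by linarith) (by positivity)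
  have h11 : |lam + ε| ≤ L + ε := (abs_add_le _ _).trans (by rw [abs_of_pos hε]; linarith)
  set w' := (𝔐'.weightForm (T x) (T x)).re
  have h12 : -((lam + ε) * (w' - w)) ≤ (L + ε) * (K * δ * ((1 + A) * m)) := by
    refine (neg_le_abs _).trans ?_
    rw [abs_mul]
    exact mul_le_mul h11 (h7.trans h10) (abs_nonneg _) (by positivity)
  have h13 : B * δ * m ≤ ε * μ * m := mul_le_mul_of_nonneg_right hBδ hm
  have h14 : ε * (μ * m) ≤ ε * w := mul_le_mul_of_nonneg_left h3 hε.le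
  have h15 : B * δ * m = K * δ * ((1 + A) * m) + (L + ε) * (K * δ * ((1 + A) * m)) := by
    rw [hB]
    ring
  have h16 : (lam + ε) * w' = lam * w + ε * w + (lam + ε) * (w' - w) := by ring
  rw [h16]
  linarith

end Model
end Comparison

/-! ### Continuity of the eigenvalues on the layers -/

section Continuity

open Set

/-- Matrices of the same rank close to a given one have uniformly bounded generalized inverses. -/
theorem exists_uniform_lift {κ : Type*} [Fintype κ] (N₀ : Matrix κ κ ℂ) : ∃ C δ : ℝ, 0 ≤ C ∧ 0 < δ ∧
    ∀ N : Matrix κ κ ℂ, (∀ i j, ‖(N - N₀) i j‖ ≤ δ) → N.rank = N₀.rank →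
      ∃ S : (κ → ℂ) →ₗ[ℂ] (κ → ℂ), ∀ ξ,
        N *ᵥ S (N *ᵥ ξ) = N *ᵥ ξ ∧ ‖S (N *ᵥ ξ)‖ ≤ C * ‖N *ᵥ ξ‖ := by
  -- On a complement `E` of the kernel, `N₀` is bounded below, and this persists for nearby `N` with
  -- twice the constant. The inverse of `N` restricted to `E` is the required lift.
  obtain ⟨E, hE⟩ := (LinearMap.ker N₀.mulVecLin).exists_isCompl
  have hinj : LinearMap.ker (N₀.mulVecLin.domRestrict E) = ⊥ := by
    rw [LinearMap.ker_eq_bot']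
    intro e he
    have h1 : (e : κ → ℂ) ∈ LinearMap.ker N₀.mulVecLin := he
    exact Subtype.ext (Submodule.disjoint_def.1 hE.disjoint _ h1 e.2)
  obtain ⟨K, hK, hanti⟩ := (N₀.mulVecLin.domRestrict E).exists_antilipschitzWith hinj
  have hN₀ : ∀ e ∈ E, ‖e‖ ≤ K * ‖N₀ *ᵥ e‖ := fun e he => by
    have h1 := hanti.le_mul_dist ⟨e, he⟩ 0
    rw [map_zero, dist_zero_right, dist_zero_right] at h1
    exact h1
  have hK' : (0 : ℝ) < K := hK
  obtain ⟨c, hc⟩ : ∃ c : ℝ, c = Fintype.card κ := ⟨_, rfl⟩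
  have hc0 : 0 ≤ c := hc ▸ Nat.cast_nonneg _
  -- The radius makes `K * ‖(N - N₀) e‖` at most `‖e‖ / 2`, which is absorbed on the left.
  refine ⟨2 * K, 1 / (2 * K * (c + 1)), by positivity, by positivity, fun N hN hrank => ?_⟩
  have hNE : ∀ e ∈ E, ‖e‖ ≤ 2 * K * ‖N *ᵥ e‖ := fun e he => by
    have h1 := norm_mulVec_le hN (by positivity) e
    rw [← hc] at h1
    have h2 : ‖N₀ *ᵥ e‖ ≤ ‖N *ᵥ e‖ + ‖(N - N₀) *ᵥ e‖ := by
      have : N₀ *ᵥ e = N *ᵥ e - (N - N₀) *ᵥ e := by rw [Matrix.sub_mulVec, sub_sub_cancel]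
      rw [this]
      exact norm_sub_le _ _
    have h3 := (hN₀ e he).trans (mul_le_mul_of_nonneg_left (h2.trans (add_le_add le_rfl h1)) hK'.le)
    have h4 : K * (c * (1 / (2 * K * (c + 1))) * ‖e‖) ≤ 1 / 2 * ‖e‖ := by
      have h5 : K * (c * (1 / (2 * K * (c + 1))) * ‖e‖) = c / (c + 1) * (1 / 2 * ‖e‖) := by
        field_simp
      rw [h5]
      exact mul_le_of_le_one_left (by positivity) ((div_le_one (by positivity)).2 (by linarith))
    linarith
  have hg : LinearMap.ker (N.mulVecLin.domRestrict E) = ⊥ := by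
    rw [LinearMap.ker_eq_bot']
    intro e he
    have h1 := hNE e e.2
    have h2 : N *ᵥ (e : κ → ℂ) = 0 := he
    rw [h2, norm_zero, mul_zero] at h1
    exact Subtype.ext (norm_le_zero_iff.1 h1)
  -- Equality of ranks is decisive: `N` maps `E` injectively, so its image has the dimension of the
  -- range of `N₀`, and hence fills the range of `N`. If the rank increased, the additional range
  -- directions could have unbounded preimages.
  have hrange : LinearMap.range (N.mulVecLin.domRestrict E) = LinearMap.range N.mulVecLin := by
    refine Submodule.eq_of_le_of_finrank_eq ?_ ?_
    · rintro _ ⟨e, rfl⟩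
      exact ⟨e, rfl⟩
    · rw [LinearMap.finrank_range_of_inj (LinearMap.ker_eq_bot.1 hg)]
      have h1 := Submodule.finrank_add_eq_of_isCompl hE
      have h2 := N₀.mulVecLin.finrank_range_add_finrank_ker
      have h3 : Module.finrank ℂ (LinearMap.range N.mulVecLin) =
        Module.finrank ℂ (LinearMap.range N₀.mulVecLin) := hrank
      omega
  obtain ⟨S, hS⟩ := LinearMap.exists_leftInverse_of_injective _ hg
  refine ⟨E.subtype ∘ₗ S, fun ξ => ?_⟩
  obtain ⟨e, he⟩ : N *ᵥ ξ ∈ LinearMap.range (N.mulVecLin.domRestrict E) := hrange ▸ ⟨ξ, rfl⟩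
  have he' : N *ᵥ (e : κ → ℂ) = N *ᵥ ξ := he
  have h1 : (E.subtype ∘ₗ S) (N *ᵥ ξ) = e := by
    rw [← he]
    exact congrArg Subtype.val (LinearMap.congr_fun hS e)
  rw [h1, he']
  exact ⟨rfl, he' ▸ hNE e e.2⟩

variable {d : ℕ} {a b : ℝ}

-- Since `B` and `B*` have the same rank, staying in a layer means exactly that the rank of `B*` is
-- constant.
open scoped ComplexOrder in
theorem rank_add_nullityB (M : BoundaryMatrix d) :
    (M.1.2ᴴ).rank + BoundaryCondition.nullityB (Quotient.mk _ M) = 2 * d := by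
  have h1 : BoundaryCondition.nullityB (Quotient.mk _ M) =
      Module.finrank ℂ (LinearMap.ker M.1.2.mulVecLin) := by
    rw [← Matrix.toLin'_apply', ← Module.End.eigenspace_zero]
    rfl
  rw [Matrix.rank_conjTranspose, h1, Matrix.rank, LinearMap.finrank_range_add_finrank_ker]
  simp [two_mul]

theorem le_matForm_of_close {N N₀ : Matrix (Fin d) (Fin d) ℂ} {μ δ : ℝ} (hδ : 0 ≤ δ)
    (hδμ : d ^ 2 * δ ≤ μ / 2) (hN : ∀ i j, ‖(N - N₀) i j‖ ≤ δ)
    (h : ∀ v, μ * ‖v‖ ^ 2 ≤ (matForm N₀ v v).re) (v : Fin d → ℂ) :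
    μ / 2 * ‖v‖ ^ 2 ≤ (matForm N v v).re := by
  have h1 := norm_matForm_le hδ hN v v
  have h2 : matForm (N - N₀) v v = matForm N v v - matForm N₀ v v := by
    rw [matForm_apply, matForm_apply, matForm_apply, Matrix.sub_mulVec, dotProduct_sub]
  have h3 := (neg_le_abs _).trans ((Complex.abs_re_le_norm _).trans h1)
  rw [h2, Complex.sub_re, Fintype.card_fin, ← pow_two] at h3
  have h4 := mul_le_mul_of_nonneg_right hδμ (sq_nonneg ‖v‖)
  linarith [h v]

theorem norm_apply_le_of_close {κ : Type*} {N N₀ : Matrix κ κ ℂ} {C δ : ℝ}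
    (hN : ∀ i j, ‖(N - N₀) i j‖ ≤ δ) (h : ∀ i j, ‖N₀ i j‖ ≤ C) (i j : κ) : ‖N i j‖ ≤ C + δ := by
  have e : N i j = N₀ i j + (N - N₀) i j := by rw [Matrix.sub_apply, add_sub_cancel]
  rw [e]
  exact (norm_add_le _ _).trans (add_le_add (h i j) (hN i j))

namespace Model

/-- The bounds of a problem are valid, up to constants, for neighbouring problems in the same
layer. -/
theorem exists_bounded_of_close (𝔐₀ : Model d a b) (M₀ : BoundaryMatrix d) : ∃ μ C δ : ℝ,
    0 < μ ∧ 0 ≤ C ∧ 0 < δ ∧ ∀ (𝔐 : Model d a b) (M : BoundaryMatrix d), Close 𝔐₀ 𝔐 M₀ M δ →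
      BoundaryCondition.nullityB (Quotient.mk _ M) =
        BoundaryCondition.nullityB (Quotient.mk _ M₀) → 𝔐.Bounded M μ C := by
  obtain ⟨μ, C, hμ, hC, hb⟩ := 𝔐₀.exists_bounded M₀
  obtain ⟨C', δ', hC', hδ', hl⟩ := exists_uniform_lift M₀.1.2ᴴ
  -- The three bounds on `δ` serve, in this order, the upper bounds of the entries, the uniform
  -- lift, and the preservation of half of the positivity of `P` and `W`.
  obtain ⟨δ, hδ⟩ : ∃ δ, δ = min (min 1 δ') (μ / (2 * (d ^ 2 + 1))) := ⟨_, rfl⟩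
  have hδ0 : 0 < δ := by rw [hδ]; positivity
  have hδ1 : δ ≤ 1 := hδ ▸ (min_le_left _ _).trans (min_le_left _ _)
  have hδ2 : δ ≤ δ' := hδ ▸ (min_le_left _ _).trans (min_le_right _ _)
  have hδ3 : d ^ 2 * δ ≤ μ / 2 := by
    have h1 : δ ≤ μ / (2 * (d ^ 2 + 1)) := hδ ▸ min_le_right _ _
    rw [le_div_iff₀ (by positivity)] at h1
    linarith
  refine ⟨μ / 2, C + 1 + C', δ, by positivity, by positivity, hδ0, fun 𝔐 M hcl hn => ?_⟩
  have hC1 : C + δ ≤ C + 1 + C' := by linarith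
  constructor
  · filter_upwards [hcl.closeP, hb.posP] with t h1 h2
    exact le_matForm_of_close hδ0.le hδ3 h1 h2
  · filter_upwards [hcl.closeW, hb.posW] with t h1 h2
    exact le_matForm_of_close hδ0.le hδ3 h1 h2
  · filter_upwards [hcl.closeP, hb.bddP] with t h1 h2 i j
    exact (norm_apply_le_of_close h1 h2 i j).trans hC1
  · filter_upwards [hcl.closeQ, hb.bddQ] with t h1 h2 i j
    exact (norm_apply_le_of_close h1 h2 i j).trans hC1
  · filter_upwards [hcl.closeW, hb.bddW] with t h1 h2 i j
    exact (norm_apply_le_of_close h1 h2 i j).trans hC1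
  · exact fun i j => (norm_apply_le_of_close hcl.closeM hb.bddM i j).trans hC1
  · have hr : (M.1.2ᴴ).rank = (M₀.1.2ᴴ).rank := by
      have h1 := rank_add_nullityB M
      have h2 := rank_add_nullityB M₀
      omega
    obtain ⟨S, hS⟩ := hl _ (fun i j => (hcl.closeB i j).trans hδ2) hr
    exact ⟨S, fun ξ => ⟨(hS ξ).1, (hS ξ).2.trans
      (mul_le_mul_of_nonneg_right (by linarith) (norm_nonneg _))⟩⟩

/-- Neighbouring problems in the same layer have neighbouring eigenvalues. -/
theorem exists_abs_jump_sub_lt (hab : a < b) (hd : 0 < d) (𝔐₀ : Model d a b) (M₀ : BoundaryMatrix d)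
    (n : ℕ) {ε : ℝ} (hε : 0 < ε) : ∃ δ : ℝ, 0 < δ ∧
    ∀ (𝔐 : Model d a b) (M : BoundaryMatrix d), Close 𝔐₀ 𝔐 M₀ M δ →
      BoundaryCondition.nullityB (Quotient.mk _ M) =
        BoundaryCondition.nullityB (Quotient.mk _ M₀) → |𝔐.jump M n - 𝔐₀.jump M₀ n| < ε := by
  obtain ⟨μ, C, δ₁, hμ, hC, hδ₁, hb⟩ := exists_bounded_of_close 𝔐₀ M₀
  obtain ⟨l, hl⟩ : ∃ l, l = 𝔐₀.jump M₀ n := ⟨_, rfl⟩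
  -- The comparison is used at the parameters `l + ε / 3` and `l - ε / 3`, both bounded by `|l| + ε
  -- / 3`.
  obtain ⟨δ₂, hδ₂, h⟩ := exists_index_le_of_close (L := |l| + ε / 3) (ε := ε / 3) hab d hμ hC
    (by positivity) (by positivity)
  refine ⟨min δ₁ δ₂, lt_min hδ₁ hδ₂, fun 𝔐 M hcl hn => ?_⟩
  have hb₀ := hb 𝔐₀ M₀ (Close.refl _ _ hδ₁.le) rfl
  have hb₁ := hb 𝔐 M (hcl.mono (min_le_left _ _)) hn
  have hcl₂ := hcl.mono (min_le_right δ₁ δ₂)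
  have hε3 : |ε / 3| = ε / 3 := abs_of_pos (by positivity)
  have h1 : 𝔐.jump M n < l + ε / 3 + ε / 3 := by
    refine (indexGE_iff hab hd).1 (h 𝔐₀ 𝔐 M₀ M hb₀ hb₁ hcl₂ (l + ε / 3) (n + 1) ?_ ?_)
    · exact (abs_add_le _ _).trans_eq (by rw [hε3])
    · exact (indexGE_iff hab hd).2 (by linarith)
  -- The comparison with the roles exchanged: otherwise the unperturbed problem would have index
  -- above `n` at `l` itself, which the strict inequality in `indexGE_iff` forbids.
  have h2 : l - ε / 3 ≤ 𝔐.jump M n := by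
    by_contra! hlt
    have h3 := h 𝔐 𝔐₀ M M₀ hb₁ hb₀ hcl₂.symm (l - ε / 3) (n + 1)
      ((abs_sub _ _).trans_eq (by rw [hε3])) ((indexGE_iff hab hd).2 hlt)
    rw [sub_add_cancel, indexGE_iff hab hd, ← hl] at h3
    exact lt_irrefl _ h3
  rw [← hl, abs_lt]
  constructor <;> linarith

end Model

theorem Equation.eventually_close (ω₀ : Equation d a b) (M₀ : BoundaryMatrix d) {δ : ℝ} (hδ : 0 < δ) :
    ∀ᶠ p : Equation d a b × BoundaryMatrix d in 𝓝 (ω₀, M₀),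
      Model.Close ω₀.model p.1.model M₀ p.2 δ := by
  have hcoeff : ∀ c : Equation d a b × BoundaryMatrix d → Coeff d a b, Continuous c →
      ∀ᶠ p in 𝓝 (ω₀, M₀), ‖c p - c (ω₀, M₀)‖ < δ := fun c hc => by
    have h1 : Continuous fun p => ‖c p - c (ω₀, M₀)‖ := (hc.sub continuous_const).norm
    exact h1.continuousAt.eventually_lt continuousAt_const (by simpa using hδ)
  have hmat : ∀ c : Equation d a b × BoundaryMatrix d → Matrix (Fin d ⊕ Fin d) (Fin d ⊕ Fin d) ℂ,
      Continuous c → ∀ᶠ p in 𝓝 (ω₀, M₀), ∀ i j, ‖(c p - c (ω₀, M₀)) i j‖ ≤ δ := fun c hc => by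
    refine eventually_all.2 fun i => eventually_all.2 fun j => ?_
    have h1 : Continuous fun p => ‖(c p - c (ω₀, M₀)) i j‖ :=
      ((hc.sub continuous_const).matrix_elem i j).norm
    exact (h1.continuousAt.eventually_lt continuousAt_const (by simpa using hδ)).mono
      fun _ h => h.le
  have hB : Continuous fun p : Equation d a b × BoundaryMatrix d => p.2.1.2 :=
    continuous_snd.comp (continuous_subtype_val.comp continuous_snd)
  have hA : Continuous fun p : Equation d a b × BoundaryMatrix d => p.2.1.1 :=
    continuous_fst.comp (continuous_subtype_val.comp continuous_snd)
  have hω : Continuous fun p : Equation d a b × BoundaryMatrix d => p.1.1 :=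
    continuous_subtype_val.comp continuous_fst
  filter_upwards [hcoeff (fun p => p.1.P) (continuous_fst.comp hω),
    hcoeff (fun p => p.1.Q) (continuous_fst.comp (continuous_snd.comp hω)),
    hcoeff (fun p => p.1.W) (continuous_snd.comp (continuous_snd.comp hω)),
    hmat (fun p => p.2.1.2 * p.2.1.1ᴴ) (hB.matrix_mul hA.matrix_conjTranspose),
    hmat (fun p => p.2.1.2ᴴ) hB.matrix_conjTranspose] with p h1 h2 h3 h4 h5
  refine ⟨?_, ?_, ?_, h4, h5⟩
  · filter_upwards [ω₀.model_P_ae, p.1.model_P_ae, ω₀.P.ae_norm_sub_le p.1.P] with t e1 e2 h i j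
    rw [e1, e2]
    exact (h i j).trans h1.le
  · filter_upwards [ω₀.model_Q_ae, p.1.model_Q_ae, ω₀.Q.ae_norm_sub_le p.1.Q] with t e1 e2 h i j
    rw [e1, e2]
    exact (h i j).trans h2.le
  · filter_upwards [ω₀.model_W_ae, p.1.model_W_ae, ω₀.W.ae_norm_sub_le p.1.W] with t e1 e2 h i j
    rw [e1, e2]
    exact (h i j).trans h3.le

/-- The action of an invertible matrix on `(A | B)`. -/
noncomputable def BoundaryMatrix.act (T : Matrix (Fin d ⊕ Fin d) (Fin d ⊕ Fin d) ℂ)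
    (hT : IsUnit T.det) (M : BoundaryMatrix d) : BoundaryMatrix d :=
  ⟨(T * M.1.1, T * M.1.2), by
    rw [← Matrix.mul_fromCols, Matrix.rank_mul_eq_right_of_isUnit_det _ _ hT]
    exact M.2.1, by
    rw [Matrix.conjTranspose_mul, Matrix.conjTranspose_mul, Matrix.mul_assoc, Matrix.mul_assoc,
      ← Matrix.mul_assoc M.1.1, ← Matrix.mul_assoc M.1.2, M.2.2]⟩

/-- The saturation of an open set is the union of its preimages under the continuous maps `(A | B) ↦
(TA | TB)`, and is therefore open. -/
theorem isOpenMap_mk_boundaryCondition :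
    IsOpenMap (Quotient.mk (boundarySetoid d) : BoundaryMatrix d → BoundaryCondition d) := by
  intro U hU
  have e : (Quotient.mk (boundarySetoid d)) ⁻¹' (Quotient.mk (boundarySetoid d) '' U) =
      ⋃ (T : Matrix (Fin d ⊕ Fin d) (Fin d ⊕ Fin d) ℂ) (hT : IsUnit T.det),
        BoundaryMatrix.act T hT ⁻¹' U := by
    ext M
    simp only [mem_preimage, mem_image, mem_iUnion]
    constructor
    · rintro ⟨N, hN, h⟩
      obtain ⟨T, hT, h1, h2⟩ := Quotient.exact h.symm
      exact ⟨T, hT, (Subtype.ext (Prod.ext h1 h2) : N = BoundaryMatrix.act T hT M) ▸ hN⟩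
    · rintro ⟨T, hT, h⟩
      have h1 : M ≈ BoundaryMatrix.act T hT M := ⟨T, hT, rfl, rfl⟩
      exact ⟨_, h, (Quotient.sound h1).symm⟩
  rw [← isQuotientMap_quotient_mk'.isOpen_preimage]
  change IsOpen ((Quotient.mk (boundarySetoid d)) ⁻¹' (Quotient.mk (boundarySetoid d) '' U))
  rw [e]
  refine isOpen_iUnion fun T => isOpen_iUnion fun hT => hU.preimage ?_
  exact ((continuous_const.matrix_mul (continuous_fst.comp continuous_subtype_val)).prodMk
    (continuous_const.matrix_mul (continuous_snd.comp continuous_subtype_val))).subtype_mk _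

/-- Openness of the quotient map, and of its product with the identity, carries a neighbourhood of a
representative to a neighbourhood of its class. So continuity may be tested on one representative,
where the comparison of jumps applies. -/
theorem continuousOn_nthEigenvalue (hab : a < b) (hd : 0 < d) (n k : ℕ) :
    ContinuousOn (fun p : Equation d a b × BoundaryCondition d => nthEigenvalue p.1 p.2 n)
      (univ ×ˢ layer d k) := by
  rintro ⟨ω₀, bc₀⟩ ⟨-, h₀⟩
  obtain ⟨M₀, rfl⟩ := Quotient.exists_rep bc₀
  rw [ContinuousWithinAt, Metric.tendsto_nhds]
  intro ε hε
  obtain ⟨δ, hδ, h⟩ := ω₀.model.exists_abs_jump_sub_lt hab hd M₀ (n - 1) hε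
  have hopen : IsOpenMap (Prod.map id (Quotient.mk (boundarySetoid d)) :
      Equation d a b × BoundaryMatrix d → Equation d a b × BoundaryCondition d) :=
    IsOpenMap.id.prodMap isOpenMap_mk_boundaryCondition
  rw [eventually_nhdsWithin_iff]
  filter_upwards [hopen.image_mem_nhds (ω₀.eventually_close M₀ hδ)]
  rintro _ ⟨⟨ω, M⟩, hcl, rfl⟩ ⟨-, hk⟩
  have hk₀ : BoundaryCondition.nullityB (Quotient.mk (boundarySetoid d) M₀) = k := h₀
  have hk₁ : BoundaryCondition.nullityB (Quotient.mk (boundarySetoid d) M) = k := hk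
  have h1 := h ω.model M hcl (hk₁.trans hk₀.symm)
  rw [← nthEigenvalue_eq hab hd, ← nthEigenvalue_eq hab hd] at h1
  exact h1

end Continuity
end SturmLiouville

/-! ### The eigenvalue sequence and its continuity on the layers. -/

theorem theorem6p1 (d : ℕ) (hd : 2 ≤ d) (a b : ℝ) (hab : a < b) :
    (∀ (ω : SturmLiouville.Equation d a b) (bc : SturmLiouville.BoundaryCondition d),
      SturmLiouville.IsEigenvalueSequence ω bc
        (fun n => SturmLiouville.nthEigenvalue ω bc (n + 1))) ∧
    ∀ n : ℕ, 1 ≤ n → ∀ k : ℕ, k ≤ 2 * d →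
      ContinuousOn
        (fun p : SturmLiouville.Equation d a b × SturmLiouville.BoundaryCondition d =>
          SturmLiouville.nthEigenvalue p.1 p.2 n)
        (Set.univ ×ˢ SturmLiouville.layer d k) := by
  have hd0 : 0 < d := by omega
  refine ⟨fun ω bc => ?_, fun n _ k _ => SturmLiouville.continuousOn_nthEigenvalue hab hd0 n k⟩
  obtain ⟨M, rfl⟩ := Quotient.exists_rep bc
  -- Eigenvalues are numbered from one and jumps from zero; the two shifts cancel.
  simp only [SturmLiouville.nthEigenvalue_eq hab hd0, Nat.add_sub_cancel]
  exact SturmLiouville.isEigenvalueSequence_jump hab hd0 ω M
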